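/- **Model (PRP system).** For each integer $j$ let $\lambda_{0,j},\lambda_{1,j},\delta_j\in[0,\infty)$ be rates, let $Z_{1,j}$ be a random variable with values in $\{1,2,\dots\}$ (batch size), let $R_j$ be a random variable with values in $\{0,1,2,\dots\}$ (number of removals), and let $F_j$ be a probability law on $[0,\infty)$ (work of a customer with label $j$). At time $0$ customers with labels $n_0,n_0-1,n_0-2,\dots$ are present, none of them served yet. The server works at unit speed, always on the customer with the highest label among those present, in last-come-first-served preemptive-resume order. The works of all customers are independent, a customer with label $n$ having work of law $F_n$. Events are driven by Poisson processes that are independent of each other and of the works: for each $j$, processes of rate $\lambda_{0,j}$ (single arrivals), $\lambda_{1,j}P(Z_{1,j}=m)$ for $m\ge 1$ (arrivals of batches of size $m$), and $\delta_jP(R_j=m)$ for $m\ge0$ (catastrophes that remove $m$ customers). The processes with index $j$ are active exactly while the customer in service has label $j$; points of inactive processes are ignored. At a point of an active single (batch) arrival process, one customer ($m$ customers) with label $j+1$ (labels $j+1,\dots,j+m$) and fresh work arrives, and service of the customer with the highest label begins. At a point of an active catastrophe process the customers $j,j-1,\dots,j-m+1$ are removed, and the service of customer $j-m$ is resumed or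 begun. When a customer $j$ is completed, the server turns to customer $j-1$ and resumes where it left off. $Q(t)$ is the label of the customer in service at time $t$, with $Q$ started from $n_0$. If infinitely many events occur before or at a finite time, then from the first such time on $Q$ is set to $+\infty$ if the levels visited before are bounded below and to $-\infty$ otherwise. For an integer $l$, the system $Q_l$ reflected at $l$ evolves in the same way, except that a catastrophe which would lead to a level at or below $l$ leads to level $l$ instead, and that the server does not work while the level is $l$, until the next arrival. **Theorem.** Let $k\ge 0$ and $l\le n_0$ be integers and let $q>0$. Let $Q$ be a PRP system started at $n_0$, and let $Q_l$ be the system with the same parameters, reflected at $l$ and started at $l$. Let $e_q$ be an exponential random variable with rate $q$, independent of $Q$, respectively of $Q_l$. If $P(\inf_{0\le u\le e_q}Q(u)=l)>0$, then $$P(Q_l(e_q)=k+l\mid Q_l(0)=l)=P\Big(Q(e_q)=k+l\;\Big|\;\inf_{0\le u\le e_q}Q(u)=l\Big)=P\Big(Q(e_q)-\inf_{0\le u\le e_q}Q(u)=k\;\Big|\;\inf_{0\le u\le e_q}Q(u)=l\Big).$$ -/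

import Mathlib

open MeasureTheory ProbabilityTheory
open scoped NNReal ENNReal

namespace PRP

/-- The parameters of a preemptive-resume production (PRP) system. Everything may depend on the
level (the label of the customer in service). -/
structure Params where
  /-- `singleRate j`: rate of the single arrivals while the level is `j` -/
  singleRate : ℤ → ℝ≥0
  /-- `batchRate j`: rate of the batch arrivals while the level is `j` -/
  batchRate : ℤ → ℝ≥0
  /-- `batchSize j`: law of the size of a batch that arrives at level `j` -/
  batchSize : ℤ → PMF ℕ+
  /-- `catRate j`: rate of the catastrophes while the level is `j` -/
  catRate : ℤ → ℝ≥0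
  /-- `catSize j`: law of the number of customers removed by a catastrophe at level `j` -/
  catSize : ℤ → PMF ℕ
  /-- `work n`: law of the amount of work brought by a customer with label `n` -/
  work : ℤ → ProbabilityMeasure ℝ≥0

/-- The index set of the driving Poisson processes. -/
inductive Clock
  /-- single arrivals, active at level `j`: they push the level from `j` to `j + 1` -/
  | single (j : ℤ)
  /-- arrivals of batches of size `m`, active at level `j`: from `j` to `j + m` -/
  | batch (j : ℤ) (m : ℕ+)
  /-- catastrophes that remove `m` customers, active at level `j`: from `j` to `j - m` -/
  | catastrophe (j : ℤ) (m : ℕ)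

/-- The level at which a driving process is active. -/
def Clock.source : Clock → ℤ
  | .single j => j
  | .batch j _ => j
  | .catastrophe j _ => j

/-- The level to which a point of an active driving process moves the unreflected system. -/
def Clock.target : Clock → ℤ
  | .single j => j + 1
  | .batch j m => j + (m : ℕ)
  | .catastrophe j m => j - m

/-- The rates of the driving Poisson processes. -/
noncomputable def Clock.rate (S : Params) : Clock → ℝ≥0∞
  | .single j => S.singleRate j
  | .batch j m => S.batchRate j * S.batchSize j m
  | .catastrophe j m => S.catRate j * S.catSize j m

/-- The random elements from which a system is built: for each clock `a` the unit exponential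
variables `gap a 0, gap a 1, …`, which yield its Poisson process, and the works. `work 0 n` is the
work of the customer with label `n` among the customers that are present at time zero, and
`work (m + 1) n` is the work of the customer, if there is one, that receives label `n` at the
`(m + 1)`-st event of the system. -/
structure Input where
  gap : Clock → ℕ → ℝ≥0
  work : ℕ → ℤ → ℝ≥0

/-- The `i`-th point (`i = 0, 1, …`) of the Poisson process with index `a`: a sum of `i + 1`
independent exponential variables of rate `a.rate S`. If the rate is zero, then there are no
points, i.e. all of them are at infinity. -/
noncomputable def point (S : Params) (x : Input) (a : Clock) (i : ℕ) : ℝ≥0∞ :=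
  ((∑ j ∈ Finset.range (i + 1), x.gap a j : ℝ≥0) : ℝ≥0∞) / a.rate S

/-- The system just after an event: the time of the event, the label of the customer in service,
and the residual work of the customers that are present (the entries of `resid` at labels larger
than `level` have no meaning). -/
structure State where
  time : ℝ≥0∞
  level : ℤ
  resid : ℤ → ℝ≥0∞

/-- The first point, after the time of `s`, of the driving processes active at the level of `s`. -/
noncomputable def nextPoint (S : Params) (x : Input) (s : State) : ℝ≥0∞ :=
  ⨅ (a : Clock) (_ : a.source = s.level) (i : ℕ) (_ : s.time < point S x a i), point S x a i

open Classical in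
/-- The time at which the customer in service would finish if there were no interruption. The
barrier `b` is `none` for the unreflected system and `some l` for the system reflected at `l`,
whose server does not work at level `l`. -/
noncomputable def completion (b : Option ℤ) (s : State) : ℝ≥0∞ :=
  if b = some s.level then ⊤ else s.time + s.resid s.level

/-- The level reached by a jump that would lead to `n` if there were no barrier. -/
def reflectAt (b : Option ℤ) (n : ℤ) : ℤ :=
  match b with
  | none => n
  | some l => max l n

open Classical in
/-- From one event to the next (a service completion, an arrival or a catastrophe). `fresh n` is
the work of a customer that receives label `n` at the next event. If there is no next event, its
time is infinite. -/
noncomputable def step (S : Params) (b : Option ℤ) (x : Input) (fresh : ℤ → ℝ≥0) (s : State) :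
    State :=
  if completion b s = ⊤ ∧ nextPoint S x s = ⊤ then
    { s with time := ⊤ }
  else if completion b s ≤ nextPoint S x s then
    { time := completion b s, level := s.level - 1, resid := s.resid }
  else
    let t := nextPoint S x s
    -- the (almost surely existing and unique) active process that has a point at time `t`
    let m := if h : ∃ a : Clock, a.source = s.level ∧ ∃ i, point S x a i = t
      then reflectAt b h.choose.target else s.level
    { time := t
      level := m
      resid := fun n =>
        if s.level < n ∧ n ≤ m then (fresh n : ℝ≥0∞)
        else if n = s.level then s.resid n - (t - s.time)
        else s.resid n }

/-- The system with barrier `b`, started at level `n₀` with customers `n₀, n₀ - 1, …` (of which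
none has been served yet), just after its `m`-th event; `m = 0` is time zero. -/
noncomputable def state (S : Params) (b : Option ℤ) (n₀ : ℤ) (x : Input) : ℕ → State
  | 0 => { time := 0, level := n₀, resid := fun n => (x.work 0 n : ℝ≥0∞) }
  | m + 1 => step S b x (x.work (m + 1)) (state S b n₀ x m)

open Classical in
/-- The label of the customer in service at time `t`. It is an integer up to the time at which
infinitely many events have occurred; from then on (if this time is finite) it is `⊤` or `⊥`,
according as the levels visited before were bounded below or not. -/
noncomputable def path (S : Params) (b : Option ℤ) (n₀ : ℤ) (x : Input) (t : ℝ≥0) : EReal :=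
  if h : ∃ m, (state S b n₀ x m).time ≤ t ∧ (t : ℝ≥0∞) < (state S b n₀ x (m + 1)).time then
    (((state S b n₀ x h.choose).level : ℝ) : EReal)
  else if BddBelow (Set.range fun m => (state S b n₀ x m).level) then ⊤
  else ⊥

/-- The path of the PRP system started at `n₀`. -/
noncomputable def Q (S : Params) (n₀ : ℤ) (x : Input) : ℝ≥0 → EReal := path S none n₀ x

/-- The path of the PRP system reflected at level `l` and started at level `l`. -/
noncomputable def Qrefl (S : Params) (l : ℤ) (x : Input) : ℝ≥0 → EReal := path S (some l) l x

/-- The running infimum of a path. -/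
noncomputable def runningInf (f : ℝ≥0 → EReal) (t : ℝ≥0) : EReal := ⨅ u ∈ Set.Icc 0 t, f u

/-- The random input `X` of a PRP system with parameters `S`: the Poisson processes are independent
of each other and of the works, and all works are independent, with the prescribed laws. -/
structure IsInput {Ω : Type*} [MeasurableSpace Ω] (S : Params) (P : Measure Ω)
    (X : Ω → Input) : Prop where
  gap_law : ∀ a i, HasLaw (fun ω => ((X ω).gap a i : ℝ)) (expMeasure 1) P
  work_law : ∀ m n, HasLaw (fun ω => (X ω).work m n) (S.work n : Measure ℝ≥0) P
  indep : iIndepFun (β := fun _ : (Clock × ℕ) ⊕ (ℕ × ℤ) => ℝ≥0)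
    (fun c ω => c.elim (fun p => (X ω).gap p.1 p.2) (fun p => (X ω).work p.1 p.2)) P

/-- `e` is an exponential random variable with rate `q` that is independent of the process `Y`. -/
structure IsExpTime {Ω : Type*} [MeasurableSpace Ω] (P : Measure Ω) (q : ℝ) (e : Ω → ℝ≥0)
    (Y : Ω → ℝ≥0 → EReal) : Prop where
  law : HasLaw (fun ω => (e ω : ℝ)) (expMeasure q) P
  indep : IndepFun e Y P

end PRP

open MeasureTheory ProbabilityTheory
open scoped NNReal ENNReal

/-! ### Exponential laws and discount factors -/

namespace PRP

/-! Cut the trajectory at its visits to level `l`. After a jump away from `l`, and as long as the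
level stays above `l`, only customers who arrived since that jump are served. The excursion is thus
built from fresh works and from the clocks alone, and does not see the residual work of customer
`l`. Put `v = k + l`, let `Λ` be the total rate of the clocks active at `l`, and let `D(w)` be the
integral of `exp(-(Λ + q)s)` over `0 ≤ s < w`. A stay at `l` with residual work `w` is a race. The
outcome "the exponential time falls at level `v` before the next entry into levels at or below `l`"
is attained at a rate `A` (`outcomeRate`) that does not depend on `w`. The outcome "the exponential
time falls before that entry" has a rate `T` (`outcomeRateTotal`), which also counts exponential
times after an explosion to `+∞`.

Start at `l` with residual works `r`. Let `u(r)` be the probability of being at `v` at the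
exponential time without having been below `l` (`stayAt`), and `p(r)` that of not having been below
`l` (one minus `passBelow`). Decomposition at the next visit to `l` gives `u = A D(r l) + R u` and
`p = T D(r l) + R p` with the same linear operator `R` (`returnOp`), by `stayAt_self` and
`one_sub_passBelow_self`. Since `R 1 ≤ Λ / (Λ + q) < 1`, bounded solutions are unique, and therefore
`T u = A p` for every `r` (`stayAt_mul_outcomeRateTotal`).

In the reflected system the server rests at `l`, so `D(r l)` becomes `D(⊤) = 1 / (Λ + q)`, and the
jumps whose excursion enters a level at or below `l` lead back to `l`. The excursions above `l` are
the same, hence so are `A` and `T`, and the constant `A / T` solves the equation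
(`stayAt_some_mul_outcomeRateTotal`). For the unreflected system started at `n₀`, the infimum is `l`
exactly when `l` is visited before any lower level and no lower level follows. Integration of `u`
and of `p` over the first visit to `l` gives the joint probability and that of the condition, so
their quotient is again `A / T`.

What remains is the Markov property. Shifted Poisson processes are again Poisson processes, and the
first ring among competing clocks is independent of what follows it. The expected discounted
indicators of level sequences are therefore iterates of one transition operator, and the sums over
the number of events are resolvents. Lemmas on paths identify the events of the theorem with events
of the embedded chain. -/

/-- Lebesgue measure on the nonnegative half-line. -/
noncomputable def leb : Measure ℝ≥0 := (volume.restrict (Set.Ici 0)).map Real.toNNReal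

/-- The discount factor `exp (-c T)`, which vanishes at `T = ⊤`. -/
noncomputable def disc (c : ℝ≥0) (T : ℝ≥0∞) : ℝ≥0∞ :=
  if T = ⊤ then 0 else ENNReal.ofReal (Real.exp (-(c * T.toReal)))

/-- The standard exponential law on `ℝ≥0`. -/
noncomputable def stdExp : Measure ℝ≥0 := (expMeasure 1).map Real.toNNReal

instance : IsProbabilityMeasure stdExp := by
  have := isProbabilityMeasure_expMeasure (r := 1) one_pos
  exact Measure.isProbabilityMeasure_map (by fun_prop)

@[simp] lemma disc_top (c : ℝ≥0) : disc c ⊤ = 0 := by simp [disc]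

lemma disc_coe (c s : ℝ≥0) : disc c s = ENNReal.ofReal (Real.exp (-(c * s))) := by simp [disc]

@[simp] lemma disc_zero (c : ℝ≥0) : disc c 0 = 1 := by simp [disc]

lemma disc_le_one (c : ℝ≥0) (T : ℝ≥0∞) : disc c T ≤ 1 := by
  unfold disc
  split_ifs
  · simp
  · rw [ENNReal.ofReal_le_one, Real.exp_le_one_iff]
    have : 0 ≤ (c : ℝ) * T.toReal := by positivity
    linarith

lemma disc_add (c : ℝ≥0) (s t : ℝ≥0∞) : disc c (s + t) = disc c s * disc c t := by
  unfold disc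
  by_cases hs : s = ⊤
  · simp [hs]
  by_cases ht : t = ⊤
  · simp [ht]
  rw [if_neg (by simp [hs, ht]), if_neg hs, if_neg ht, ← ENNReal.ofReal_mul (Real.exp_nonneg _),
    ← Real.exp_add, ENNReal.toReal_add hs ht]
  ring_nf

lemma disc_add_rate (c d : ℝ≥0) (T : ℝ≥0∞) : disc (c + d) T = disc c T * disc d T := by
  unfold disc
  split_ifs
  · simp
  · rw [← ENNReal.ofReal_mul (Real.exp_nonneg _), ← Real.exp_add]
    push_cast
    ring_nf

lemma disc_smul (c d s : ℝ≥0) : disc c (d * s : ℝ≥0) = disc (c * d) s := by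
  simp only [disc_coe]
  push_cast
  ring_nf

lemma disc_anti (c : ℝ≥0) : Antitone (disc c) := by
  intro s t h
  obtain ⟨u, rfl⟩ := exists_add_of_le h
  rw [disc_add]
  exact mul_le_of_le_one_right' (disc_le_one _ _)

lemma disc_pos (c : ℝ≥0) {T : ℝ≥0∞} (hT : T ≠ ⊤) : 0 < disc c T := by
  simp [disc, hT, Real.exp_pos]

lemma disc_lt_disc {c : ℝ≥0} (hc : 0 < c) {s t : ℝ≥0∞} (h : s < t) : disc c t < disc c s := by
  by_cases ht : t = ⊤
  · subst ht; simpa using disc_pos c h.ne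
  · have hs := h.ne_top
    simp only [disc, hs, ht, if_false]
    rw [ENNReal.ofReal_lt_ofReal_iff (Real.exp_pos _), Real.exp_lt_exp]
    have := (ENNReal.toReal_lt_toReal hs ht).2 h
    have hc' : (0 : ℝ) < c := hc
    nlinarith

lemma disc_le_disc_iff {c : ℝ≥0} (hc : 0 < c) {s t : ℝ≥0∞} : disc c s ≤ disc c t ↔ t ≤ s := by
  constructor
  · intro h
    by_contra! h'
    exact absurd h (disc_lt_disc hc h').not_ge
  · exact fun h => disc_anti c h

@[fun_prop]
lemma measurable_disc (c : ℝ≥0) : Measurable (disc c) := (disc_anti c).measurable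

lemma lintegral_leb {f : ℝ≥0 → ℝ≥0∞} (hf : Measurable f) :
    ∫⁻ s, f s ∂leb = ∫⁻ x in Set.Ici (0 : ℝ), f x.toNNReal := by
  rw [leb, lintegral_map hf (by fun_prop)]

instance : SFinite leb := by unfold leb; infer_instance

lemma lintegral_exp_law {f : ℝ≥0 → ℝ≥0∞} (hf : Measurable f) {q : ℝ≥0} (hq : 0 < q) :
    ∫⁻ x, f x.toNNReal ∂(expMeasure q) = q * ∫⁻ s, disc q s * f s ∂leb := by
  rw [lintegral_leb (by fun_prop), ← lintegral_const_mul _ (by fun_prop)]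
  have : expMeasure q = volume.withDensity (exponentialPDF q) := rfl
  have hm : Measurable (exponentialPDF q) := (measurable_exponentialPDFReal q).ennreal_ofReal
  rw [this, lintegral_withDensity_eq_lintegral_mul _ hm (by fun_prop),
    ← lintegral_indicator measurableSet_Ici]
  refine lintegral_congr fun x => ?_
  by_cases hx : 0 ≤ x
  · have hx' : x ∈ Set.Ici (0 : ℝ) := hx
    rw [Set.indicator_of_mem hx']
    simp only [Pi.mul_apply, exponentialPDF_of_nonneg hx, disc_coe, Real.coe_toNNReal x hx]
    rw [ENNReal.ofReal_mul (by positivity), ENNReal.ofReal_coe_nnreal, mul_assoc]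
  · have hx' : x ∉ Set.Ici (0 : ℝ) := hx
    rw [Set.indicator_of_notMem hx']
    simp [exponentialPDF_of_neg (not_le.1 hx)]

lemma lintegral_stdExp {f : ℝ≥0 → ℝ≥0∞} (hf : Measurable f) :
    ∫⁻ u, f u ∂stdExp = ∫⁻ u, disc 1 u * f u ∂leb := by
  rw [stdExp, lintegral_map hf (by fun_prop)]
  simpa using lintegral_exp_law hf (q := 1) one_pos

lemma lintegral_leb_div {f : ℝ≥0 → ℝ≥0∞} (hf : Measurable f) {r : ℝ≥0} (hr : r ≠ 0) :
    ∫⁻ u, f (u / r) ∂leb = r * ∫⁻ s, f s ∂leb := by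
  rw [lintegral_leb (by fun_prop), lintegral_leb hf]
  have h0 : (0 : ℝ) < r := by positivity
  rw [← lintegral_indicator measurableSet_Ici, ← lintegral_indicator measurableSet_Ici]
  have hm : Measurable ((Set.Ici (0 : ℝ)).indicator fun x => f x.toNNReal) :=
    Measurable.indicator (by fun_prop) measurableSet_Ici
  have h1 := congrArg (fun m => ∫⁻ x, (Set.Ici (0 : ℝ)).indicator (fun x => f x.toNNReal) x ∂m)
    (Real.map_volume_mul_left (a := (r : ℝ)⁻¹) (by positivity))
  rw [lintegral_map hm (by fun_prop), lintegral_smul_measure] at h1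
  rw [inv_inv, abs_of_pos h0, ENNReal.ofReal_coe_nnreal, smul_eq_mul] at h1
  rw [← h1]
  refine lintegral_congr fun x => ?_
  by_cases hx : 0 ≤ x
  · rw [Set.indicator_of_mem (by exact hx),
      Set.indicator_of_mem (by simp only [Set.mem_Ici]; positivity)]
    congr 1
    rw [mul_comm, ← div_eq_mul_inv, Real.toNNReal_div hx, Real.toNNReal_coe]
  · rw [Set.indicator_of_notMem (by exact hx), Set.indicator_of_notMem]
    simp only [Set.mem_Ici, not_le] at hx ⊢
    exact mul_neg_of_pos_of_neg (by positivity) hx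

lemma lintegral_leb_add {f : ℝ≥0 → ℝ≥0∞} (hf : Measurable f) (c : ℝ≥0) :
    ∫⁻ u, (Set.Ici c).indicator (fun u => f (u - c)) u ∂leb = ∫⁻ s, f s ∂leb := by
  rw [lintegral_leb (Measurable.indicator (by fun_prop) measurableSet_Ici), lintegral_leb hf,
    ← lintegral_indicator measurableSet_Ici, ← lintegral_indicator measurableSet_Ici,
    ← lintegral_sub_right_eq_self ((Set.Ici (0 : ℝ)).indicator fun x => f x.toNNReal) (c : ℝ)]
  refine lintegral_congr fun x => ?_
  by_cases hx : (c : ℝ) ≤ x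
  · have h0 : 0 ≤ x := c.2.trans hx
    rw [Set.indicator_of_mem (by exact h0), Set.indicator_of_mem, Set.indicator_of_mem]
    · rw [NNReal.sub_def, Real.coe_toNNReal x h0]
    · simpa using hx
    · simpa [Real.le_toNNReal_iff_coe_le h0] using hx
  · rw [Set.indicator_of_notMem (a := x - c) (by simpa using hx)]
    by_cases h0 : 0 ≤ x
    · rw [Set.indicator_of_mem (by exact h0), Set.indicator_of_notMem]
      simpa [Real.le_toNNReal_iff_coe_le h0] using hx
    · rw [Set.indicator_of_notMem (by exact h0)]

lemma expMeasure_Iio {c : ℝ≥0} (hc : 0 < c) (w : ℝ≥0) :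
    expMeasure c (Set.Iic w) = 1 - disc c w := by
  have hp := isProbabilityMeasure_expMeasure (r := c) (by exact_mod_cast hc)
  have h := cdf_expMeasure_eq (r := c) (by exact_mod_cast hc) w
  rw [cdf_eq_real, if_pos w.coe_nonneg] at h
  rw [← ofReal_measureReal, h, ENNReal.ofReal_sub _ (Real.exp_nonneg _), disc_coe]
  simp

lemma stdExp_singleton (w : ℝ≥0) : stdExp {w} = 0 := by
  rw [← lintegral_indicator_one (measurableSet_singleton w),
    lintegral_stdExp (measurable_one.indicator (measurableSet_singleton w)), lintegral_leb
    (f := fun u => disc 1 u * ({w} : Set ℝ≥0).indicator 1 u)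
    (Measurable.mul (by fun_prop) (measurable_one.indicator (measurableSet_singleton w))),
    ← lintegral_indicator measurableSet_Ici]
  refine (lintegral_congr_ae (g := 0) ?_).trans (by simp)
  filter_upwards [compl_mem_ae_iff.2 (Real.volume_singleton (a := (w : ℝ)))] with x hx
  by_cases h0 : 0 ≤ x
  · have : x.toNNReal ≠ w := fun h => hx (by simp [← h, h0])
    simp [this]
  · simp [h0]

/-- An exponential variable of rate `c` falls either before `w` or not. The additive form avoids
subtraction in `ℝ≥0∞` and covers `w = ⊤`. -/
lemma lintegral_leb_disc_Iio {c : ℝ≥0} (hc : c ≠ 0) (w : ℝ≥0∞) :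
    c * ∫⁻ s, {s : ℝ≥0 | (s : ℝ≥0∞) < w}.indicator (fun s => disc c s) s ∂leb + disc c w = 1 := by
  have hc' : 0 < c := pos_iff_ne_zero.2 hc
  have hp := isProbabilityMeasure_expMeasure (r := c) (by exact_mod_cast hc')
  have hm (w : ℝ≥0∞) : MeasurableSet {s : ℝ≥0 | (s : ℝ≥0∞) < w} :=
    measurableSet_lt (by fun_prop) (by fun_prop)
  have h1 := lintegral_exp_law (f := {s : ℝ≥0 | (s : ℝ≥0∞) < w}.indicator 1)
    (measurable_one.indicator (hm w)) hc'
  have h2 : ∀ s : ℝ≥0, disc c s * {s : ℝ≥0 | (s : ℝ≥0∞) < w}.indicator 1 s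
      = {s : ℝ≥0 | (s : ℝ≥0∞) < w}.indicator (fun s => disc c s) s := by
    intro s
    by_cases h : (s : ℝ≥0∞) < w
    · rw [Set.indicator_of_mem (by exact h), Set.indicator_of_mem (by exact h)]; simp
    · rw [Set.indicator_of_notMem (by exact h), Set.indicator_of_notMem (by exact h)]; simp
  simp only [h2] at h1
  rw [← h1]
  have h3 : (fun x : ℝ => {s : ℝ≥0 | (s : ℝ≥0∞) < w}.indicator (1 : ℝ≥0 → ℝ≥0∞) x.toNNReal)
      = (Real.toNNReal ⁻¹' {s : ℝ≥0 | (s : ℝ≥0∞) < w}).indicator 1 := rfl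
  rw [h3, lintegral_indicator_one (measurable_real_toNNReal (hm w))]
  induction w using ENNReal.recTopCoe with
  | top => simp
  | coe w =>
    have h4 : (expMeasure c) (Real.toNNReal ⁻¹' {s : ℝ≥0 | (s : ℝ≥0∞) < w}) =
        expMeasure c (Set.Iic w) := by
      have hac : expMeasure c ≪ volume := withDensity_absolutelyContinuous _ _
      refine measure_congr ?_
      have h0 : ∀ᵐ x ∂(expMeasure c), 0 ≤ x := by
        rw [ae_iff]
        have : expMeasure c = volume.withDensity (exponentialPDF c) := rfl
        rw [this, withDensity_apply _ (by measurability)]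
        have : {x : ℝ | ¬ 0 ≤ x} = Set.Iio 0 := by ext; simp
        rw [this, lintegral_exponentialPDF_of_nonpos le_rfl]
      filter_upwards [h0, hac.ae_le (compl_mem_ae_iff.2 (Real.volume_singleton (a := (w : ℝ))))]
        with x hx hxw
      have hxw' : x ≠ w := hxw
      refine propext ?_
      change (x.toNNReal : ℝ≥0∞) < w ↔ x ≤ w
      rw [ENNReal.coe_lt_coe, Real.toNNReal_lt_iff_lt_coe hx]
      exact ⟨le_of_lt, fun h => lt_of_le_of_ne h hxw'⟩
    rw [h4, expMeasure_Iio hc', tsub_add_cancel_of_le (disc_le_one _ _)]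

lemma stdExp_Ici (c : ℝ≥0) : stdExp (Set.Ici c) = disc 1 c := by
  have h := lintegral_leb_add (f := fun s => disc 1 s) (by fun_prop) c
  have h1 := lintegral_leb_disc_Iio (c := 1) one_ne_zero ⊤
  simp only [ENNReal.coe_lt_top, Set.ofPred_true, Set.indicator_univ, disc_top, add_zero,
    ENNReal.coe_one, one_mul] at h1
  rw [← lintegral_indicator_one measurableSet_Ici,
    lintegral_stdExp (measurable_one.indicator measurableSet_Ici),
    ← mul_one (disc 1 c), ← h1, ← h, ← lintegral_const_mul _
      (Measurable.indicator (by fun_prop) measurableSet_Ici)]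
  refine lintegral_congr fun s => ?_
  by_cases hs : c ≤ s
  · rw [Set.indicator_of_mem (by exact hs), Set.indicator_of_mem (by exact hs), ← disc_add,
      ← ENNReal.coe_add, add_tsub_cancel_of_le hs]
    simp
  · rw [Set.indicator_of_notMem (by exact hs), Set.indicator_of_notMem (by exact hs)]
    simp

/-- The exponential law is memoryless. -/
lemma lintegral_stdExp_sub {f : ℝ≥0 → ℝ≥0∞} (hf : Measurable f) (c : ℝ≥0) :
    ∫⁻ u, (Set.Ici c).indicator (fun u => f (u - c)) u ∂stdExp
      = disc 1 c * ∫⁻ u, f u ∂stdExp := by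
  rw [lintegral_stdExp (Measurable.indicator (by fun_prop) measurableSet_Ici),
    lintegral_stdExp hf, ← lintegral_const_mul _ (by fun_prop),
    ← lintegral_leb_add (f := fun u => disc 1 c * (disc 1 u * f u)) (by fun_prop) c]
  refine lintegral_congr fun s => ?_
  by_cases hs : c ≤ s
  · rw [Set.indicator_of_mem (by exact hs), Set.indicator_of_mem (by exact hs), ← mul_assoc,
      ← disc_add, ← ENNReal.coe_add, add_tsub_cancel_of_le hs]
  · rw [Set.indicator_of_notMem (by exact hs), Set.indicator_of_notMem (by exact hs)]
    simp

end PRP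

/-! ### Stationarity of a single Poisson process -/

namespace PRP

section Product

/-- The sequence with first entry `u`, followed by the sequence `g`. -/
def seqCons {α : Type*} (u : α) (g : ℕ → α) : ℕ → α
  | 0 => u
  | n + 1 => g n

@[simp] lemma seqCons_zero {α : Type*} (u : α) (g : ℕ → α) : seqCons u g 0 = u := rfl
@[simp] lemma seqCons_succ {α : Type*} (u : α) (g : ℕ → α) (n : ℕ) :
    seqCons u g (n + 1) = g n := rfl

lemma seqCons_self {α : Type*} (g : ℕ → α) : seqCons (g 0) (fun n => g (n + 1)) = g := by
  ext n; cases n <;> rfl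

variable {α : Type*} [MeasurableSpace α]

lemma measurable_seqCons : Measurable fun p : α × (ℕ → α) => seqCons p.1 p.2 := by
  refine measurable_pi_iff.2 fun n => ?_
  cases n with
  | zero => exact measurable_fst
  | succ n => exact (measurable_pi_apply n).comp measurable_snd

/-- An independent entry put in front of an i.i.d. sequence gives an i.i.d. sequence. This is what
allows conditioning on the first gap. -/
lemma map_seqCons (μ : Measure α) [IsProbabilityMeasure μ] :
    (μ.prod (Measure.infinitePi fun _ : ℕ => μ)).map (fun p => seqCons p.1 p.2)
      = Measure.infinitePi fun _ : ℕ => μ := by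
  classical
  refine Measure.eq_infinitePi _ fun s t ht => ?_
  rw [Measure.map_apply measurable_seqCons (.pi s.countable_toSet fun _ _ => ht _)]
  have h1 : (fun p : α × (ℕ → α) => seqCons p.1 p.2) ⁻¹' (Set.pi s t)
      = (if 0 ∈ s then t 0 else Set.univ) ×ˢ
        (Set.pi (s.preimage (· + 1) (add_left_injective 1).injOn : Finset ℕ)
          fun n => t (n + 1)) := by
    ext ⟨u, g⟩
    simp only [Set.mem_preimage, Set.mem_pi, Finset.mem_coe, Set.mem_prod, Finset.mem_preimage]
    constructor
    · intro h
      refine ⟨?_, fun n hn => h (n + 1) hn⟩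
      split_ifs with h0
      · exact h 0 h0
      · trivial
    · rintro ⟨h0, h1⟩ n hn
      cases n with
      | zero => simpa [hn] using h0
      | succ n => exact h1 n hn
  rw [h1, Measure.prod_prod, Measure.infinitePi_pi _ fun _ _ => ht _]
  have h2 : ∏ n ∈ s.preimage (· + 1) (add_left_injective 1).injOn, μ (t (n + 1))
      = ∏ n ∈ s.erase 0, μ (t n) := by
    refine Finset.prod_bij (fun n _ => n + 1) (by simp) (by simp) ?_ (by simp)
    intro n hn
    rw [Finset.mem_erase] at hn
    exact ⟨n - 1, by simpa [Nat.sub_add_cancel (Nat.pos_of_ne_zero hn.1)] using hn.2,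
      Nat.sub_add_cancel (Nat.pos_of_ne_zero hn.1)⟩
  rw [h2]
  split_ifs with h0
  · rw [Finset.mul_prod_erase s (fun n => μ (t n)) h0]
  · rw [Finset.erase_eq_of_notMem h0]; simp

lemma lintegral_seqCons (μ : Measure α) [IsProbabilityMeasure μ] {f : (ℕ → α) → ℝ≥0∞}
    (hf : Measurable f) :
    ∫⁻ g, f g ∂(Measure.infinitePi fun _ : ℕ => μ)
      = ∫⁻ u, ∫⁻ g, f (seqCons u g) ∂(Measure.infinitePi fun _ : ℕ => μ) ∂μ := by
  conv_lhs => rw [← map_seqCons μ]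
  rw [lintegral_map hf measurable_seqCons,
    lintegral_prod (fun p => f (seqCons p.1 p.2)) (hf.comp measurable_seqCons).aemeasurable]

variable {ι : Type*} [DecidableEq ι]

lemma measurable_update_pair (i : ι) :
    Measurable fun p : α × (ι → α) => Function.update p.2 i p.1 := by
  refine measurable_pi_iff.2 fun j => ?_
  by_cases h : j = i
  · subst h; simpa using measurable_fst
  · simp only [Function.update_of_ne h]
    exact (measurable_pi_apply j).comp measurable_snd

/-- Resampling one coordinate of a product measure does not change the law. This isolates one clock
from the others. -/
lemma map_update (μ : ι → Measure α) [∀ i, IsProbabilityMeasure (μ i)] (i : ι) :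
    ((μ i).prod (Measure.infinitePi μ)).map (fun p => Function.update p.2 i p.1)
      = Measure.infinitePi μ := by
  refine Measure.eq_infinitePi _ fun s t ht => ?_
  rw [Measure.map_apply (measurable_update_pair i) (.pi s.countable_toSet fun _ _ => ht _)]
  have h1 : (fun p : α × (ι → α) => Function.update p.2 i p.1) ⁻¹' (Set.pi s t)
      = (if i ∈ s then t i else Set.univ) ×ˢ (Set.pi (s.erase i : Finset ι) t) := by
    ext ⟨u, g⟩
    simp only [Set.mem_preimage, Set.mem_pi, Finset.mem_coe, Set.mem_prod, Finset.mem_erase]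
    constructor
    · intro h
      refine ⟨?_, fun n hn => by simpa [hn.1] using h n hn.2⟩
      split_ifs with h0
      · simpa using h i h0
      · trivial
    · rintro ⟨h0, h1⟩ n hn
      by_cases hni : n = i
      · subst hni; simpa [hn] using h0
      · simpa [hni] using h1 n ⟨hni, hn⟩
  rw [h1, Measure.prod_prod, Measure.infinitePi_pi _ fun _ _ => ht _]
  split_ifs with h0
  · rw [Finset.mul_prod_erase s (fun n => μ n (t n)) h0]
  · rw [Finset.erase_eq_of_notMem h0]; simp

lemma lintegral_update (μ : ι → Measure α) [∀ i, IsProbabilityMeasure (μ i)] (i : ι)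
    {f : (ι → α) → ℝ≥0∞} (hf : Measurable f) :
    ∫⁻ g, f g ∂(Measure.infinitePi μ)
      = ∫⁻ u, ∫⁻ g, f (Function.update g i u) ∂(Measure.infinitePi μ) ∂(μ i) := by
  conv_lhs => rw [← map_update μ i]
  rw [lintegral_map hf (measurable_update_pair i),
    lintegral_prod (fun p => f (Function.update p.2 i p.1))
      (hf.comp (measurable_update_pair i)).aemeasurable]

end Product

/-- The partial sums of a sequence of gaps: the points of the process. -/
def psum (g : ℕ → ℝ≥0) (n : ℕ) : ℝ≥0 := ∑ j ∈ Finset.range (n + 1), g j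

lemma psum_zero (g : ℕ → ℝ≥0) : psum g 0 = g 0 := by simp [psum]

lemma psum_succ (g : ℕ → ℝ≥0) (n : ℕ) : psum g (n + 1) = psum g n + g (n + 1) := by
  simp [psum, Finset.sum_range_succ]

lemma psum_seqCons_succ (u : ℝ≥0) (g : ℕ → ℝ≥0) (n : ℕ) :
    psum (seqCons u g) (n + 1) = u + psum g n := by
  simp only [psum]
  rw [Finset.sum_range_succ' _ (n + 1), add_comm]
  simp

lemma psum_mono (g : ℕ → ℝ≥0) : Monotone (psum g) :=
  monotone_nat_of_le_succ fun n => by rw [psum_succ]; exact le_self_add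

@[fun_prop]
lemma measurable_psum (n : ℕ) : Measurable fun g => psum g n := by
  unfold psum; fun_prop

/-- The second alternative makes the search for the first point after `c` total. It has probability
zero under `gapLaw`. -/
lemma exists_passage (c : ℝ≥0) (g : ℕ → ℝ≥0) :
    ∃ n, c < psum g n ∨ ∀ i, psum g i ≤ c := by
  by_cases h : ∃ n, c < psum g n
  · exact h.imp fun _ => Or.inl
  · push Not at h
    exact ⟨0, Or.inr h⟩

open Classical in
/-- The index of the first point after `c` (`0` if there is none). -/
noncomputable def passage (c : ℝ≥0) (g : ℕ → ℝ≥0) : ℕ := Nat.find (exists_passage c g)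

/-- The gaps of the points after `c`, seen from `c`. -/
noncomputable def shift (c : ℝ≥0) (g : ℕ → ℝ≥0) : ℕ → ℝ≥0 :=
  seqCons (psum g (passage c g) - c) fun i => g (passage c g + (i + 1))

lemma measurable_passage : Measurable fun p : ℝ≥0 × (ℕ → ℝ≥0) => passage p.1 p.2 := by
  classical
  unfold passage
  refine measurable_find (p := fun (x : ℝ≥0 × (ℕ → ℝ≥0)) n =>
    x.1 < psum x.2 n ∨ ∀ i, psum x.2 i ≤ x.1) (fun x => exists_passage x.1 x.2) fun k => ?_
  refine MeasurableSet.union (measurableSet_lt (by fun_prop) (by fun_prop)) ?_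
  exact (MeasurableSet.iInter fun i => measurableSet_le (f := fun p => psum p.2 i)
    (g := fun p : ℝ≥0 × (ℕ → ℝ≥0) => p.1) (by fun_prop) (by fun_prop)).congr (by ext; simp; rfl)

lemma measurable_shift : Measurable fun p : ℝ≥0 × (ℕ → ℝ≥0) => shift p.1 p.2 := by
  have h : (fun p : ℝ≥0 × (ℕ → ℝ≥0) => shift p.1 p.2)
      = (fun z : ℕ × (ℝ≥0 × (ℕ → ℝ≥0)) =>
          seqCons (psum z.2.2 z.1 - z.2.1) fun i => z.2.2 (z.1 + (i + 1)))
        ∘ fun p => (passage p.1 p.2, p) := rfl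
  rw [h]
  refine Measurable.comp ?_ (measurable_passage.prodMk measurable_id)
  refine measurable_from_prod_countable_right fun n => ?_
  exact measurable_seqCons.comp (by fun_prop :
    Measurable fun z : ℝ≥0 × (ℕ → ℝ≥0) => (psum z.2 n - z.1, fun i => z.2 (n + (i + 1))))

lemma passage_eq_zero {c : ℝ≥0} {g : ℕ → ℝ≥0} (h : c < g 0) : passage c g = 0 := by
  classical
  unfold passage
  rw [Nat.find_eq_zero, psum_zero]
  exact Or.inl h

lemma shift_of_lt {c : ℝ≥0} {g : ℕ → ℝ≥0} (h : c < g 0) :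
    shift c g = seqCons (g 0 - c) fun i => g (i + 1) := by
  unfold shift
  rw [passage_eq_zero h, psum_zero]
  simp

lemma passage_seqCons {c u : ℝ≥0} {g : ℕ → ℝ≥0} (hu : u ≤ c) (h : ∃ n, c - u < psum g n) :
    passage c (seqCons u g) = passage (c - u) g + 1 := by
  classical
  unfold passage
  obtain ⟨k, hk⟩ := h
  have h0 : ¬ ∀ i, psum g i ≤ c - u := fun h => (h k).not_gt hk
  have h0' : ¬ ∀ i, psum (seqCons u g) i ≤ c := by
    intro h
    have := h (k + 1)
    rw [psum_seqCons_succ] at this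
    exact hk.not_ge (le_tsub_of_add_le_left this)
  have hiff (n : ℕ) : c < psum (seqCons u g) (n + 1) ↔ c - u < psum g n := by
    rw [psum_seqCons_succ, tsub_lt_iff_left hu]
  rw [Nat.find_eq_iff]
  refine ⟨Or.inl ((hiff _).2 ?_), fun n hn => ?_⟩
  · exact (Nat.find_spec (exists_passage (c - u) g)).resolve_right h0
  · rintro (h | h)
    · cases n with
      | zero => rw [psum_zero] at h; exact h.not_ge hu
      | succ n =>
        exact Nat.find_min (exists_passage (c - u) g) (Nat.lt_of_succ_lt_succ hn)
          (Or.inl ((hiff n).1 h))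
    · exact h0' h

/-- A first point at or before `c` is invisible from `c`. It can be deleted if `c` is reduced by its
gap. -/
lemma shift_seqCons {c u : ℝ≥0} {g : ℕ → ℝ≥0} (hu : u ≤ c) (h : ∃ n, c - u < psum g n) :
    shift c (seqCons u g) = shift (c - u) g := by
  unfold shift
  rw [passage_seqCons hu h, psum_seqCons_succ]
  congr 1
  · conv_lhs => rw [← add_tsub_cancel_of_le hu]
    rw [add_tsub_add_eq_tsub_left, add_tsub_cancel_left]
  · ext i
    rw [show passage (c - u) g + 1 + (i + 1) = passage (c - u) g + (i + 1) + 1 by ring,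
      seqCons_succ]

lemma lt_psum_passage {c : ℝ≥0} {g : ℕ → ℝ≥0} (h : ∃ n, c < psum g n) :
    c < psum g (passage c g) := by
  classical
  obtain ⟨k, hk⟩ := h
  exact (Nat.find_spec (exists_passage c g)).resolve_right fun h => (h k).not_gt hk

lemma psum_le_of_lt_passage {c : ℝ≥0} {g : ℕ → ℝ≥0} {n : ℕ} (hn : n < passage c g) :
    psum g n ≤ c := by
  classical
  by_contra! h
  exact Nat.find_min (exists_passage c g) hn (Or.inl h)

lemma add_psum_shift {c : ℝ≥0} {g : ℕ → ℝ≥0} (h : ∃ n, c < psum g n) (i : ℕ) :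
    c + psum (shift c g) i = psum g (passage c g + i) := by
  have h0 := (lt_psum_passage h).le
  induction i with
  | zero => rw [psum_zero, shift, seqCons_zero, add_zero, add_tsub_cancel_of_le h0]
  | succ i ih =>
    rw [psum_succ, ← add_assoc, ih, ← add_assoc, psum_succ, shift, seqCons_succ]
    rfl

attribute [irreducible] passage shift

lemma measurable_shift_const (c : ℝ≥0) : Measurable (shift c) :=
  Measurable.of_uncurry_left (f := shift) measurable_shift

/-- The law of the gaps of a Poisson process of unit rate. -/
noncomputable def gapLaw : Measure (ℕ → ℝ≥0) := Measure.infinitePi fun _ => stdExp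

instance : IsProbabilityMeasure gapLaw := by unfold gapLaw; infer_instance

lemma measurableSet_le_apply_zero (c : ℝ≥0) : MeasurableSet {g : ℕ → ℝ≥0 | c ≤ g 0} :=
  measurableSet_le (by fun_prop) (by fun_prop)

lemma gapLaw_apply_eq (i : ℕ) (c : ℝ≥0) : ∀ᵐ g ∂gapLaw, g i ≠ c := by
  have h := Measure.infinitePi_map_eval (fun _ : ℕ => stdExp) i
  have h2 : ∀ᵐ u ∂((Measure.infinitePi fun _ : ℕ => stdExp).map fun x => x i), u ≠ c := by
    rw [h]
    exact compl_mem_ae_iff.2 (stdExp_singleton c)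
  exact ae_of_ae_map (f := fun g : ℕ → ℝ≥0 => g i) (p := fun u => u ≠ c)
    (measurable_pi_apply i).aemeasurable h2

/-- If all partial sums were at most `k`, then so would be all gaps. For the first `n` gaps this has
a probability that tends to zero geometrically in `n`. -/
lemma ae_exists_lt_psum : ∀ᵐ g ∂gapLaw, ∀ c, ∃ n, c < psum g n := by
  have key (k : ℕ) : ∀ᵐ g ∂gapLaw, ∃ n, (k : ℝ≥0) < psum g n := by
    rw [ae_iff]
    have hlt : stdExp (Set.Iic (k : ℝ≥0)) < 1 := by
      refine lt_of_le_of_ne prob_le_one fun h => ?_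
      have h1 : stdExp (Set.Ici ((k : ℝ≥0) + 1)) = 0 := by
        refine measure_mono_null ?_ ((prob_compl_eq_zero_iff measurableSet_Iic).2 h)
        intro x hx
        simp only [Set.mem_Ici] at hx
        simp only [Set.mem_compl_iff, Set.mem_Iic, not_le]
        exact lt_of_lt_of_le (lt_add_one _) hx
      rw [stdExp_Ici] at h1
      exact (disc_pos 1 ENNReal.coe_ne_top).ne' h1
    have hle (n : ℕ) : gapLaw {g | ¬ ∃ n, (k : ℝ≥0) < psum g n}
        ≤ stdExp (Set.Iic (k : ℝ≥0)) ^ n := by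
      have : gapLaw (Set.pi (Finset.range n) fun _ => Set.Iic (k : ℝ≥0))
          = stdExp (Set.Iic (k : ℝ≥0)) ^ n := by
        rw [gapLaw, Measure.infinitePi_pi _ fun _ _ => measurableSet_Iic]
        simp
      rw [← this]
      refine measure_mono fun g hg => ?_
      simp only [not_exists, not_lt] at hg
      intro i _
      exact (Finset.single_le_sum (f := g) (fun _ _ => zero_le) (by simp)).trans (hg i)
    exact le_antisymm (ge_of_tendsto' (ENNReal.tendsto_pow_atTop_nhds_zero_of_lt_one hlt) hle)
      zero_le
  filter_upwards [ae_all_iff.2 key] with g hg c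
  obtain ⟨k, hk⟩ := exists_nat_ge c
  exact (hg k).imp fun n hn => hk.trans_lt hn

/-- If no point precedes `c`, the first gap beyond `c` is again exponential by lack of memory, and
the later gaps are untouched. The process seen from `c` is thus independent of this event. -/
lemma lintegral_shift_of_le {f : (ℕ → ℝ≥0) → ℝ≥0∞} (hf : Measurable f) (c : ℝ≥0) :
    ∫⁻ g, {g : ℕ → ℝ≥0 | c ≤ g 0}.indicator (fun g => f (shift c g)) g ∂gapLaw
      = disc 1 c * ∫⁻ g, f g ∂gapLaw := by
  have hsc := measurable_shift_const c
  have h1 : ∀ u ≠ c, ∀ g, {g : ℕ → ℝ≥0 | c ≤ g 0}.indicator (fun g => f (shift c g)) (seqCons u g)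
      = (Set.Ici c).indicator (fun u => f (seqCons (u - c) g)) u := by
    intro u hu g
    by_cases h : c ≤ u
    · rw [Set.indicator_of_mem (by exact h), Set.indicator_of_mem (by exact h),
        shift_of_lt (by exact lt_of_le_of_ne h hu.symm)]
      simp
    · rw [Set.indicator_of_notMem (by exact h), Set.indicator_of_notMem (by exact h)]
  have hm : Measurable fun p : ℝ≥0 × (ℕ → ℝ≥0) => f (seqCons p.1 p.2) :=
    hf.comp measurable_seqCons
  unfold gapLaw
  rw [lintegral_seqCons (f := {g : ℕ → ℝ≥0 | c ≤ g 0}.indicator fun g => f (shift c g)) _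
      ((hf.comp hsc).indicator (measurableSet_le_apply_zero c)),
    lintegral_seqCons _ hf, ← lintegral_stdExp_sub hm.lintegral_prod_right']
  refine lintegral_congr_ae ?_
  -- A point exactly at `c` does not count as a point after `c`, so this null case has to be
  -- excluded.
  filter_upwards [compl_mem_ae_iff.2 (stdExp_singleton c)] with u hu
  simp_rw [h1 u hu]
  by_cases h : c ≤ u
  · simp only [Set.indicator_of_mem (show u ∈ Set.Ici c from h)]
  · simp only [Set.indicator_of_notMem (show u ∉ Set.Ici c from h), lintegral_zero]

lemma measurableSet_lt_psum (c : ℝ≥0) (n : ℕ) : MeasurableSet {g : ℕ → ℝ≥0 | c < psum g n} :=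
  measurableSet_lt (by fun_prop) (by fun_prop)

lemma gapLaw_le_apply_zero (c : ℝ≥0) : gapLaw {g | c ≤ g 0} = disc 1 c := by
  have h := lintegral_shift_of_le (f := fun _ => 1) measurable_const c
  simpa [lintegral_indicator_const (measurableSet_le_apply_zero c)] using h

/-- Induction on `n` by conditioning on the first gap `u`. If `u ≥ c`, lack of memory applies; if `u
< c`, the process restarts after `u` with `c - u` in place of `c` and one point fewer to look at. -/
lemma lintegral_shift_lt_psum {f : (ℕ → ℝ≥0) → ℝ≥0∞} (hf : Measurable f) (n : ℕ) (c : ℝ≥0) :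
    ∫⁻ g, {g | c < psum g n}.indicator (fun g => f (shift c g)) g ∂gapLaw
      = gapLaw {g | c < psum g n} * ∫⁻ g, f g ∂gapLaw := by
  induction n generalizing c f with
  | zero =>
    have h1 : ({g | c < psum g 0} : Set (ℕ → ℝ≥0)) =ᵐ[gapLaw] {g | c ≤ g 0} := by
      filter_upwards [gapLaw_apply_eq 0 c] with g hg
      refine propext ?_
      change c < psum g 0 ↔ c ≤ g 0
      rw [psum_zero]
      exact ⟨le_of_lt, fun h => lt_of_le_of_ne h hg.symm⟩
    rw [measure_congr h1, gapLaw_le_apply_zero, ← lintegral_shift_of_le hf,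
      lintegral_indicator (measurableSet_lt_psum c 0),
      lintegral_indicator (measurableSet_le_apply_zero c), setLIntegral_congr h1]
  | succ n ih =>
    let A : Set (ℕ → ℝ≥0) := {g | g 0 < c ∧ c < psum g (n + 1)}
    have hA : MeasurableSet A :=
      (measurableSet_lt (by fun_prop) (by fun_prop)).inter (measurableSet_lt_psum c (n + 1))
    have h1 : ({g | c < psum g (n + 1)} : Set (ℕ → ℝ≥0)) =ᵐ[gapLaw]
        ({g | c ≤ g 0} ∪ A : Set (ℕ → ℝ≥0)) := by
      filter_upwards [gapLaw_apply_eq 0 c] with g hg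
      refine propext ?_
      change c < psum g (n + 1) ↔ c ≤ g 0 ∨ (g 0 < c ∧ c < psum g (n + 1))
      have : g 0 ≤ psum g (n + 1) := by
        simpa [psum_zero] using psum_mono g (Nat.zero_le (n + 1))
      constructor
      · intro h
        rcases le_or_gt c (g 0) with h' | h'
        · exact Or.inl h'
        · exact Or.inr ⟨h', h⟩
      · rintro (h | h)
        · exact (lt_of_le_of_ne h hg.symm).trans_le this
        · exact h.2
    have hd : Disjoint {g : ℕ → ℝ≥0 | c ≤ g 0} A :=
      Set.disjoint_left.2 fun g hg hg' => (not_le.2 hg'.1) hg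
    -- The first factor does not depend on `f`; the case `f = 1` below identifies it as the mass of
    -- `A`.
    have hJ : ∀ f : (ℕ → ℝ≥0) → ℝ≥0∞, Measurable f →
        ∫⁻ g in A, f (shift c g) ∂gapLaw
          = (∫⁻ u, (Set.Iio c).indicator (fun u => gapLaw {g | c - u < psum g n}) u ∂stdExp)
            * ∫⁻ g, f g ∂gapLaw := by
      intro f hf
      have hp : Measurable fun u => gapLaw {g | c - u < psum g n} := by
        have hs : MeasurableSet {p : ℝ≥0 × (ℕ → ℝ≥0) | c - p.1 < psum p.2 n} :=
          measurableSet_lt (by fun_prop) (by fun_prop)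
        exact measurable_measure_prodMk_left hs
      rw [← lintegral_indicator hA, ← lintegral_mul_const _ (hp.indicator measurableSet_Iio)]
      conv_lhs => unfold gapLaw
      rw [lintegral_seqCons (f := A.indicator fun g => f (shift c g)) _
        ((hf.comp (measurable_shift_const c)).indicator hA)]
      change ∫⁻ u, ∫⁻ g, _ ∂gapLaw ∂_ = _
      refine lintegral_congr fun u => ?_
      by_cases hu : u < c
      · rw [Set.indicator_of_mem (by exact hu), ← ih hf]
        refine lintegral_congr fun g => ?_
        have hiff : seqCons u g ∈ A ↔ g ∈ {g | c - u < psum g n} := by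
          change (u < c ∧ c < psum (seqCons u g) (n + 1)) ↔ c - u < psum g n
          rw [psum_seqCons_succ, ← tsub_lt_iff_left hu.le, and_iff_right hu]
        by_cases hg : g ∈ {g | c - u < psum g n}
        · rw [Set.indicator_of_mem hg, Set.indicator_of_mem (hiff.2 hg),
            shift_seqCons hu.le ⟨n, hg⟩]
        · rw [Set.indicator_of_notMem hg, Set.indicator_of_notMem (hiff.not.2 hg)]
      · rw [Set.indicator_of_notMem (by exact hu), zero_mul]
        refine (lintegral_congr fun g => ?_).trans lintegral_zero
        rw [Set.indicator_of_notMem]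
        exact fun h => hu h.1
    have hmass := hJ (fun _ => 1) measurable_const
    simp only [lintegral_const, Measure.restrict_apply_univ, one_mul, measure_univ,
      mul_one] at hmass
    rw [measure_congr h1, measure_union hd hA, gapLaw_le_apply_zero, add_mul, hmass, ← hJ f hf,
      ← lintegral_shift_of_le hf, lintegral_indicator (measurableSet_lt_psum c (n + 1)),
      setLIntegral_congr h1, lintegral_union hA hd,
      lintegral_indicator (measurableSet_le_apply_zero c)]

/-- A Poisson process is stationary. -/
lemma lintegral_shift {f : (ℕ → ℝ≥0) → ℝ≥0∞} (hf : Measurable f) (c : ℝ≥0) :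
    ∫⁻ g, f (shift c g) ∂gapLaw = ∫⁻ g, f g ∂gapLaw := by
  have hmono : Monotone fun n => {g : ℕ → ℝ≥0 | c < psum g n} :=
    fun m n h g hg => lt_of_lt_of_le hg (psum_mono g h)
  have hU : (⋃ n, {g : ℕ → ℝ≥0 | c < psum g n}) =ᵐ[gapLaw] Set.univ := by
    filter_upwards [ae_exists_lt_psum] with g hg
    refine propext ⟨fun _ => trivial, fun _ => Set.mem_iUnion.2 (hg c)⟩
  have h1 := setLIntegral_iUnion_of_directed (μ := gapLaw) (fun g => f (shift c g))
    (s := fun n => {g : ℕ → ℝ≥0 | c < psum g n}) hmono.directed_le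
  rw [setLIntegral_congr hU, setLIntegral_univ] at h1
  rw [h1]
  simp_rw [← lintegral_indicator (measurableSet_lt_psum c _), lintegral_shift_lt_psum hf,
    ← ENNReal.iSup_mul]
  rw [← hmono.measure_iUnion, measure_congr hU, measure_univ, one_mul]

lemma map_shift (c : ℝ≥0) : gapLaw.map (shift c) = gapLaw := by
  ext t ht
  have h := lintegral_shift (measurable_one.indicator ht) c
  rw [lintegral_indicator_one ht] at h
  rw [Measure.map_apply (measurable_shift_const c) ht, ← h,
    ← lintegral_indicator_one (measurable_shift_const c ht)]
  rfl

lemma gapLaw_inter_preimage_shift (c : ℝ≥0) {t : Set (ℕ → ℝ≥0)} (ht : MeasurableSet t) :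
    gapLaw ({g | c ≤ g 0} ∩ shift c ⁻¹' t) = disc 1 c * gapLaw t := by
  rw [← lintegral_indicator_one ht, ← lintegral_shift_of_le (measurable_one.indicator ht),
    lintegral_indicator (measurableSet_le_apply_zero c), ← lintegral_indicator_one
    ((measurableSet_le_apply_zero c).inter (measurable_shift_const c ht)),
    ← lintegral_indicator (measurableSet_le_apply_zero c), Set.inter_indicator_one]
  refine lintegral_congr fun g => ?_
  by_cases hg : g ∈ {g : ℕ → ℝ≥0 | c ≤ g 0}
  · simp only [Pi.mul_apply, Set.indicator_of_mem hg, Pi.one_apply, one_mul]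
    rfl
  · simp only [Pi.mul_apply, Set.indicator_of_notMem hg, zero_mul]

end PRP

/-! ### Competing clocks: total rates and the first ring -/

namespace PRP

section ClockRates

/-- Clocks as a sum type. -/
def Clock.toSum : Clock → ℤ ⊕ (ℤ × ℕ+) ⊕ (ℤ × ℕ)
  | .single j => .inl j
  | .batch j m => .inr (.inl (j, m))
  | .catastrophe j m => .inr (.inr (j, m))

lemma Clock.toSum_injective : Function.Injective Clock.toSum := by
  rintro (a | ⟨a, m⟩ | ⟨a, m⟩) (b | ⟨b, n⟩ | ⟨b, n⟩) h <;> simp_all [Clock.toSum]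

instance : Countable Clock := Clock.toSum_injective.countable

noncomputable instance : DecidableEq Clock := Classical.decEq _

lemma Clock.rate_ne_top (S : Params) (a : Clock) : a.rate S ≠ ⊤ := by
  cases a with
  | single j => exact ENNReal.coe_ne_top
  | batch j m => exact ENNReal.mul_ne_top ENNReal.coe_ne_top (PMF.apply_ne_top _ _)
  | catastrophe j m => exact ENNReal.mul_ne_top ENNReal.coe_ne_top (PMF.apply_ne_top _ _)

/-- The rate of a clock, as a nonnegative real number. -/
noncomputable def Clock.rateNN (S : Params) (a : Clock) : ℝ≥0 := (a.rate S).toNNReal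

@[simp] lemma Clock.coe_rateNN (S : Params) (a : Clock) : (a.rateNN S : ℝ≥0∞) = a.rate S :=
  ENNReal.coe_toNNReal (a.rate_ne_top S)

/-- The rate of a clock that is active at level `j`, and zero for the other clocks. -/
noncomputable def activeRate (S : Params) (j : ℤ) (a : Clock) : ℝ≥0 :=
  if a.source = j then a.rateNN S else 0

/-- The laws of the batch and catastrophe sizes have total mass one, so the sum is at most the sum
of the three rates at level `j`. -/
lemma tsum_activeRate_ne_top (S : Params) (j : ℤ) :
    ∑' a, (activeRate S j a : ℝ≥0∞) ≠ ⊤ := by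
  let F : ℤ ⊕ (ℤ × ℕ+) ⊕ (ℤ × ℕ) → ℝ≥0∞ := Sum.elim
    (fun i => if i = j then (S.singleRate i : ℝ≥0∞) else 0) (Sum.elim
    (fun p => if p.1 = j then S.batchRate p.1 * S.batchSize p.1 p.2 else 0)
    (fun p => if p.1 = j then S.catRate p.1 * S.catSize p.1 p.2 else 0))
  have h1 : ∀ a, (activeRate S j a : ℝ≥0∞) = F a.toSum := by
    intro a
    have : (activeRate S j a : ℝ≥0∞) = if a.source = j then a.rate S else 0 := by
      unfold activeRate; split_ifs <;> simp
    rw [this]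
    cases a <;> rfl
  have h2 : ∑' a, (activeRate S j a : ℝ≥0∞) ≤ ∑' z, F z := by
    simp_rw [h1]
    exact ENNReal.tsum_comp_le_tsum_of_injective Clock.toSum_injective F
  refine ne_top_of_le_ne_top ?_ h2
  rw [ENNReal.summable.tsum_sum (by exact ENNReal.summable),
    ENNReal.summable.tsum_sum (by exact ENNReal.summable)]
  simp only [F, Sum.elim_inl, Sum.elim_inr]
  rw [tsum_ite_eq,
    ENNReal.tsum_prod (f := fun i m =>
      if i = j then (S.batchRate i * S.batchSize i m : ℝ≥0∞) else 0),
    ENNReal.tsum_prod (f := fun i m => if i = j then (S.catRate i * S.catSize i m : ℝ≥0∞) else 0)]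
  have h3 : ∀ i, ∑' m, (if i = j then (S.batchRate i * S.batchSize i m : ℝ≥0∞) else 0)
      = if i = j then (S.batchRate i : ℝ≥0∞) else 0 := by
    intro i; split_ifs
    · rw [ENNReal.tsum_mul_left, PMF.tsum_coe, mul_one]
    · simp
  have h4 : ∀ i, ∑' m, (if i = j then (S.catRate i * S.catSize i m : ℝ≥0∞) else 0)
      = if i = j then (S.catRate i : ℝ≥0∞) else 0 := by
    intro i; split_ifs
    · rw [ENNReal.tsum_mul_left, PMF.tsum_coe, mul_one]
    · simp
  simp_rw [h3, h4, tsum_ite_eq]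
  simp

/-- The total rate of the clocks that are active at level `j`. -/
noncomputable def totalRate (S : Params) (j : ℤ) : ℝ≥0 :=
  (∑' a, (activeRate S j a : ℝ≥0∞)).toNNReal

lemma coe_totalRate (S : Params) (j : ℤ) :
    (totalRate S j : ℝ≥0∞) = ∑' a, (activeRate S j a : ℝ≥0∞) :=
  ENNReal.coe_toNNReal (tsum_activeRate_ne_top S j)

lemma hasSum_activeRate (S : Params) (j : ℤ) : HasSum (activeRate S j) (totalRate S j) := by
  rw [← ENNReal.hasSum_coe, coe_totalRate]
  exact ENNReal.summable.hasSum

end ClockRates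

/-- The law of the gaps of all clocks. -/
noncomputable def clockLaw : Measure (Clock → ℕ → ℝ≥0) := Measure.infinitePi fun _ => gapLaw

instance : IsProbabilityMeasure clockLaw := by unfold clockLaw; infer_instance

/-- The clocks seen from time `t`. -/
noncomputable def shiftClocks (S : Params) (t : ℝ≥0) (g : Clock → ℕ → ℝ≥0) :
    Clock → ℕ → ℝ≥0 := fun a => shift (a.rateNN S * t) (g a)

lemma measurable_shiftClocks (S : Params) :
    Measurable fun p : ℝ≥0 × (Clock → ℕ → ℝ≥0) => shiftClocks S p.1 p.2 := by
  refine measurable_pi_iff.2 fun a => ?_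
  exact measurable_shift.comp (by fun_prop :
    Measurable fun p : ℝ≥0 × (Clock → ℕ → ℝ≥0) => (a.rateNN S * p.1, p.2 a))

lemma measurable_shiftClocks_const (S : Params) (t : ℝ≥0) : Measurable (shiftClocks S t) :=
  Measurable.of_uncurry_left (f := shiftClocks S) (measurable_shiftClocks S)

/-- No clock in `B` rings before time `s`. -/
def quiet (S : Params) (B : Set Clock) (s : ℝ≥0) : Set (Clock → ℕ → ℝ≥0) :=
  {g | ∀ b ∈ B, b.rateNN S * s ≤ g b 0}

lemma measurableSet_quiet (S : Params) (B : Set Clock) (s : ℝ≥0) :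
    MeasurableSet (quiet S B s) := by
  have : quiet S B s = ⋂ b, ⋂ (_ : b ∈ B), {g | b.rateNN S * s ≤ g b 0} := by
    ext; simp [quiet]
  rw [this]
  exact .iInter fun b => .iInter fun _ => measurableSet_le (by fun_prop) (by fun_prop)

lemma disc_sum {ι : Type*} (J : Finset ι) (c : ι → ℝ≥0) (s : ℝ≥0) :
    disc (∑ i ∈ J, c i) s = ∏ i ∈ J, disc (c i) s := by
  classical
  induction J using Finset.induction_on with
  | empty => simp [disc]
  | insert i J hi ih => rw [Finset.sum_insert hi, Finset.prod_insert hi, disc_add_rate, ih]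

-- By independence, silence of all clocks in `B` up to `s` factors over the clocks, with total
-- probability `disc Λ s`. By lack of memory for each clock it does not influence what is seen from
-- `s`. The measure is normalised in the proof in order to use the characterisation of product
-- measures by finite boxes.
open Classical in
lemma map_shiftClocks_restrict_quiet (S : Params) (B : Set Clock) {Λ : ℝ≥0}
    (hΛ : HasSum (fun b => if b ∈ B then b.rateNN S else 0) Λ) (s : ℝ≥0) :
    (clockLaw.restrict (quiet S B s)).map (shiftClocks S s) = disc Λ s • clockLaw := by
  have hd0 : disc Λ s ≠ 0 := (disc_pos Λ ENNReal.coe_ne_top).ne'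
  have hd1 : disc Λ s ≠ ⊤ := ne_top_of_le_ne_top ENNReal.one_ne_top (disc_le_one _ _)
  suffices h : (disc Λ s)⁻¹ • (clockLaw.restrict (quiet S B s)).map (shiftClocks S s)
      = clockLaw by
    rw [← congrArg (fun m => disc Λ s • m) h, smul_smul, ENNReal.mul_inv_cancel hd0 hd1, one_smul]
  refine Measure.eq_infinitePi _ fun I t ht => ?_
  have hbox : MeasurableSet (Set.pi (I : Set Clock) t) := .pi I.countable_toSet fun _ _ => ht _
  rw [Measure.smul_apply, Measure.map_apply (measurable_shiftClocks_const S s) hbox,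
    Measure.restrict_apply (measurable_shiftClocks_const S s hbox), smul_eq_mul]
  let A : Clock → Set (ℕ → ℝ≥0) := fun b =>
    (if b ∈ B then {g | b.rateNN S * s ≤ g 0} else Set.univ) ∩
      (if b ∈ I then shift (b.rateNN S * s) ⁻¹' t b else Set.univ)
  have hA : ∀ b, MeasurableSet (A b) := fun b => by
    refine MeasurableSet.inter ?_ ?_
    · split_ifs
      · exact measurableSet_le_apply_zero _
      · exact .univ
    · split_ifs
      · exact measurable_shift_const _ (ht b)
      · exact .univ
  have hset : shiftClocks S s ⁻¹' Set.pi (I : Set Clock) t ∩ quiet S B s = Set.univ.pi A := by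
    ext g
    simp only [Set.mem_inter_iff, Set.mem_preimage, Set.mem_pi, Finset.mem_coe, quiet,
      Set.mem_univ, true_imp_iff, A]
    constructor
    · rintro ⟨h1, h2⟩ b
      refine ⟨?_, ?_⟩
      · split_ifs with hb
        · exact h2 b hb
        · trivial
      · split_ifs with hb
        · exact h1 b hb
        · trivial
    · intro h
      refine ⟨fun b hb => ?_, fun b hb => ?_⟩
      · have := (h b).2
        rwa [if_pos hb] at this
      · have := (h b).1
        rwa [if_pos hb] at this
  have hgA : ∀ b, gapLaw (A b) = disc (if b ∈ B then b.rateNN S else 0) s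
      * (if b ∈ I then gapLaw (t b) else 1) := by
    intro b
    by_cases hb : b ∈ B <;> by_cases hI : b ∈ I <;> simp only [A, hb, hI, if_true, if_false]
    · rw [gapLaw_inter_preimage_shift _ (ht b), disc_smul, one_mul]
    · rw [Set.inter_univ, gapLaw_le_apply_zero, disc_smul, one_mul, mul_one]
    · rw [Set.univ_inter, ← Measure.map_apply (measurable_shift_const _) (ht b), map_shift]
      simp [disc]
    · simp [disc]
  have hprod : ∀ J : Finset Clock, I ⊆ J → ∏ b ∈ J, gapLaw (A b)
      = disc (∑ b ∈ J, if b ∈ B then b.rateNN S else 0) s * ∏ b ∈ I, gapLaw (t b) := by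
    intro J hIJ
    simp_rw [hgA]
    rw [Finset.prod_mul_distrib]
    congr 1
    · rw [disc_sum]
    · rw [Finset.prod_ite_mem, Finset.inter_eq_right.2 hIJ]
  -- `B` may be infinite, so the event constrains infinitely many coordinates and its probability is
  -- a limit of finite products. The rates in these products sum to `Λ` in the limit.
  have hlim1 : Filter.Tendsto (fun J : Finset Clock => ∏ b ∈ J, gapLaw (A b)) Filter.atTop
      (nhds (clockLaw (Set.univ.pi A))) := by
    rw [clockLaw, Measure.infinitePi_pi_univ _ hA, ENNReal.tprod_eq_iInf_prod fun b => prob_le_one]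
    exact tendsto_atTop_iInf (Finset.prod_anti_set_of_le_one' fun b => prob_le_one)
  have hlim2 : Filter.Tendsto (fun J : Finset Clock => ∏ b ∈ J, gapLaw (A b)) Filter.atTop
      (nhds (disc Λ s * ∏ b ∈ I, gapLaw (t b))) := by
    have h1 : Filter.Tendsto (fun J : Finset Clock =>
        disc (∑ b ∈ J, if b ∈ B then b.rateNN S else 0) s * ∏ b ∈ I, gapLaw (t b)) Filter.atTop
        (nhds (disc Λ s * ∏ b ∈ I, gapLaw (t b))) := by
      refine ENNReal.Tendsto.mul_const ?_ (Or.inr ?_)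
      · have hc : Continuous fun c : ℝ≥0 => disc c s := by
          simp_rw [disc_coe]
          exact ENNReal.continuous_ofReal.comp (by fun_prop)
        exact (hc.tendsto Λ).comp hΛ
      · exact ne_top_of_le_ne_top ENNReal.one_ne_top
          (Finset.prod_le_one' fun b _ => prob_le_one)
    refine h1.congr' ?_
    filter_upwards [Filter.eventually_ge_atTop I] with J hJ
    exact (hprod J hJ).symm
  rw [hset, tendsto_nhds_unique hlim1 hlim2, ← mul_assoc, ENNReal.inv_mul_cancel hd0 hd1, one_mul]

open Classical in
lemma lintegral_quiet (S : Params) (B : Set Clock) {Λ : ℝ≥0}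
    (hΛ : HasSum (fun b => if b ∈ B then b.rateNN S else 0) Λ) (s : ℝ≥0)
    {f : (Clock → ℕ → ℝ≥0) → ℝ≥0∞} (hf : Measurable f) :
    ∫⁻ g, (quiet S B s).indicator (fun g => f (shiftClocks S s g)) g ∂clockLaw
      = disc Λ s * ∫⁻ g, f g ∂clockLaw := by
  rw [lintegral_indicator (measurableSet_quiet S B s),
    ← lintegral_map hf (measurable_shiftClocks_const S s),
    map_shiftClocks_restrict_quiet S B hΛ, lintegral_smul_measure, smul_eq_mul]

/-- Among the clocks active at the level of `a`, the clock `a` rings first. -/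
def ringsFirst (S : Params) (a : Clock) : Set (Clock → ℕ → ℝ≥0) :=
  {g | a.rateNN S ≠ 0 ∧ ∀ b, b ≠ a → b.source = a.source →
    b.rateNN S * (g a 0 / a.rateNN S) ≤ g b 0}

lemma measurableSet_ringsFirst (S : Params) (a : Clock) : MeasurableSet (ringsFirst S a) := by
  by_cases h : a.rateNN S = 0
  · have : ringsFirst S a = ∅ := by ext; simp [ringsFirst, h]
    rw [this]; exact .empty
  · have : ringsFirst S a = ⋂ b, ⋂ (_ : b ≠ a), ⋂ (_ : b.source = a.source),
        {g | b.rateNN S * (g a 0 / a.rateNN S) ≤ g b 0} := by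
      ext; simp [ringsFirst, h]
    rw [this]
    exact .iInter fun b => .iInter fun _ => .iInter fun _ =>
      measurableSet_le (by fun_prop) (by fun_prop)

lemma hasSum_otherRates (S : Params) (a : Clock) :
    ∃ Λ : ℝ≥0, HasSum (fun b => open Classical in
      if b ∈ {b : Clock | b ≠ a ∧ b.source = a.source} then b.rateNN S else 0) Λ ∧
      a.rateNN S + Λ = totalRate S a.source := by
  classical
  have h := hasSum_activeRate S a.source
  have hs : Summable (fun b => if b ∈ {b : Clock | b ≠ a ∧ b.source = a.source}
      then b.rateNN S else 0) := by
    refine NNReal.summable_of_le (fun b => ?_) h.summable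
    unfold activeRate
    simp only [Set.mem_ofPred_eq]
    split_ifs with h1 h2 h2
    · exact le_rfl
    · exact absurd h1.2 h2
    · exact zero_le
    · exact le_rfl
  refine ⟨_, hs.hasSum, ?_⟩
  have h2 : HasSum (fun b => (if b = a then a.rateNN S else 0)
      + if b ∈ {b : Clock | b ≠ a ∧ b.source = a.source} then b.rateNN S else 0)
      (a.rateNN S + _) := (hasSum_ite_eq a (a.rateNN S)).add hs.hasSum
  refine h2.unique ?_
  convert h using 2 with b
  unfold activeRate
  by_cases hb : b = a
  · subst hb; simp
  · simp [hb]

/-- Competing exponential clocks: the time of the first ring, the clock that rings first, and the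
clocks seen from that time. -/
lemma lintegral_ringsFirst (S : Params) (a : Clock) {H : ℝ≥0 → (Clock → ℕ → ℝ≥0) → ℝ≥0∞}
    (hH : Measurable fun p : ℝ≥0 × (Clock → ℕ → ℝ≥0) => H p.1 p.2) :
    ∫⁻ g, (ringsFirst S a).indicator
      (fun g => H (g a 0 / a.rateNN S) (shiftClocks S (g a 0 / a.rateNN S) g)) g ∂clockLaw
      = a.rate S * ∫⁻ s, disc (totalRate S a.source) s * ∫⁻ g, H s g ∂clockLaw ∂leb := by
  classical
  rw [← Clock.coe_rateNN]
  by_cases hr : a.rateNN S = 0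
  · have : ringsFirst S a = ∅ := by ext; simp [ringsFirst, hr]
    simp [this, hr]
  obtain ⟨Λ, hΛ, hsum⟩ := hasSum_otherRates S a
  set r := a.rateNN S with hrdef
  set B : Set Clock := {b : Clock | b ≠ a ∧ b.source = a.source} with hB
  let F : (Clock → ℕ → ℝ≥0) → ℝ≥0∞ := (ringsFirst S a).indicator
    fun g => H (g a 0 / r) (shiftClocks S (g a 0 / r) g)
  have hF : Measurable F := by
    refine Measurable.indicator ?_ (measurableSet_ringsFirst S a)
    have h1 : Measurable fun g : Clock → ℕ → ℝ≥0 => (g a 0 / r, g) := by fun_prop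
    exact hH.comp ((by fun_prop : Measurable fun g : Clock → ℕ → ℝ≥0 => g a 0 / r).prodMk
      ((measurable_shiftClocks S).comp h1))
  have hFu : Measurable fun p : (ℕ → ℝ≥0) × (Clock → ℕ → ℝ≥0) =>
      F (Function.update p.2 a p.1) := hF.comp (measurable_update_pair a)
  have hΨ : Measurable fun s => ∫⁻ g, H s g ∂clockLaw := hH.lintegral_prod_right'
  have hHs : ∀ s, Measurable (H s) := fun s => Measurable.of_uncurry_left (f := H) hH
  -- Resample the clock `a` as a first gap `u` followed by gaps `g'`. It rings first when the others
  -- are quiet up to `u / r`, and from that time on its gaps are `g'`.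
  have key : ∀ u, ∀ᵐ g' ∂gapLaw, ∀ y : Clock → ℕ → ℝ≥0,
      F (Function.update y a (seqCons u g')) = (quiet S B (u / r)).indicator
        (fun y => H (u / r) (Function.update (shiftClocks S (u / r) y) a g')) y := by
    intro u
    -- A zero gap would put the second point at the time of the first, where the strict inequality
    -- in `passage` would skip it.
    filter_upwards [gapLaw_apply_eq 0 0] with g' hg' y
    have hiff : Function.update y a (seqCons u g') ∈ ringsFirst S a ↔ y ∈ quiet S B (u / r) := by
      simp only [ringsFirst, quiet, Set.mem_ofPred_eq, Function.update_self, seqCons_zero, hB,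
        ← hrdef]
      constructor
      · rintro ⟨-, h⟩ b ⟨hba, hbs⟩
        simpa [hba] using h b hba hbs
      · refine fun h => ⟨hr, fun b hba hbs => ?_⟩
        simpa [hba] using h b ⟨hba, hbs⟩
    have h0 : 0 < g' 0 := pos_iff_ne_zero.2 hg'
    have hshift : shiftClocks S (u / r) (Function.update y a (seqCons u g'))
        = Function.update (shiftClocks S (u / r) y) a g' := by
      funext b
      by_cases hb : b = a
      · subst hb
        simp only [shiftClocks, Function.update_self, ← hrdef]
        rw [mul_div_cancel₀ _ hr, shift_seqCons le_rfl ⟨0, by simpa [psum_zero] using h0⟩,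
          tsub_self, shift_of_lt h0, tsub_zero, seqCons_self]
      · simp [shiftClocks, hb]
    by_cases hq : y ∈ quiet S B (u / r)
    · simp only [F]
      rw [Set.indicator_of_mem hq, Set.indicator_of_mem (hiff.2 hq), Function.update_self,
        seqCons_zero, hshift]
    · simp only [F]
      rw [Set.indicator_of_notMem hq, Set.indicator_of_notMem (hiff.not.2 hq)]
  have inner : ∀ u, ∫⁻ g', ∫⁻ y, F (Function.update y a (seqCons u g')) ∂clockLaw ∂gapLaw
      = disc Λ (u / r : ℝ≥0) * ∫⁻ g, H (u / r) g ∂clockLaw := by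
    intro u
    have h1 : ∫⁻ g', ∫⁻ y, F (Function.update y a (seqCons u g')) ∂clockLaw ∂gapLaw
        = ∫⁻ g', disc Λ (u / r : ℝ≥0)
          * ∫⁻ y, H (u / r) (Function.update y a g') ∂clockLaw ∂gapLaw := by
      refine lintegral_congr_ae ?_
      filter_upwards [key u] with g' hg'
      simp_rw [hg']
      exact lintegral_quiet S B (by convert! hΛ) (u / r)
        (f := fun y => H (u / r) (Function.update y a g'))
        ((hHs _).comp ((measurable_update_pair a).comp measurable_prodMk_left))
    have hm : Measurable fun p : (ℕ → ℝ≥0) × (Clock → ℕ → ℝ≥0) =>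
        H (u / r) (Function.update p.2 a p.1) := (hHs _).comp (measurable_update_pair a)
    rw [h1, lintegral_const_mul _ hm.lintegral_prod_right']
    congr 1
    exact (lintegral_update (fun _ => gapLaw) a (hHs _)).symm
  have h2 : ∫⁻ g, F g ∂clockLaw
      = ∫⁻ u, disc Λ (u / r : ℝ≥0) * ∫⁻ g, H (u / r) g ∂clockLaw ∂stdExp := by
    conv_lhs => unfold clockLaw
    rw [lintegral_update (fun _ => gapLaw) a hF]
    change ∫⁻ g', ∫⁻ y, _ ∂clockLaw ∂gapLaw = _
    conv_lhs => unfold gapLaw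
    rw [lintegral_seqCons (f := fun g' => ∫⁻ y, F (Function.update y a g') ∂clockLaw) _
      hFu.lintegral_prod_right']
    exact lintegral_congr inner
  refine h2.trans ?_
  have hm1 : Measurable fun s : ℝ≥0 => disc Λ s * ∫⁻ g, H s g ∂clockLaw := by fun_prop
  rw [lintegral_stdExp (f := fun u => disc Λ (u / r : ℝ≥0) * ∫⁻ g, H (u / r) g ∂clockLaw)
    (hm1.comp (by fun_prop : Measurable fun u : ℝ≥0 => u / r)), ← lintegral_leb_div _ hr]
  · refine lintegral_congr fun u => ?_
    -- The density `disc 1 u` of the first gap equals `disc r (u / r)`, and together with the factor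
    -- `disc Λ (u / r)` of the silent clocks it gives the total rate.
    rw [← hsum, disc_add_rate, ← mul_assoc]
    congr 2
    have := disc_smul 1 r (u / r)
    rwa [one_mul, mul_div_cancel₀ _ hr] at this
  · fun_prop

end PRP

/-! ### Almost sure properties of the clocks and time shifts -/

namespace PRP

/-- The `i`-th point of the clock `a`. -/
noncomputable def pt (S : Params) (g : Clock → ℕ → ℝ≥0) (a : Clock) (i : ℕ) : ℝ≥0∞ :=
  (psum (g a) i : ℝ≥0∞) / a.rate S

/-- The first point after `T` of the clocks active at level `j`. -/
noncomputable def nextPt (S : Params) (g : Clock → ℕ → ℝ≥0) (j : ℤ) (T : ℝ≥0∞) : ℝ≥0∞ :=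
  ⨅ (a : Clock) (_ : a.source = j) (i : ℕ) (_ : T < pt S g a i), pt S g a i

/-- The properties of the clocks that hold almost surely and make the system well-behaved. -/
structure Good (S : Params) (g : Clock → ℕ → ℝ≥0) : Prop where
  pos : ∀ a i, 0 < g a i
  unbounded : ∀ a c, ∃ n, c < psum (g a) n
  distinct : ∀ a b, a ≠ b → ∀ i i', pt S g a i = pt S g b i' → pt S g a i = ⊤
  finite : ∀ j (N : ℕ), {a : Clock | a.source = j ∧ pt S g a 0 ≤ N}.Finite

section AlmostSure

lemma ae_clock {p : (ℕ → ℝ≥0) → Prop} (h : ∀ᵐ g ∂gapLaw, p g) (a : Clock) :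
    ∀ᵐ g ∂clockLaw, p (g a) := by
  have h2 : ∀ᵐ u ∂(clockLaw.map fun g => g a), p u := by
    rw [clockLaw, Measure.infinitePi_map_eval]; exact h
  exact ae_of_ae_map (f := fun g : Clock → ℕ → ℝ≥0 => g a) (measurable_pi_apply a).aemeasurable h2

lemma ae_psum_ne (i : ℕ) (c : ℝ≥0) : ∀ᵐ g ∂gapLaw, psum g i ≠ c := by
  cases i with
  | zero => simpa only [psum_zero] using gapLaw_apply_eq 0 c
  | succ i =>
    have hm : MeasurableSet {g : ℕ → ℝ≥0 | psum g (i + 1) = c} :=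
      measurableSet_eq_fun (by fun_prop) (by fun_prop)
    have : gapLaw {g | psum g (i + 1) = c} = 0 := by
      rw [← lintegral_indicator_one hm]
      conv_lhs => unfold gapLaw
      rw [lintegral_seqCons _ (measurable_one.indicator hm)]
      have hm2 := (measurable_one (α := ℝ≥0∞)).indicator hm |>.comp measurable_seqCons
      rw [lintegral_lintegral_swap (f := fun u g => {g : ℕ → ℝ≥0 | psum g (i + 1) = c}.indicator
        (1 : (ℕ → ℝ≥0) → ℝ≥0∞) (seqCons u g)) hm2.aemeasurable]
      refine (lintegral_congr fun g => ?_).trans lintegral_zero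
      refine (lintegral_congr_ae (g := 0) ?_).trans lintegral_zero
      filter_upwards [compl_mem_ae_iff.2 (stdExp_singleton (c - psum g i))] with u hu
      rw [Set.indicator_of_notMem, Pi.zero_apply]
      intro h
      have h' : psum (seqCons u g) (i + 1) = c := h
      rw [psum_seqCons_succ] at h'
      exact hu (by simp [← h'])
    exact compl_mem_ae_iff.2 this

lemma ae_psum_smul_ne {a b : Clock} (hab : a ≠ b) (d : ℝ≥0) (i i' : ℕ) :
    ∀ᵐ g ∂clockLaw, psum (g b) i' ≠ d * psum (g a) i := by
  have h := Measure.infinitePi_map_eval_prod (P := fun _ : Clock => gapLaw) hab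
  have hm : MeasurableSet {p : (ℕ → ℝ≥0) × (ℕ → ℝ≥0) | psum p.2 i' = d * psum p.1 i} :=
    measurableSet_eq_fun (by fun_prop) (by fun_prop)
  have h2 : ∀ᵐ p ∂(clockLaw.map fun g => (g a, g b)), psum p.2 i' ≠ d * psum p.1 i := by
    rw [clockLaw, h]
    refine compl_mem_ae_iff.2 ((Measure.measure_prod_null hm).2 ?_)
    refine Filter.Eventually.of_forall fun g => ?_
    exact compl_mem_ae_iff.1 (ae_psum_ne i' (d * psum g i))
  exact ae_of_ae_map (f := fun g : Clock → ℕ → ℝ≥0 => (g a, g b))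
    (p := fun p => psum p.2 i' ≠ d * psum p.1 i) (by fun_prop) h2

lemma stdExp_Iic_le (c : ℝ≥0) : stdExp (Set.Iic c) ≤ c := by
  have h1 : stdExp (Set.Iic c) = expMeasure (1 : ℝ≥0) (Set.Iic (c : ℝ)) := by
    rw [stdExp, Measure.map_apply (by fun_prop) measurableSet_Iic]
    congr 1
    ext x
    simp [Real.toNNReal_le_iff_le_coe]
  rw [h1, expMeasure_Iio one_pos, disc_coe, tsub_le_iff_right, ← ENNReal.ofReal_coe_nnreal,
    ← ENNReal.ofReal_add (by positivity) (by positivity), ENNReal.one_le_ofReal]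
  have := Real.add_one_le_exp (-((1 : ℝ≥0) * (c : ℝ)))
  simp at this ⊢
  linarith

lemma pt_eq_coe (S : Params) (g : Clock → ℕ → ℝ≥0) {a : Clock} (ha : a.rateNN S ≠ 0) (i : ℕ) :
    pt S g a i = (psum (g a) i / a.rateNN S : ℝ≥0) := by
  rw [pt, ← Clock.coe_rateNN, ENNReal.coe_div ha]

/-- Borel–Cantelli: a clock rings by time `N` with probability at most its rate times `N`, and the
rates at one level are summable. -/
lemma ae_finite_first (S : Params) (j : ℤ) (N : ℕ) :
    ∀ᵐ g ∂clockLaw, {a : Clock | a.source = j ∧ pt S g a 0 ≤ N}.Finite := by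
  have hpos : ∀ᵐ g ∂clockLaw, ∀ a : Clock, 0 < g a 0 :=
    ae_all_iff.2 fun a => (ae_clock (gapLaw_apply_eq 0 0) a).mono fun g hg => pos_iff_ne_zero.2 hg
  have hle : ∀ a : Clock, clockLaw {g | a.source = j ∧ a.rateNN S ≠ 0 ∧ g a 0 ≤ a.rateNN S * N}
      ≤ activeRate S j a * (N : ℝ≥0∞) := by
    intro a
    by_cases ha : a.source = j
    · have h1 : clockLaw {g : Clock → ℕ → ℝ≥0 | g a 0 ≤ a.rateNN S * N}
          = stdExp (Set.Iic (a.rateNN S * N)) := by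
        rw [← Measure.infinitePi_map_eval (fun _ : ℕ => stdExp) 0,
          ← show gapLaw = Measure.infinitePi (fun _ : ℕ => stdExp) from rfl,
          ← Measure.infinitePi_map_eval (fun _ : Clock => gapLaw) a,
          Measure.map_map (by fun_prop) (by fun_prop),
          Measure.map_apply (by fun_prop) measurableSet_Iic]
        rfl
      refine (measure_mono fun g hg => hg.2.2).trans (h1.le.trans ((stdExp_Iic_le _).trans ?_))
      simp [activeRate, ha]
    · simp [ha]
  have hsum : ∑' a : Clock,
      clockLaw {g | a.source = j ∧ a.rateNN S ≠ 0 ∧ g a 0 ≤ a.rateNN S * N} ≠ ⊤ := by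
    refine ne_top_of_le_ne_top ?_ (ENNReal.tsum_le_tsum hle)
    rw [ENNReal.tsum_mul_right]
    exact ENNReal.mul_ne_top (tsum_activeRate_ne_top S j) (by simp)
  filter_upwards [ae_finite_setOfPred_mem hsum, hpos] with g hg hp
  refine hg.subset fun a ha => ?_
  obtain ⟨h1, h2⟩ := ha
  have hr : a.rateNN S ≠ 0 := by
    intro h0
    have : a.rate S = 0 := by rw [← Clock.coe_rateNN, h0]; rfl
    rw [pt, this, ENNReal.div_zero (by simpa [psum_zero] using (hp a).ne')] at h2
    simp at h2
  refine ⟨h1, hr, ?_⟩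
  rw [pt_eq_coe S g hr, psum_zero] at h2
  have h3 : g a 0 / a.rateNN S ≤ N := by exact_mod_cast h2
  rwa [div_le_iff₀' (pos_iff_ne_zero.2 hr)] at h3

/-- Positivity of the gaps is essential: `0 / 0 = 0` in `ℝ≥0∞`, so a zero gap would let a clock of
rate zero ring at time zero. -/
lemma pt_eq_top {S : Params} {g : Clock → ℕ → ℝ≥0} {a : Clock} (hpos : ∀ i, 0 < g a i)
    (ha : a.rateNN S = 0) (i : ℕ) : pt S g a i = ⊤ := by
  have h0 : a.rate S = 0 := by rw [← Clock.coe_rateNN, ha]; rfl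
  have h1 : 0 < psum (g a) i :=
    (hpos 0).trans_le (by simpa [psum_zero] using psum_mono (g a) (Nat.zero_le i))
  rw [pt, h0, ENNReal.div_zero (by simpa using h1.ne')]

lemma ae_good (S : Params) : ∀ᵐ g ∂clockLaw, Good S g := by
  have h1 : ∀ᵐ g ∂clockLaw, ∀ (a : Clock) (i : ℕ), 0 < g a i :=
    ae_all_iff.2 fun a => ae_all_iff.2 fun i =>
      (ae_clock (gapLaw_apply_eq i 0) a).mono fun g hg => pos_iff_ne_zero.2 hg
  have h2 : ∀ᵐ g ∂clockLaw, ∀ (a : Clock) c, ∃ n, c < psum (g a) n :=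
    ae_all_iff.2 fun a => ae_clock ae_exists_lt_psum a
  -- A coincidence of points of two clocks with positive rates makes one partial sum a fixed
  -- multiple of an independent one that has no atoms.
  have h3 : ∀ᵐ g ∂clockLaw, ∀ (a b : Clock) (i i' : ℕ), a ≠ b →
      psum (g b) i' ≠ (b.rateNN S / a.rateNN S) * psum (g a) i := by
    refine ae_all_iff.2 fun a => ae_all_iff.2 fun b => ae_all_iff.2 fun i =>
      ae_all_iff.2 fun i' => ?_
    by_cases hab : a = b
    · simp [hab]
    · exact (ae_psum_smul_ne hab _ i i').mono fun g hg _ => hg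
  have h4 : ∀ᵐ g ∂clockLaw, ∀ j (N : ℕ), {a : Clock | a.source = j ∧ pt S g a 0 ≤ N}.Finite :=
    ae_all_iff.2 fun j => ae_all_iff.2 fun N => ae_finite_first S j N
  filter_upwards [h1, h2, h3, h4] with g h1 h2 h3 h4
  refine ⟨h1, h2, fun a b hab i i' h => ?_, h4⟩
  by_cases ha : a.rateNN S = 0
  · exact pt_eq_top (h1 a) ha i
  by_cases hb : b.rateNN S = 0
  · rw [h]; exact pt_eq_top (h1 b) hb i'
  exfalso
  rw [pt_eq_coe S g ha, pt_eq_coe S g hb, ENNReal.coe_inj] at h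
  refine h3 a b i i' hab ?_
  field_simp at h ⊢
  rw [← h]

end AlmostSure

section Shift

variable {S : Params} {g : Clock → ℕ → ℝ≥0}

lemma pt_mono (S : Params) (g : Clock → ℕ → ℝ≥0) (a : Clock) : Monotone (pt S g a) :=
  fun _ _ h => ENNReal.div_le_div_right (by exact_mod_cast psum_mono (g a) h) _

lemma Good.pt_pos (hg : Good S g) (a : Clock) (i : ℕ) : 0 < pt S g a i := by
  refine ENNReal.div_pos ?_ (a.rate_ne_top S)
  have h1 : 0 < psum (g a) i :=
    (hg.pos a 0).trans_le (by simpa [psum_zero] using psum_mono (g a) (Nat.zero_le i))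
  simpa using h1.ne'

lemma Good.shiftClocks_pos (hg : Good S g) (t : ℝ≥0) (a : Clock) (i : ℕ) :
    0 < shiftClocks S t g a i := by
  unfold shiftClocks
  cases i with
  | zero =>
    have h1 := add_psum_shift (hg.unbounded a (a.rateNN S * t)) 0
    have h2 := lt_psum_passage (hg.unbounded a (a.rateNN S * t))
    rw [psum_zero, add_zero] at h1
    rw [← h1] at h2
    exact pos_of_lt_add_right h2
  | succ i =>
    have h1 := add_psum_shift (hg.unbounded a (a.rateNN S * t)) i
    have h2 := add_psum_shift (hg.unbounded a (a.rateNN S * t)) (i + 1)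
    rw [psum_succ, ← add_assoc, h1, ← add_assoc, psum_succ] at h2
    rw [add_left_cancel h2]
    exact hg.pos _ _

/-- The shifted clock keeps the points after `t` and only renumbers them. -/
lemma add_pt_shiftClocks (hg : Good S g) (t : ℝ≥0) (a : Clock) (i : ℕ) :
    t + pt S (shiftClocks S t g) a i = pt S g a (passage (a.rateNN S * t) (g a) + i) := by
  by_cases ha : a.rateNN S = 0
  · rw [pt_eq_top (hg.pos a) ha, pt_eq_top (hg.shiftClocks_pos t a) ha, add_top]
  · rw [pt_eq_coe S _ ha, pt_eq_coe S _ ha, ← ENNReal.coe_add, ENNReal.coe_inj,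
      ← add_psum_shift (hg.unbounded a (a.rateNN S * t)), shiftClocks, add_div,
      mul_div_cancel_left₀ _ ha]

lemma exists_pt_shiftClocks (hg : Good S g) (t : ℝ≥0) {a : Clock} {i : ℕ} (h : t < pt S g a i) :
    ∃ i', t + pt S (shiftClocks S t g) a i' = pt S g a i := by
  by_cases ha : a.rateNN S = 0
  · exact ⟨0, by rw [pt_eq_top (hg.pos a) ha, pt_eq_top (hg.shiftClocks_pos t a) ha, add_top]⟩
  · have hle : passage (a.rateNN S * t) (g a) ≤ i := by
      by_contra! hlt
      have h1 := psum_le_of_lt_passage hlt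
      rw [pt_eq_coe S g ha, ENNReal.coe_lt_coe, lt_div_iff₀' (pos_iff_ne_zero.2 ha)] at h
      exact h.not_ge h1
    obtain ⟨k, rfl⟩ := Nat.exists_eq_add_of_le hle
    exact ⟨k, add_pt_shiftClocks hg t a k⟩

/-- Lets the pathwise decomposition at the first event be iterated: the clocks seen from an event
are as regular as those at time zero. -/
lemma Good.shift (hg : Good S g) (t : ℝ≥0) : Good S (shiftClocks S t g) where
  pos := hg.shiftClocks_pos t
  unbounded a c := by
    have h0 := hg.unbounded a (a.rateNN S * t)
    obtain ⟨n, hn⟩ := hg.unbounded a (a.rateNN S * t + c)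
    refine ⟨n, ?_⟩
    have h1 := add_psum_shift h0 n
    have h2 : psum (g a) n ≤ psum (g a) (passage (a.rateNN S * t) (g a) + n) :=
      psum_mono _ (Nat.le_add_left _ _)
    rw [← h1] at h2
    exact lt_of_add_lt_add_left (hn.trans_le h2)
  distinct a b hab i i' h := by
    have h1 : pt S g a (passage (a.rateNN S * t) (g a) + i)
        = pt S g b (passage (b.rateNN S * t) (g b) + i') := by
      rw [← add_pt_shiftClocks hg, ← add_pt_shiftClocks hg, h]
    have h2 := hg.distinct a b hab _ _ h1
    rw [← add_pt_shiftClocks hg] at h2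
    simpa using h2
  finite j N := by
    obtain ⟨M, hM⟩ := exists_nat_ge t
    refine (hg.finite j (M + N)).subset ?_
    rintro a ⟨ha, hN⟩
    refine ⟨ha, ?_⟩
    refine (pt_mono S g a (Nat.zero_le (passage (a.rateNN S * t) (g a) + 0))).trans ?_
    rw [← add_pt_shiftClocks hg]
    push_cast
    exact add_le_add (by exact_mod_cast hM) hN

/-- Finitely many clocks of level `j` ring up to any given time, and each of them finitely often.
The infimum is then one over a finite set, so the next point really is a ring. -/
lemma exists_pt_eq_nextPt (hg : Good S g) {j : ℤ} {T : ℝ≥0∞} (h : nextPt S g j T ≠ ⊤) :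
    ∃ a, a.source = j ∧ ∃ i, T < pt S g a i ∧ pt S g a i = nextPt S g j T := by
  obtain ⟨N, hN⟩ := ENNReal.exists_nat_gt h
  let A : Set (Clock × ℕ) := {p | p.1.source = j ∧ T < pt S g p.1 p.2 ∧ pt S g p.1 p.2 ≤ N}
  have hfin : A.Finite := by
    have h1 : A ⊆ ⋃ a ∈ {a : Clock | a.source = j ∧ pt S g a 0 ≤ N},
        Prod.mk a '' {i | pt S g a i ≤ N} := by
      rintro ⟨a, i⟩ ⟨h1, -, h3⟩
      simp only [Set.mem_iUnion]
      exact ⟨a, ⟨h1, (pt_mono S g a (Nat.zero_le i)).trans h3⟩, i, h3, rfl⟩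
    refine Set.Finite.subset (Set.Finite.biUnion (hg.finite j N) fun a _ => ?_) h1
    refine Set.Finite.image _ ?_
    by_cases ha : a.rateNN S = 0
    · simp [pt_eq_top (hg.pos a) ha]
    obtain ⟨n, hn⟩ := hg.unbounded a (a.rateNN S * N)
    refine (Set.finite_Iio n).subset fun i hi => ?_
    by_contra hni
    have h2 : pt S g a i ≤ N := hi
    rw [pt_eq_coe S g ha] at h2
    have h3 : psum (g a) i / a.rateNN S ≤ N := by exact_mod_cast h2
    rw [div_le_iff₀' (pos_iff_ne_zero.2 ha)] at h3
    exact (hn.trans_le (psum_mono (g a) (not_lt.1 hni))).not_ge h3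
  have hne : A.Nonempty := by
    simp only [nextPt, iInf_lt_iff] at hN
    obtain ⟨a, ha, i, hi, hlt⟩ := hN
    exact ⟨(a, i), ha, hi, hlt.le⟩
  obtain ⟨⟨a, i⟩, ⟨ha, hi, hiN⟩, hmin⟩ := Set.exists_min_image A (fun p => pt S g p.1 p.2) hfin hne
  refine ⟨a, ha, i, hi, le_antisymm ?_ ?_⟩
  · refine le_iInf fun b => le_iInf fun hb => le_iInf fun i' => le_iInf fun hi' => ?_
    rcases le_or_gt (pt S g b i') N with h1 | h1
    · exact hmin (b, i') ⟨hb, hi', h1⟩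
    · exact hiN.trans h1.le
  · exact iInf_le_of_le a (iInf_le_of_le ha (iInf_le_of_le i (iInf_le_of_le hi le_rfl)))

lemma nextPt_le {j : ℤ} {T : ℝ≥0∞} {a : Clock} (ha : a.source = j) {i : ℕ} (hi : T < pt S g a i) :
    nextPt S g j T ≤ pt S g a i :=
  iInf_le_of_le a (iInf_le_of_le ha (iInf_le_of_le i (iInf_le_of_le hi le_rfl)))

lemma le_nextPt {j : ℤ} {T : ℝ≥0∞} : T ≤ nextPt S g j T :=
  le_iInf fun _ => le_iInf fun _ => le_iInf fun _ => le_iInf fun hi => hi.le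

lemma lt_nextPt (hg : Good S g) {j : ℤ} {T : ℝ≥0∞} (hT : T ≠ ⊤) : T < nextPt S g j T := by
  by_cases h : nextPt S g j T = ⊤
  · rw [h]; exact hT.lt_top
  · obtain ⟨a, -, i, hi, he⟩ := exists_pt_eq_nextPt hg h
    rwa [← he]

lemma nextPt_shiftClocks (hg : Good S g) (t : ℝ≥0) (j : ℤ) (T : ℝ≥0∞) :
    nextPt S g j (t + T) = t + nextPt S (shiftClocks S t g) j T := by
  refine le_antisymm ?_ ?_
  · by_cases h : nextPt S (shiftClocks S t g) j T = ⊤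
    · simp [h]
    · obtain ⟨a, ha, i, hi, he⟩ := exists_pt_eq_nextPt (hg.shift t) h
      rw [← he, add_pt_shiftClocks hg]
      refine nextPt_le ha ?_
      rw [← add_pt_shiftClocks hg]
      exact (ENNReal.add_lt_add_iff_left ENNReal.coe_ne_top).2 hi
  · refine le_iInf fun a => le_iInf fun ha => le_iInf fun i => le_iInf fun hi => ?_
    obtain ⟨i', hi'⟩ := exists_pt_shiftClocks hg t (le_self_add.trans_lt hi)
    rw [← hi']
    refine add_le_add le_rfl (nextPt_le ha ?_)
    rw [← hi'] at hi
    exact (ENNReal.add_lt_add_iff_left ENNReal.coe_ne_top).1 hi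

/-- The clocks that ring at the first ring after `T` are the same for the shifted clocks. -/
lemma rings_shiftClocks_iff (hg : Good S g) (t : ℝ≥0) {u : ℝ≥0∞} (hu : 0 < u) (a : Clock) :
    (∃ i, pt S g a i = t + u) ↔ ∃ i, pt S (shiftClocks S t g) a i = u := by
  constructor
  · rintro ⟨i, hi⟩
    obtain ⟨i', hi'⟩ := exists_pt_shiftClocks hg t (a := a) (i := i)
      (by rw [hi]; exact ENNReal.lt_add_right ENNReal.coe_ne_top hu.ne')
    refine ⟨i', ?_⟩
    rw [hi] at hi'
    exact (ENNReal.add_right_inj ENNReal.coe_ne_top).1 hi'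
  · rintro ⟨i, hi⟩
    exact ⟨_, by rw [← add_pt_shiftClocks hg t a i, hi]⟩

end Shift
end PRP

/-! ### The embedded chain and its decomposition at the first event -/

namespace PRP

variable {S : Params} {b : Option ℤ} {g : Clock → ℕ → ℝ≥0} {y : ℕ → ℤ → ℝ≥0}

/-- The system started from an arbitrary state. The customers that arrive at the `(m + 1)`-st event
bring the works `y m`. -/
noncomputable def chain (S : Params) (b : Option ℤ) (g : Clock → ℕ → ℝ≥0) (y : ℕ → ℤ → ℝ≥0)
    (s : State) : ℕ → State
  | 0 => s
  | m + 1 => step S b ⟨g, y⟩ (y m) (chain S b g y s m)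

lemma state_eq_chain (S : Params) (b : Option ℤ) (n₀ : ℤ) (x : Input) (m : ℕ) :
    state S b n₀ x m = chain S b x.gap (fun i => x.work (i + 1))
      ⟨0, n₀, fun n => (x.work 0 n : ℝ≥0∞)⟩ m := by
  induction m with
  | zero => rfl
  | succ m ih => rw [state, chain, ih]; rfl

/-- The recursion defining `chain` peels off the last event, the Markov property needs the first. -/
lemma chain_succ (s : State) (m : ℕ) :
    chain S b g y s (m + 1)
      = chain S b g (fun i => y (i + 1)) (step S b ⟨g, y⟩ (y 0) s) m := by
  induction m with
  | zero => rfl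
  | succ m ih => rw [chain, ih]; rfl

/-- The residual works after a jump from level `j` to level `m`, when the customer `j` has been
served for a time `t` since the last event. -/
noncomputable def newResid (j m : ℤ) (r : ℤ → ℝ≥0∞) (t : ℝ≥0∞) (fresh : ℤ → ℝ≥0) :
    ℤ → ℝ≥0∞ := fun n =>
  if j < n ∧ n ≤ m then (fresh n : ℝ≥0∞) else if n = j then r n - t else r n

open Classical in
/-- The level after a ring of one of the clocks that satisfy `p`. -/
noncomputable def jumpLevel (b : Option ℤ) (j : ℤ) (p : Clock → Prop) : ℤ :=
  if h : ∃ a, p a then reflectAt b h.choose.target else j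

/-- Makes the choice inside `step` harmless: on good clocks only one clock rings at a time. -/
lemma jumpLevel_of_unique {j : ℤ} {p : Clock → Prop} {a : Clock} (ha : p a)
    (hu : ∀ a', p a' → a' = a) : jumpLevel b j p = reflectAt b a.target := by
  unfold jumpLevel
  have h : ∃ a, p a := ⟨a, ha⟩
  rw [dif_pos h, hu _ h.choose_spec]

open Classical in
lemma step_eq (S : Params) (b : Option ℤ) (x : Input) (fresh : ℤ → ℝ≥0) (s : State) :
    step S b x fresh s =
      if completion b s = ⊤ ∧ nextPt S x.gap s.level s.time = ⊤ then { s with time := ⊤ }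
      else if completion b s ≤ nextPt S x.gap s.level s.time then
        ⟨completion b s, s.level - 1, s.resid⟩
      else
        let m := jumpLevel b s.level fun a =>
          a.source = s.level ∧ ∃ i, pt S x.gap a i = nextPt S x.gap s.level s.time
        ⟨nextPt S x.gap s.level s.time, m,
          newResid s.level m s.resid (nextPt S x.gap s.level s.time - s.time) fresh⟩ := rfl

/-- The state at a time that is later by `t`. -/
noncomputable def State.delay (t : ℝ≥0) (s : State) : State := { s with time := t + s.time }

lemma completion_delay (t : ℝ≥0) (s : State) :
    completion b (s.delay t) = t + completion b s := by
  by_cases h : b = some s.level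
  · simp [completion, State.delay, h]
  · simp [completion, State.delay, h, add_assoc]

/-- Homogeneity in time: a later state under the given clocks evolves like the earlier state under
the shifted clocks. The works `y'` are arbitrary because `step` reads only the gaps of its input and
`fresh`. -/
lemma step_delay (hg : Good S g) (y' : ℕ → ℤ → ℝ≥0) (t : ℝ≥0) (fresh : ℤ → ℝ≥0) (s : State) :
    step S b ⟨g, y⟩ fresh (s.delay t)
      = (step S b ⟨shiftClocks S t g, y'⟩ fresh s).delay t := by
  have ht : (t : ℝ≥0∞) ≠ ⊤ := ENNReal.coe_ne_top
  rw [step_eq, step_eq, completion_delay]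
  have hn : nextPt S g (s.delay t).level (s.delay t).time
      = t + nextPt S (shiftClocks S t g) s.level s.time := nextPt_shiftClocks hg t _ _
  simp only [hn]
  have htop : ∀ c : ℝ≥0∞, t + c = ⊤ ↔ c = ⊤ := fun c => by simp
  simp only [htop]
  by_cases h1 : completion b s = ⊤ ∧ nextPt S (shiftClocks S t g) s.level s.time = ⊤
  · simp only [if_pos h1]
    simp [State.delay]
  · rw [if_neg h1, if_neg h1]
    by_cases h2 : completion b s ≤ nextPt S (shiftClocks S t g) s.level s.time
    · rw [if_pos h2, if_pos (add_le_add le_rfl h2)]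
      rfl
    · rw [if_neg h2, if_neg (by rwa [ENNReal.add_le_add_iff_left ht])]
      -- Shifted clocks show only points strictly after `t`, so rings can be compared only at
      -- positive shifted times.
      have hpos : 0 < nextPt S (shiftClocks S t g) s.level s.time := by
        by_cases hT : s.time = ⊤
        · exact lt_of_lt_of_le (by simp [hT]) le_nextPt
        · exact zero_le.trans_lt (lt_nextPt (hg.shift t) hT)
      have hp : (fun a : Clock => a.source = (s.delay t).level ∧
            ∃ i, pt S g a i = t + nextPt S (shiftClocks S t g) s.level s.time)
          = fun a => a.source = s.level ∧
            ∃ i, pt S (shiftClocks S t g) a i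
              = nextPt S (shiftClocks S t g) s.level s.time := by
        funext a
        rw [rings_shiftClocks_iff hg t hpos]
        rfl
      simp only [hp]
      simp only [State.delay, ENNReal.add_sub_add_eq_sub_left ht]

lemma chain_delay (hg : Good S g) (t : ℝ≥0) (s : State) (m : ℕ) :
    chain S b g y (s.delay t) m = (chain S b (shiftClocks S t g) y s m).delay t := by
  induction m with
  | zero => rfl
  | succ m ih => rw [chain, chain, ih, step_delay hg y]

lemma time_le_step (x : Input) (fresh : ℤ → ℝ≥0) (s : State) :
    s.time ≤ (step S b x fresh s).time := by
  rw [step_eq]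
  split_ifs
  · simp
  · simp only [completion]
    split_ifs <;> simp
  · exact le_nextPt

lemma chain_time_mono (s : State) : Monotone fun m => (chain S b g y s m).time :=
  monotone_nat_of_le_succ fun _ => time_le_step _ _ _

/-- The discounted indicator of the event that the levels up to the `n`-th event lie in prescribed
sets. -/
noncomputable def weight (q : ℝ≥0) (C : ℕ → Set ℤ) (f : ℕ → State) (n : ℕ) : ℝ≥0∞ :=
  disc q (f n).time * ∏ i ∈ Finset.range (n + 1), (C i).indicator 1 (f i).level

/-- The residual work of the customer in service, infinite if the server does not work. -/
noncomputable def serviceTime (b : Option ℤ) (j : ℤ) (r : ℤ → ℝ≥0∞) : ℝ≥0∞ :=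
  open Classical in if b = some j then ⊤ else r j

lemma completion_zero (j : ℤ) (r : ℤ → ℝ≥0∞) : completion b ⟨0, j, r⟩ = serviceTime b j r := by
  simp [completion, serviceTime]

section FirstStep

variable {j : ℤ} {r : ℤ → ℝ≥0∞} {fresh : ℤ → ℝ≥0}

/-- The inequality is weak, in agreement with `step`, where a completion wins a tie against a ring.
-/
lemma mem_quiet_iff (hg : Good S g) (w : ℝ≥0) :
    g ∈ quiet S {a | a.source = j} w ↔ w ≤ nextPt S g j 0 := by
  constructor
  · intro h
    refine le_iInf fun a => le_iInf fun ha => le_iInf fun i => le_iInf fun _ => ?_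
    refine le_trans ?_ (pt_mono S g a (Nat.zero_le i))
    by_cases hr : a.rateNN S = 0
    · rw [pt_eq_top (hg.pos a) hr]; exact le_top
    · rw [pt_eq_coe S g hr, psum_zero, ENNReal.coe_le_coe, le_div_iff₀' (pos_iff_ne_zero.2 hr)]
      exact h a ha
  · intro h a ha
    have h1 := h.trans (nextPt_le ha (hg.pt_pos a 0))
    by_cases hr : a.rateNN S = 0
    · simp [hr]
    · rwa [pt_eq_coe S g hr, psum_zero, ENNReal.coe_le_coe,
        le_div_iff₀' (pos_iff_ne_zero.2 hr)] at h1

lemma step_of_completion (hw : serviceTime b j r ≠ ⊤) (h : serviceTime b j r ≤ nextPt S g j 0) :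
    step S b ⟨g, y⟩ fresh ⟨0, j, r⟩ = ⟨serviceTime b j r, j - 1, r⟩ := by
  rw [step_eq]
  simp only [completion_zero]
  rw [if_neg (by simp [hw]), if_pos h]

lemma nextPt_of_ringsFirst (hg : Good S g) {a : Clock} (ha : a.source = j)
    (h : g ∈ ringsFirst S a) : nextPt S g j 0 = (g a 0 / a.rateNN S : ℝ≥0) := by
  refine le_antisymm ?_ ?_
  · refine (nextPt_le ha (hg.pt_pos a 0)).trans ?_
    rw [pt_eq_coe S g h.1, psum_zero]
  · rw [← mem_quiet_iff hg]
    intro b hb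
    by_cases hba : b = a
    · subst hba
      rw [mul_div_cancel₀ _ h.1]
    · exact h.2 b hba (hb.trans ha.symm)

lemma step_of_ringsFirst (hg : Good S g) {a : Clock} (ha : a.source = j) (h : g ∈ ringsFirst S a)
    (hw : ((g a 0 / a.rateNN S : ℝ≥0) : ℝ≥0∞) < serviceTime b j r) :
    step S b ⟨g, y⟩ fresh ⟨0, j, r⟩
      = ⟨(g a 0 / a.rateNN S : ℝ≥0), reflectAt b a.target,
        newResid j (reflectAt b a.target) r (g a 0 / a.rateNN S : ℝ≥0) fresh⟩ := by
  have hn := nextPt_of_ringsFirst hg ha h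
  have hpt : pt S g a 0 = (g a 0 / a.rateNN S : ℝ≥0) := by rw [pt_eq_coe S g h.1, psum_zero]
  rw [step_eq]
  simp only [completion_zero, hn]
  rw [if_neg (by simp), if_neg (not_le.2 hw),
    jumpLevel_of_unique (a := a) ⟨ha, 0, hpt⟩ (fun a' ha' => ?_), tsub_zero]
  obtain ⟨-, i, hi⟩ := ha'
  by_contra hne
  have := hg.distinct a a' (Ne.symm hne) 0 i (by rw [hpt, hi])
  rw [hpt] at this
  exact ENNReal.coe_ne_top this

lemma ringsFirst_unique (hg : Good S g) {a a' : Clock} (ha : a.source = a'.source)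
    (h : g ∈ ringsFirst S a) (h' : g ∈ ringsFirst S a') : a = a' := by
  by_contra hne
  have h1 := nextPt_of_ringsFirst hg ha h
  have h2 := nextPt_of_ringsFirst hg rfl h'
  have := hg.distinct a a' hne 0 0 (by
    rw [pt_eq_coe S g h.1, pt_eq_coe S g h'.1, psum_zero, psum_zero, ← h1, ← h2])
  rw [pt_eq_coe S g h.1] at this
  exact ENNReal.coe_ne_top this

lemma exists_ringsFirst (hg : Good S g) (h : nextPt S g j 0 ≠ ⊤) :
    ∃ a, a.source = j ∧ g ∈ ringsFirst S a := by
  obtain ⟨a, ha, i, -, hi⟩ := exists_pt_eq_nextPt hg h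
  have hr : a.rateNN S ≠ 0 := by
    intro hr
    rw [← hi, pt_eq_top (hg.pos a) hr] at h
    exact h rfl
  have hle : ((g a 0 / a.rateNN S : ℝ≥0) : ℝ≥0∞) ≤ nextPt S g j 0 := by
    have h0 : pt S g a 0 = (g a 0 / a.rateNN S : ℝ≥0) := by rw [pt_eq_coe S g hr, psum_zero]
    rw [← hi, ← h0]
    exact pt_mono S g a (Nat.zero_le i)
  rw [← mem_quiet_iff hg] at hle
  exact ⟨a, ha, hr, fun b _ hb => hle b (hb.trans ha)⟩

end FirstStep

section Weight

variable {q : ℝ≥0} {C : ℕ → Set ℤ}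

lemma weight_zero (j : ℤ) (r : ℤ → ℝ≥0∞) :
    weight q C (chain S b g y ⟨0, j, r⟩) 0 = (C 0).indicator 1 j := by
  simp [weight, chain]

lemma weight_delay (f : ℕ → State) (t : ℝ≥0) (n : ℕ) :
    weight q C (fun m => (f m).delay t) n = disc q t * weight q C f n := by
  simp only [weight, State.delay, disc_add, mul_assoc]

lemma weight_succ (f : ℕ → State) (n : ℕ) :
    weight q C f (n + 1) = (C 0).indicator 1 (f 0).level
      * weight q (fun i => C (i + 1)) (fun i => f (i + 1)) n := by
  simp only [weight]
  rw [Finset.prod_range_succ' _ (n + 1)]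
  ring

/-- Pathwise Markov decomposition: after the first event the system starts afresh under shifted
clocks, and the elapsed time contributes a factor by multiplicativity of the discount. -/
lemma weight_chain_succ (hg : Good S g) {j j' : ℤ} {r r' : ℤ → ℝ≥0∞} {t : ℝ≥0}
    (h : step S b ⟨g, y⟩ (y 0) ⟨0, j, r⟩ = ⟨t, j', r'⟩) (n : ℕ) :
    weight q C (chain S b g y ⟨0, j, r⟩) (n + 1) = (C 0).indicator 1 j * (disc q t *
      weight q (fun i => C (i + 1))
        (chain S b (shiftClocks S t g) (fun i => y (i + 1)) ⟨0, j', r'⟩) n) := by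
  have h0 : (⟨t, j', r'⟩ : State) = State.delay t ⟨0, j', r'⟩ := by simp [State.delay]
  rw [weight_succ, ← weight_delay]
  congr 2
  funext m
  rw [chain_succ, h, h0, chain_delay hg]

lemma weight_chain_succ_of_top {j : ℤ} {r : ℤ → ℝ≥0∞}
    (h : (step S b ⟨g, y⟩ (y 0) ⟨0, j, r⟩).time = ⊤) (n : ℕ) :
    weight q C (chain S b g y ⟨0, j, r⟩) (n + 1) = 0 := by
  have h1 : (chain S b g y ⟨0, j, r⟩ 1).time = ⊤ := h
  have h2 := chain_time_mono (S := S) (b := b) (g := g) (y := y) ⟨0, j, r⟩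
    (Nat.le_add_left 1 n)
  simp only [h1, top_le_iff] at h2
  simp [weight, h2]

/-- The discounted indicator of `weight` for the system started at time zero with level `j` and
residual works `r`, by recursion on the number of events. -/
noncomputable def firstStep (S : Params) (b : Option ℤ) (q : ℝ≥0) :
    ℕ → (ℕ → Set ℤ) → ℤ → (ℤ → ℝ≥0∞) → (Clock → ℕ → ℝ≥0) → (ℕ → ℤ → ℝ≥0) → ℝ≥0∞
  | 0, C, j, _, _, _ => (C 0).indicator 1 j
  | n + 1, C, j, r, g, y => (C 0).indicator 1 j *
      ((quiet S {a | a.source = j} (serviceTime b j r).toNNReal).indicator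
          (fun g => disc q (serviceTime b j r) *
            firstStep S b q n (fun i => C (i + 1)) (j - 1) r
              (shiftClocks S (serviceTime b j r).toNNReal g) (fun i => y (i + 1))) g
        + ∑' a : Clock, if a.source = j then
          (ringsFirst S a).indicator (fun g =>
            {s : ℝ≥0 | (s : ℝ≥0∞) < serviceTime b j r}.indicator (fun s => disc q s *
              firstStep S b q n (fun i => C (i + 1)) (reflectAt b a.target)
                (newResid j (reflectAt b a.target) r s (y 0))
                (shiftClocks S s g) (fun i => y (i + 1))) (g a 0 / a.rateNN S)) g
          else 0)

lemma firstStep_zero (C : ℕ → Set ℤ) (j : ℤ) (r : ℤ → ℝ≥0∞) :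
    firstStep S b q 0 C j r g y = (C 0).indicator 1 j := rfl

lemma firstStep_succ (n : ℕ) (C : ℕ → Set ℤ) (j : ℤ) (r : ℤ → ℝ≥0∞) :
    firstStep S b q (n + 1) C j r g y = (C 0).indicator 1 j *
      ((quiet S {a | a.source = j} (serviceTime b j r).toNNReal).indicator
          (fun g => disc q (serviceTime b j r) *
            firstStep S b q n (fun i => C (i + 1)) (j - 1) r
              (shiftClocks S (serviceTime b j r).toNNReal g) (fun i => y (i + 1))) g
        + ∑' a : Clock, if a.source = j then
          (ringsFirst S a).indicator (fun g =>
            {s : ℝ≥0 | (s : ℝ≥0∞) < serviceTime b j r}.indicator (fun s => disc q s *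
              firstStep S b q n (fun i => C (i + 1)) (reflectAt b a.target)
                (newResid j (reflectAt b a.target) r s (y 0))
                (shiftClocks S s g) (fun i => y (i + 1))) (g a 0 / a.rateNN S)) g
          else 0) := rfl

attribute [irreducible] firstStep

/-- `weight` passes through the choice in `step` and is not visibly measurable. `firstStep` lists
the alternatives for the first event as disjoint indicators, which are measurable and can be
integrated one by one. -/
lemma firstStep_eq_weight (hg : Good S g) (n : ℕ) (C : ℕ → Set ℤ) (j : ℤ) (r : ℤ → ℝ≥0∞) :
    firstStep S b q n C j r g y = weight q C (chain S b g y ⟨0, j, r⟩) n := by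
  induction n generalizing C j r g y with
  | zero => rw [weight_zero, firstStep_zero]
  | succ n ih =>
    rw [firstStep_succ]
    by_cases h1 : serviceTime b j r = ⊤ ∧ nextPt S g j 0 = ⊤
    · rw [weight_chain_succ_of_top]
      · refine (congrArg _ ?_).trans (mul_zero _)
        rw [add_eq_zero]
        -- For infinite service time `toNNReal` gives `0` and the quiet event is no restriction, but
        -- the factor `disc q ⊤ = 0` removes the term.
        refine ⟨by simp [h1.1, Set.indicator], ENNReal.tsum_eq_zero.2 fun a => ?_⟩
        split_ifs with ha
        · refine Set.indicator_of_notMem (fun har => ?_) _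
          rw [nextPt_of_ringsFirst hg ha har] at h1
          exact ENNReal.coe_ne_top h1.2
        · rfl
      · rw [step_eq]
        simp only [completion_zero]
        rw [if_pos h1]
    by_cases h2 : serviceTime b j r ≤ nextPt S g j 0
    · have hw : serviceTime b j r ≠ ⊤ := by
        intro hw
        rw [hw, top_le_iff] at h2
        exact h1 ⟨hw, h2⟩
      have hq : g ∈ quiet S {a | a.source = j} (serviceTime b j r).toNNReal := by
        rwa [mem_quiet_iff hg, ENNReal.coe_toNNReal hw]
      have hstep := step_of_completion (y := y) (fresh := y 0) hw h2
      rw [← ENNReal.coe_toNNReal hw] at hstep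
      rw [weight_chain_succ hg hstep, Set.indicator_of_mem hq, ih (hg.shift _),
        ENNReal.coe_toNNReal hw]
      congr 1
      refine (congrArg _ (ENNReal.tsum_eq_zero.2 fun a => ?_)).trans (add_zero _)
      split_ifs with ha
      · by_cases har : g ∈ ringsFirst S a
        · rw [Set.indicator_of_mem har, Set.indicator_of_notMem]
          have := nextPt_of_ringsFirst hg ha har
          rw [this] at h2
          exact not_lt.2 h2
        · rw [Set.indicator_of_notMem har]
      · rfl
    · push Not at h2
      obtain ⟨a, ha, har⟩ := exists_ringsFirst hg h2.ne_top
      have hn := nextPt_of_ringsFirst hg ha har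
      have hlt := hn ▸ h2
      have hstep := step_of_ringsFirst (y := y) (fresh := y 0) hg ha har hlt
      rw [weight_chain_succ hg hstep, tsum_eq_single a]
      · have hmem : g a 0 / a.rateNN S ∈ {s : ℝ≥0 | (s : ℝ≥0∞) < serviceTime b j r} := hlt
        rw [if_pos ha, Set.indicator_of_mem har, Set.indicator_of_mem hmem, ih (hg.shift _)]
        congr 1
        refine (congrArg (· + _) ?_).trans (zero_add _)
        by_cases hw : serviceTime b j r = ⊤
        · simp [hw, Set.indicator]
        · rw [Set.indicator_of_notMem]
          rw [mem_quiet_iff hg, ENNReal.coe_toNNReal hw]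
          exact not_le.2 h2
      · intro a' hne
        split_ifs with ha'
        · rw [Set.indicator_of_notMem]
          exact fun h => hne (ringsFirst_unique hg (ha'.trans ha.symm) h har)
        · rfl

lemma measurable_serviceTime (b : Option ℤ) (j : ℤ) : Measurable (serviceTime b j) := by
  unfold serviceTime
  split_ifs <;> fun_prop

lemma measurable_newResid (j m : ℤ) :
    Measurable fun p : (ℤ → ℝ≥0∞) × ℝ≥0∞ × (ℤ → ℝ≥0) => newResid j m p.1 p.2.1 p.2.2 := by
  refine measurable_pi_iff.2 fun n => ?_
  unfold newResid
  split_ifs <;> fun_prop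

lemma measurableSet_quiet_pair (S : Params) (B : Set Clock) {α : Type*} [MeasurableSpace α]
    {w : α → ℝ≥0} {γ : α → Clock → ℕ → ℝ≥0} (hw : Measurable w) (hγ : Measurable γ) :
    MeasurableSet {p | γ p ∈ quiet S B (w p)} := by
  have : {p | γ p ∈ quiet S B (w p)} = ⋂ b, ⋂ (_ : b ∈ B), {p | b.rateNN S * w p ≤ γ p b 0} := by
    ext; simp [quiet]
  rw [this]
  exact .iInter fun b => .iInter fun _ => measurableSet_le (by fun_prop) (by fun_prop)

lemma measurable_firstStep (S : Params) (b : Option ℤ) (q : ℝ≥0) (n : ℕ) (C : ℕ → Set ℤ) (j : ℤ) :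
    Measurable fun p : (ℤ → ℝ≥0∞) × (Clock → ℕ → ℝ≥0) × (ℕ → ℤ → ℝ≥0) =>
      firstStep S b q n C j p.1 p.2.1 p.2.2 := by
  induction n generalizing C j with
  | zero => simp only [firstStep_zero]; exact measurable_const
  | succ n ih =>
    simp only [firstStep_succ]
    have hs := measurable_serviceTime b j
    have hsN : Measurable fun p : (ℤ → ℝ≥0∞) × (Clock → ℕ → ℝ≥0) × (ℕ → ℤ → ℝ≥0) =>
        (serviceTime b j p.1).toNNReal := (hs.comp measurable_fst).ennreal_toNNReal
    have hc (a : Clock) : Measurable fun p : (ℤ → ℝ≥0∞) × (Clock → ℕ → ℝ≥0) × (ℕ → ℤ → ℝ≥0) =>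
        ((p.2.1 a 0 / a.rateNN S : ℝ≥0) : ℝ≥0∞) := Measurable.coe_nnreal_ennreal (by fun_prop)
    refine Measurable.mul measurable_const (Measurable.add ?_ (Measurable.tsum fun a => ?_))
    · have h1 : MeasurableSet {p : (ℤ → ℝ≥0∞) × (Clock → ℕ → ℝ≥0) × (ℕ → ℤ → ℝ≥0) |
          p.2.1 ∈ quiet S {a | a.source = j} (serviceTime b j p.1).toNNReal} :=
        measurableSet_quiet_pair S _ (by fun_prop) (by fun_prop)
      refine Measurable.indicator (f := fun p : (ℤ → ℝ≥0∞) × (Clock → ℕ → ℝ≥0) × (ℕ → ℤ → ℝ≥0) =>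
        disc q (serviceTime b j p.1) * firstStep S b q n (fun i => C (i + 1)) (j - 1) p.1
          (shiftClocks S (serviceTime b j p.1).toNNReal p.2.1) (fun i => p.2.2 (i + 1))) ?_ h1
      refine Measurable.mul (by fun_prop) ((ih _ _).comp (Measurable.prodMk measurable_fst
        (Measurable.prodMk ((measurable_shiftClocks S).comp (Measurable.prodMk hsN ?_)) ?_)))
      all_goals fun_prop
    · split_ifs with ha
      swap
      · exact measurable_const
      have h1 : MeasurableSet {p : (ℤ → ℝ≥0∞) × (Clock → ℕ → ℝ≥0) × (ℕ → ℤ → ℝ≥0) |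
          p.2.1 ∈ ringsFirst S a} :=
        (by fun_prop : Measurable fun p : (ℤ → ℝ≥0∞) × (Clock → ℕ → ℝ≥0) × (ℕ → ℤ → ℝ≥0) => p.2.1)
          (measurableSet_ringsFirst S a)
      have h2 : MeasurableSet {p : (ℤ → ℝ≥0∞) × (Clock → ℕ → ℝ≥0) × (ℕ → ℤ → ℝ≥0) |
          ((p.2.1 a 0 / a.rateNN S : ℝ≥0) : ℝ≥0∞) < serviceTime b j p.1} :=
        measurableSet_lt (by fun_prop) (by fun_prop)
      refine Measurable.indicator (Measurable.indicator (s := {p | _}) (f := fun p :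
        (ℤ → ℝ≥0∞) × (Clock → ℕ → ℝ≥0) × (ℕ → ℤ → ℝ≥0) =>
        disc q (p.2.1 a 0 / a.rateNN S : ℝ≥0) * firstStep S b q n (fun i => C (i + 1))
          (reflectAt b a.target) (newResid j (reflectAt b a.target) p.1
            (p.2.1 a 0 / a.rateNN S : ℝ≥0) (p.2.2 0))
          (shiftClocks S (p.2.1 a 0 / a.rateNN S) p.2.1) (fun i => p.2.2 (i + 1))) ?_ h2) h1
      refine Measurable.mul (by fun_prop) ((ih _ _).comp (Measurable.prodMk
        ((measurable_newResid _ _).comp (Measurable.prodMk measurable_fst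
          (Measurable.prodMk (hc a) ?_)))
        (Measurable.prodMk ((measurable_shiftClocks S).comp (Measurable.prodMk ?_ ?_)) ?_)))
      all_goals fun_prop

end Weight

end PRP

/-! ### The Markov property in mean: the transition operator -/

namespace PRP

/-- The joint law of the works of customers with all labels. -/
noncomputable def workRow (S : Params) : Measure (ℤ → ℝ≥0) :=
  Measure.infinitePi fun n => (S.work n : Measure ℝ≥0)

instance (S : Params) : IsProbabilityMeasure (workRow S) := by unfold workRow; infer_instance

/-- The joint law of the works that arrive at the successive events. -/
noncomputable def worksLaw (S : Params) : Measure (ℕ → ℤ → ℝ≥0) :=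
  Measure.infinitePi fun _ => workRow S

instance (S : Params) : IsProbabilityMeasure (worksLaw S) := by unfold worksLaw; infer_instance

lemma lintegral_worksLaw (S : Params) {F : (ℤ → ℝ≥0) → (ℕ → ℤ → ℝ≥0) → ℝ≥0∞}
    (hF : Measurable fun p : (ℤ → ℝ≥0) × (ℕ → ℤ → ℝ≥0) => F p.1 p.2) :
    ∫⁻ y, F (y 0) (fun i => y (i + 1)) ∂worksLaw S
      = ∫⁻ z, ∫⁻ y, F z y ∂worksLaw S ∂workRow S := by
  unfold worksLaw
  rw [lintegral_seqCons (f := fun y => F (y 0) (fun i => y (i + 1))) _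
    (hF.comp (by fun_prop : Measurable fun y : ℕ → ℤ → ℝ≥0 => (y 0, fun i => y (i + 1))))]
  rfl

lemma disc_ne_top (c : ℝ≥0) (T : ℝ≥0∞) : disc c T ≠ ⊤ :=
  ne_top_of_le_ne_top ENNReal.one_ne_top (disc_le_one c T)

variable {S : Params} {b : Option ℤ} {q : ℝ≥0}

/-- The contribution of the arrivals and catastrophes to `transition`. -/
noncomputable def jumpOp (S : Params) (b : Option ℤ) (q : ℝ≥0)
    (f : ℤ → (ℤ → ℝ≥0∞) → ℝ≥0∞) (j : ℤ) (r : ℤ → ℝ≥0∞) : ℝ≥0∞ :=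
  ∑' a : Clock, if a.source = j then a.rate S * ∫⁻ s,
    {s : ℝ≥0 | (s : ℝ≥0∞) < serviceTime b j r}.indicator (fun s => disc (totalRate S j + q) s *
      ∫⁻ z, f (reflectAt b a.target) (newResid j (reflectAt b a.target) r s z) ∂workRow S) s ∂leb
    else 0

/-- The transition operator of the system from one event to the next, with discounting. -/
noncomputable def transition (S : Params) (b : Option ℤ) (q : ℝ≥0)
    (f : ℤ → (ℤ → ℝ≥0∞) → ℝ≥0∞) (j : ℤ) (r : ℤ → ℝ≥0∞) : ℝ≥0∞ :=
  disc (totalRate S j + q) (serviceTime b j r) * f (j - 1) r + jumpOp S b q f j r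

/-- The expectation of `weight` for the system started from level `j` and residual works `r`. -/
noncomputable def meanWeight (S : Params) (b : Option ℤ) (q : ℝ≥0) (n : ℕ) (C : ℕ → Set ℤ) (j : ℤ)
    (r : ℤ → ℝ≥0∞) : ℝ≥0∞ :=
  ∫⁻ p, firstStep S b q n C j r p.1 p.2 ∂(clockLaw.prod (worksLaw S))

lemma meanWeight_zero (C : ℕ → Set ℤ) (j : ℤ) (r : ℤ → ℝ≥0∞) :
    meanWeight S b q 0 C j r = (C 0).indicator 1 j := by
  simp [meanWeight, firstStep_zero]

lemma lintegral_quiet_level (S : Params) (j : ℤ) (s : ℝ≥0)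
    {f : (Clock → ℕ → ℝ≥0) → ℝ≥0∞} (hf : Measurable f) :
    ∫⁻ g, (quiet S {a | a.source = j} s).indicator (fun g => f (shiftClocks S s g)) g ∂clockLaw
      = disc (totalRate S j) s * ∫⁻ g, f g ∂clockLaw :=
  lintegral_quiet S _ (by
    convert! hasSum_activeRate S j using 2 with a
    simp only [activeRate, Set.mem_ofPred_eq]
    congr) s hf

/-- Given the first event, the shifted clocks have the original law and the next row of works is
independent of all later ones. A completion requires silence of the active clocks
(`lintegral_quiet_level`), a jump is a first ring (`lintegral_ringsFirst`). The discount at rate `q`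
merges with the survival factor of the clocks into one at rate `totalRate S j + q`. -/
lemma meanWeight_succ (n : ℕ) (C : ℕ → Set ℤ) (j : ℤ) (r : ℤ → ℝ≥0∞) :
    meanWeight S b q (n + 1) C j r = (C 0).indicator 1 j *
      transition S b q (meanWeight S b q n fun i => C (i + 1)) j r := by
  have hfs : ∀ j r, Measurable fun p : (Clock → ℕ → ℝ≥0) × (ℕ → ℤ → ℝ≥0) =>
      firstStep S b q n (fun i => C (i + 1)) j r p.1 p.2 := fun j r =>
    Measurable.of_uncurry_left (f := fun r (p : (Clock → ℕ → ℝ≥0) × (ℕ → ℤ → ℝ≥0)) =>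
      firstStep S b q n (fun i => C (i + 1)) j r p.1 p.2)
        (measurable_firstStep S b q n (fun i => C (i + 1)) j)
  set w := serviceTime b j r with hw
  have hA : Measurable fun p : (Clock → ℕ → ℝ≥0) × (ℕ → ℤ → ℝ≥0) =>
      (quiet S {a | a.source = j} w.toNNReal).indicator (fun g => disc q w *
        firstStep S b q n (fun i => C (i + 1)) (j - 1) r
          (shiftClocks S w.toNNReal g) (fun i => p.2 (i + 1))) p.1 := by
    refine Measurable.indicator (f := fun p : (Clock → ℕ → ℝ≥0) × (ℕ → ℤ → ℝ≥0) => disc q w *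
        firstStep S b q n (fun i => C (i + 1)) (j - 1) r
          (shiftClocks S w.toNNReal p.1) (fun i => p.2 (i + 1))) ?_
      (measurable_fst (measurableSet_quiet S _ _))
    refine Measurable.mul measurable_const ((hfs _ _).comp (Measurable.prodMk
      ((measurable_shiftClocks_const S _).comp measurable_fst) (by fun_prop)))
  have hB : ∀ a : Clock, Measurable fun p : (Clock → ℕ → ℝ≥0) × (ℕ → ℤ → ℝ≥0) =>
      (ringsFirst S a).indicator (fun g =>
            {s : ℝ≥0 | (s : ℝ≥0∞) < w}.indicator (fun s => disc q s *
              firstStep S b q n (fun i => C (i + 1)) (reflectAt b a.target)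
                (newResid j (reflectAt b a.target) r s (p.2 0))
                (shiftClocks S s g) (fun i => p.2 (i + 1))) (g a 0 / a.rateNN S)) p.1 := by
    intro a
    have h1 : MeasurableSet {p : (Clock → ℕ → ℝ≥0) × (ℕ → ℤ → ℝ≥0) | p.1 ∈ ringsFirst S a} :=
      measurable_fst (measurableSet_ringsFirst S a)
    have hc : Measurable fun p : (Clock → ℕ → ℝ≥0) × (ℕ → ℤ → ℝ≥0) =>
        ((p.1 a 0 / a.rateNN S : ℝ≥0) : ℝ≥0∞) := Measurable.coe_nnreal_ennreal (by fun_prop)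
    refine Measurable.indicator (Measurable.indicator (s := {p | _}) (f := fun p :
      (Clock → ℕ → ℝ≥0) × (ℕ → ℤ → ℝ≥0) => disc q (p.1 a 0 / a.rateNN S : ℝ≥0) *
        firstStep S b q n (fun i => C (i + 1))
        (reflectAt b a.target) (newResid j (reflectAt b a.target) r
          (p.1 a 0 / a.rateNN S : ℝ≥0) (p.2 0))
        (shiftClocks S (p.1 a 0 / a.rateNN S) p.1) (fun i => p.2 (i + 1))) ?_
      (measurableSet_lt hc measurable_const)) h1
    refine Measurable.mul ((measurable_disc q).comp hc)
      ((measurable_firstStep S b q n (fun i => C (i + 1)) (reflectAt b a.target)).comp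
      (Measurable.prodMk ((measurable_newResid _ _).comp (Measurable.prodMk measurable_const
        (Measurable.prodMk hc ?_)))
      (Measurable.prodMk ((measurable_shiftClocks S).comp (Measurable.prodMk ?_ ?_)) ?_)))
    all_goals fun_prop
  have h0 : meanWeight S b q (n + 1) C j r = (C 0).indicator 1 j *
      ((∫⁻ p, (quiet S {a | a.source = j} w.toNNReal).indicator (fun g => disc q w *
        firstStep S b q n (fun i => C (i + 1)) (j - 1) r
          (shiftClocks S w.toNNReal g) (fun i => p.2 (i + 1))) p.1 ∂(clockLaw.prod (worksLaw S)))
      + ∑' a : Clock, if a.source = j then ∫⁻ p, (ringsFirst S a).indicator (fun g =>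
            {s : ℝ≥0 | (s : ℝ≥0∞) < w}.indicator (fun s => disc q s *
              firstStep S b q n (fun i => C (i + 1)) (reflectAt b a.target)
                (newResid j (reflectAt b a.target) r s (p.2 0))
                (shiftClocks S s g) (fun i => p.2 (i + 1))) (g a 0 / a.rateNN S)) p.1
              ∂(clockLaw.prod (worksLaw S)) else 0) := by
    unfold meanWeight
    simp only [firstStep_succ]
    rw [lintegral_const_mul', lintegral_add_left hA, lintegral_tsum]
    · congr 3
      funext a
      split_ifs
      · rfl
      · simp
    · intro a
      split_ifs
      · exact (hB a).aemeasurable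
      · exact aemeasurable_const
    · by_cases hj : j ∈ C 0 <;> simp [hj]
  rw [h0, transition, jumpOp, ← hw]
  congr 2
  · rw [lintegral_prod_symm _ hA.aemeasurable]
    have h1 : ∀ y : ℕ → ℤ → ℝ≥0, ∫⁻ g, (quiet S {a | a.source = j} w.toNNReal).indicator
        (fun g => disc q w * firstStep S b q n (fun i => C (i + 1)) (j - 1) r
          (shiftClocks S w.toNNReal g) (fun i => y (i + 1))) g ∂clockLaw
        = disc (totalRate S j + q) w * ∫⁻ g, firstStep S b q n (fun i => C (i + 1)) (j - 1) r
          g (fun i => y (i + 1)) ∂clockLaw := by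
      intro y
      by_cases hwt : w = ⊤
      · simp [hwt]
      have hm : Measurable fun g => firstStep S b q n (fun i => C (i + 1)) (j - 1) r g
          (fun i => y (i + 1)) := (hfs (j - 1) r).comp measurable_prodMk_right
      rw [lintegral_quiet_level S j w.toNNReal (f := fun g => disc q w *
        firstStep S b q n (fun i => C (i + 1)) (j - 1) r g (fun i => y (i + 1))) (hm.const_mul _),
        lintegral_const_mul _ hm, ENNReal.coe_toNNReal hwt, ← mul_assoc, disc_add_rate]
    have hI : Measurable fun y : ℕ → ℤ → ℝ≥0 =>
        ∫⁻ g, firstStep S b q n (fun i => C (i + 1)) (j - 1) r g y ∂clockLaw :=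
      (hfs (j - 1) r).lintegral_prod_left'
    have hI' : Measurable fun y : ℕ → ℤ → ℝ≥0 => ∫⁻ g, firstStep S b q n (fun i => C (i + 1))
        (j - 1) r g (fun i => y (i + 1)) ∂clockLaw := hI.comp (by fun_prop :
      Measurable fun y : ℕ → ℤ → ℝ≥0 => fun i => y (i + 1))
    simp_rw [h1]
    rw [lintegral_const_mul _ hI']
    congr 1
    rw [lintegral_worksLaw S (F := fun _ y => ∫⁻ g, firstStep S b q n (fun i => C (i + 1)) (j - 1) r
      g y ∂clockLaw) (hI.comp measurable_snd), lintegral_const, measure_univ, mul_one, meanWeight,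
      lintegral_prod_symm _ (hfs _ _).aemeasurable]
  · congr 1
    funext a
    split_ifs with ha
    swap
    · rfl
    subst ha
    set m := reflectAt b a.target with hm
    have hF : Measurable fun p : (ℝ≥0 × (ℤ → ℝ≥0)) × (Clock → ℕ → ℝ≥0) × (ℕ → ℤ → ℝ≥0) =>
        firstStep S b q n (fun i => C (i + 1)) m (newResid a.source m r p.1.1 p.1.2)
          p.2.1 p.2.2 := by
      have h1 : Measurable fun p : (ℝ≥0 × (ℤ → ℝ≥0)) × (Clock → ℕ → ℝ≥0) × (ℕ → ℤ → ℝ≥0) =>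
          (p.1.1 : ℝ≥0∞) := Measurable.coe_nnreal_ennreal (by fun_prop)
      refine (measurable_firstStep S b q n (fun i => C (i + 1)) m).comp (Measurable.prodMk
        ((measurable_newResid _ _).comp (Measurable.prodMk measurable_const
          (Measurable.prodMk h1 ?_))) ?_)
      all_goals fun_prop
    rw [lintegral_prod_symm _ (hB a).aemeasurable]
    have hw1 : MeasurableSet {s : ℝ≥0 | (s : ℝ≥0∞) < w} :=
      measurableSet_lt measurable_coe_nnreal_ennreal measurable_const
    have h1 : ∀ y : ℕ → ℤ → ℝ≥0, ∫⁻ g, (ringsFirst S a).indicator (fun g =>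
            {s : ℝ≥0 | (s : ℝ≥0∞) < w}.indicator (fun s => disc q s *
              firstStep S b q n (fun i => C (i + 1)) m (newResid a.source m r s (y 0))
                (shiftClocks S s g) (fun i => y (i + 1))) (g a 0 / a.rateNN S)) g ∂clockLaw
        = a.rate S * ∫⁻ s, {s : ℝ≥0 | (s : ℝ≥0∞) < w}.indicator (fun s =>
          disc (totalRate S a.source + q) s * ∫⁻ g, firstStep S b q n (fun i => C (i + 1)) m
            (newResid a.source m r s (y 0)) g (fun i => y (i + 1)) ∂clockLaw) s ∂leb := by
      intro y
      have hH : Measurable fun p : ℝ≥0 × (Clock → ℕ → ℝ≥0) =>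
          {s : ℝ≥0 | (s : ℝ≥0∞) < w}.indicator (fun s => disc q s *
              firstStep S b q n (fun i => C (i + 1)) m (newResid a.source m r s (y 0))
                p.2 (fun i => y (i + 1))) p.1 := by
        refine Measurable.indicator (f := fun p : ℝ≥0 × (Clock → ℕ → ℝ≥0) => disc q p.1 *
              firstStep S b q n (fun i => C (i + 1)) m (newResid a.source m r p.1 (y 0))
                p.2 (fun i => y (i + 1))) ?_ (measurable_fst hw1)
        exact Measurable.mul
          ((measurable_disc q).comp (measurable_coe_nnreal_ennreal.comp measurable_fst))
          (hF.comp (by fun_prop : Measurable fun p : ℝ≥0 × (Clock → ℕ → ℝ≥0) =>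
            ((p.1, y 0), (p.2, fun i => y (i + 1)))))
      refine (lintegral_ringsFirst S a (H := fun s g => {s : ℝ≥0 | (s : ℝ≥0∞) < w}.indicator
        (fun s => disc q s * firstStep S b q n (fun i => C (i + 1)) m
          (newResid a.source m r s (y 0)) g (fun i => y (i + 1))) s) hH).trans ?_
      congr 1
      refine lintegral_congr fun s => ?_
      by_cases hs : s ∈ {s : ℝ≥0 | (s : ℝ≥0∞) < w}
      · simp only [Set.indicator_of_mem hs]
        rw [lintegral_const_mul' _ _ (disc_ne_top _ _), ← mul_assoc, disc_add_rate]
      · simp only [Set.indicator_of_notMem hs, lintegral_zero, mul_zero]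
    refine (lintegral_congr h1).trans ?_
    have hG : Measurable fun p : (ℝ≥0 × (ℤ → ℝ≥0)) × (ℕ → ℤ → ℝ≥0) =>
        ∫⁻ g, firstStep S b q n (fun i => C (i + 1)) m (newResid a.source m r p.1.1 p.1.2) g p.2
          ∂clockLaw := by
      have h2 : Measurable fun p : ((ℝ≥0 × (ℤ → ℝ≥0)) × (ℕ → ℤ → ℝ≥0)) × (Clock → ℕ → ℝ≥0) =>
        firstStep S b q n (fun i => C (i + 1)) m (newResid a.source m r p.1.1.1 p.1.1.2)
          p.2 p.1.2 := hF.comp (by fun_prop : Measurable fun p :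
            ((ℝ≥0 × (ℤ → ℝ≥0)) × (ℕ → ℤ → ℝ≥0)) × (Clock → ℕ → ℝ≥0) =>
              (p.1.1, (p.2, p.1.2)))
      exact h2.lintegral_prod_right'
    have hG2 : Measurable fun p : (ℕ → ℤ → ℝ≥0) × ℝ≥0 =>
        {s : ℝ≥0 | (s : ℝ≥0∞) < w}.indicator (fun s =>
          disc (totalRate S a.source + q) s * ∫⁻ g, firstStep S b q n (fun i => C (i + 1)) m
            (newResid a.source m r s (p.1 0)) g (fun i => p.1 (i + 1)) ∂clockLaw) p.2 := by
      refine Measurable.indicator (f := fun p : (ℕ → ℤ → ℝ≥0) × ℝ≥0 =>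
          disc (totalRate S a.source + q) p.2 * ∫⁻ g, firstStep S b q n (fun i => C (i + 1)) m
            (newResid a.source m r p.2 (p.1 0)) g (fun i => p.1 (i + 1)) ∂clockLaw) ?_
        (measurable_snd hw1)
      exact Measurable.mul
          ((measurable_disc _).comp (measurable_coe_nnreal_ennreal.comp measurable_snd))
          (hG.comp (by fun_prop : Measurable fun p : (ℕ → ℤ → ℝ≥0) × ℝ≥0 =>
            ((p.2, p.1 0), fun i => p.1 (i + 1))))
    rw [lintegral_const_mul _ hG2.lintegral_prod_right']
    congr 1
    rw [lintegral_lintegral_swap hG2.aemeasurable]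
    refine lintegral_congr fun s => ?_
    by_cases hs : s ∈ {s : ℝ≥0 | (s : ℝ≥0∞) < w}
    · simp only [Set.indicator_of_mem hs]
      rw [lintegral_const_mul' _ _ (disc_ne_top _ _),
        lintegral_worksLaw S (F := fun z y => ∫⁻ g, firstStep S b q n (fun i => C (i + 1)) m
          (newResid a.source m r s z) g y ∂clockLaw)
          (hG.comp (by fun_prop : Measurable fun p : (ℤ → ℝ≥0) × (ℕ → ℤ → ℝ≥0) =>
            ((s, p.1), p.2)))]
      congr 1
      refine lintegral_congr fun z => ?_
      rw [meanWeight, lintegral_prod_symm _ (hfs _ _).aemeasurable]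
    · simp only [Set.indicator_of_notMem hs, lintegral_zero]

end PRP

/-! ### Killing and resolvents of the transition operator -/

namespace PRP

/-- The discounted length of the time interval `[0, w)`. -/
noncomputable def discTime (c : ℝ≥0) (w : ℝ≥0∞) : ℝ≥0∞ :=
  ∫⁻ s, {s : ℝ≥0 | (s : ℝ≥0∞) < w}.indicator (fun s => disc c s) s ∂leb

lemma mul_discTime_add {c : ℝ≥0} (hc : c ≠ 0) (w : ℝ≥0∞) : c * discTime c w + disc c w = 1 :=
  lintegral_leb_disc_Iio hc w

lemma measurableSet_coe_lt (w : ℝ≥0∞) : MeasurableSet {s : ℝ≥0 | (s : ℝ≥0∞) < w} :=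
  measurableSet_lt measurable_coe_nnreal_ennreal measurable_const

/-- A function of the level and the residual works that is measurable in the latter. -/
def LevelMeasurable (f : ℤ → (ℤ → ℝ≥0∞) → ℝ≥0∞) : Prop := ∀ j, Measurable (f j)

/-- The function `f` on the levels in `C`, zero elsewhere. -/
noncomputable def cut (C : Set ℤ) (f : ℤ → (ℤ → ℝ≥0∞) → ℝ≥0∞) : ℤ → (ℤ → ℝ≥0∞) → ℝ≥0∞ :=
  fun j r => C.indicator 1 j * f j r

variable {S : Params} {b : Option ℤ} {q : ℝ≥0} {C D : Set ℤ}
  {f f' : ℤ → (ℤ → ℝ≥0∞) → ℝ≥0∞} {j : ℤ} {r : ℤ → ℝ≥0∞}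

lemma cut_of_mem (hj : j ∈ C) : cut C f j r = f j r := by simp [cut, hj]

lemma cut_of_notMem (hj : j ∉ C) : cut C f j r = 0 := by simp [cut, hj]

lemma LevelMeasurable.cut (hf : LevelMeasurable f) : LevelMeasurable (cut C f) :=
  fun j => (hf j).const_mul _

lemma LevelMeasurable.add (hf : LevelMeasurable f) (hf' : LevelMeasurable f') :
    LevelMeasurable (f + f') := fun j => (hf j).add (hf' j)

lemma levelMeasurable_const (c : ℝ≥0∞) : LevelMeasurable fun _ _ => c := fun _ => measurable_const

lemma cut_mono (h : f ≤ f') : cut C f ≤ cut C f' := fun j r => mul_le_mul_right (h j r) _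

lemma measurable_jump (hf : LevelMeasurable f) (j m : ℤ) (r : ℤ → ℝ≥0∞) :
    Measurable fun p : ℝ≥0 × (ℤ → ℝ≥0) => f m (newResid j m r p.1 p.2) := by
  have h1 : Measurable fun p : ℝ≥0 × (ℤ → ℝ≥0) => (p.1 : ℝ≥0∞) :=
    measurable_coe_nnreal_ennreal.comp measurable_fst
  exact (hf m).comp ((measurable_newResid j m).comp
    (Measurable.prodMk measurable_const (Measurable.prodMk h1 measurable_snd)))

section Linear

lemma jumpOp_mono (h : f ≤ f') : jumpOp S b q f ≤ jumpOp S b q f' := by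
  intro j r
  refine ENNReal.tsum_le_tsum fun a => ?_
  split_ifs
  · refine mul_le_mul_right (lintegral_mono fun s => Set.indicator_le_indicator ?_) _
    exact mul_le_mul_right (lintegral_mono fun z => h _ _) _
  · exact le_rfl

lemma transition_mono (h : f ≤ f') : transition S b q f ≤ transition S b q f' :=
  fun j r => add_le_add (mul_le_mul_right (h _ _) _) (jumpOp_mono h j r)

lemma jumpOp_tsum {ι : Type*} [Countable ι] {F : ι → ℤ → (ℤ → ℝ≥0∞) → ℝ≥0∞}
    (hF : ∀ i, LevelMeasurable (F i)) (j : ℤ) (r : ℤ → ℝ≥0∞) :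
    jumpOp S b q (fun j r => ∑' i, F i j r) j r = ∑' i, jumpOp S b q (F i) j r := by
  unfold jumpOp
  rw [ENNReal.tsum_comm]
  refine tsum_congr fun a => ?_
  split_ifs
  swap
  · simp
  rw [ENNReal.tsum_mul_left]
  congr 1
  have hm : ∀ i, Measurable fun s : ℝ≥0 => ∫⁻ z, F i (reflectAt b a.target)
      (newResid j (reflectAt b a.target) r s z) ∂workRow S := fun i =>
    (measurable_jump (hF i) j (reflectAt b a.target) r).lintegral_prod_right'
  rw [← lintegral_tsum]
  · refine lintegral_congr fun s => ?_
    by_cases hs : s ∈ {s : ℝ≥0 | (s : ℝ≥0∞) < serviceTime b j r}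
    · simp only [Set.indicator_of_mem hs]
      rw [ENNReal.tsum_mul_left, lintegral_tsum]
      exact fun i => ((measurable_jump (hF i) j _ r).comp measurable_prodMk_left).aemeasurable
    · simp only [Set.indicator_of_notMem hs, tsum_zero]
  · refine fun i => (Measurable.indicator ?_ (measurableSet_coe_lt _)).aemeasurable
    exact ((measurable_disc _).comp measurable_coe_nnreal_ennreal).mul (hm i)

lemma transition_tsum {ι : Type*} [Countable ι] {F : ι → ℤ → (ℤ → ℝ≥0∞) → ℝ≥0∞}
    (hF : ∀ i, LevelMeasurable (F i)) (j : ℤ) (r : ℤ → ℝ≥0∞) :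
    transition S b q (fun j r => ∑' i, F i j r) j r = ∑' i, transition S b q (F i) j r := by
  unfold transition
  rw [jumpOp_tsum hF, ENNReal.tsum_add, ENNReal.tsum_mul_left]

lemma jumpOp_add (hf : LevelMeasurable f) (hf' : LevelMeasurable f') :
    jumpOp S b q (f + f') = jumpOp S b q f + jumpOp S b q f' := by
  funext j r
  have h := jumpOp_tsum (S := S) (b := b) (q := q) (F := fun i : Bool => if i then f else f')
    (by intro i; cases i <;> simpa) j r
  simp only [tsum_bool, Bool.false_eq_true, if_false, if_true] at h
  rw [show f + f' = fun j r => f' j r + f j r by funext j r; exact add_comm _ _, h, add_comm]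
  rfl

lemma transition_add (hf : LevelMeasurable f) (hf' : LevelMeasurable f') :
    transition S b q (f + f') = transition S b q f + transition S b q f' := by
  funext j r
  simp only [transition, jumpOp_add hf hf', Pi.add_apply, mul_add]
  ring

lemma transition_sum_range {F : ℕ → ℤ → (ℤ → ℝ≥0∞) → ℝ≥0∞} (hF : ∀ n, LevelMeasurable (F n))
    (N : ℕ) : transition S b q (fun j r => ∑ n ∈ Finset.range N, F n j r)
      = fun j r => ∑ n ∈ Finset.range N, transition S b q (F n) j r := by
  induction N with
  | zero => funext j r; simp [transition, jumpOp]
  | succ N ih =>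
    have h : (fun j r => ∑ n ∈ Finset.range (N + 1), F n j r)
        = (fun j r => ∑ n ∈ Finset.range N, F n j r) + F N := by
      funext j r; simp [Finset.sum_range_succ]
    rw [h, transition_add (fun j => Finset.measurable_fun_sum _ fun n _ => hF n j) (hF N), ih]
    funext j r
    simp [Finset.sum_range_succ]

lemma jumpOp_smul {c : ℝ≥0∞} (hc : c ≠ ⊤) (f : ℤ → (ℤ → ℝ≥0∞) → ℝ≥0∞) (j : ℤ) (r : ℤ → ℝ≥0∞) :
    jumpOp S b q (fun j r => c * f j r) j r = c * jumpOp S b q f j r := by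
  unfold jumpOp
  rw [← ENNReal.tsum_mul_left]
  refine tsum_congr fun a => ?_
  split_ifs
  swap
  · simp
  rw [mul_left_comm, ← lintegral_const_mul' _ _ hc]
  congr 1
  refine lintegral_congr fun s => ?_
  rw [← Set.indicator_const_mul]
  congr 1
  funext s
  rw [lintegral_const_mul' _ _ hc, mul_left_comm]

lemma transition_smul {c : ℝ≥0∞} (hc : c ≠ ⊤) (f : ℤ → (ℤ → ℝ≥0∞) → ℝ≥0∞) (j : ℤ)
    (r : ℤ → ℝ≥0∞) :
    transition S b q (fun j r => c * f j r) j r = c * transition S b q f j r := by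
  unfold transition
  rw [jumpOp_smul hc, mul_add, mul_left_comm]

lemma LevelMeasurable.jumpOp (hf : LevelMeasurable f) : LevelMeasurable (jumpOp S b q f) := by
  intro j
  unfold PRP.jumpOp
  refine Measurable.tsum fun a => ?_
  split_ifs
  swap
  · exact measurable_const
  have h1 : Measurable fun p : ((ℤ → ℝ≥0∞) × ℝ≥0) × (ℤ → ℝ≥0) => f (reflectAt b a.target)
      (newResid j (reflectAt b a.target) p.1.1 p.1.2 p.2) :=
    (hf _).comp ((measurable_newResid j _).comp (Measurable.prodMk
      (measurable_fst.comp measurable_fst) (Measurable.prodMk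
      (measurable_coe_nnreal_ennreal.comp (measurable_snd.comp measurable_fst)) measurable_snd)))
  have h2 : Measurable fun p : (ℤ → ℝ≥0∞) × ℝ≥0 => disc (totalRate S j + q) p.2 *
      ∫⁻ z, f (reflectAt b a.target) (newResid j (reflectAt b a.target) p.1 p.2 z) ∂workRow S :=
    ((measurable_disc _).comp (measurable_coe_nnreal_ennreal.comp measurable_snd)).mul
      h1.lintegral_prod_right'
  have h3 : MeasurableSet {p : (ℤ → ℝ≥0∞) × ℝ≥0 | (p.2 : ℝ≥0∞) < serviceTime b j p.1} :=
    measurableSet_lt (measurable_coe_nnreal_ennreal.comp measurable_snd)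
      ((measurable_serviceTime b j).comp measurable_fst)
  exact (h2.indicator h3).lintegral_prod_right'.const_mul _

lemma LevelMeasurable.transition (hf : LevelMeasurable f) :
    LevelMeasurable (transition S b q f) := fun j =>
  (((measurable_disc _).comp (measurable_serviceTime b j)).mul (hf _)).add (hf.jumpOp j)

lemma jumpOp_one (j : ℤ) (r : ℤ → ℝ≥0∞) :
    jumpOp S b q (fun _ _ => 1) j r
      = totalRate S j * discTime (totalRate S j + q) (serviceTime b j r) := by
  unfold jumpOp discTime
  simp only [lintegral_const, measure_univ, mul_one]
  rw [coe_totalRate, ← ENNReal.tsum_mul_right]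
  refine tsum_congr fun a => ?_
  unfold activeRate
  split_ifs <;> simp

/-- The probability that the exponential time expires before the next event. -/
noncomputable def killed (S : Params) (b : Option ℤ) (q : ℝ≥0) (j : ℤ) (r : ℤ → ℝ≥0∞) : ℝ≥0∞ :=
  q * discTime (totalRate S j + q) (serviceTime b j r)

/-- One of three things comes first: the end of service, a ring of an active clock or the
exponential time. -/
lemma transition_one_add_killed (hq : q ≠ 0) (j : ℤ) (r : ℤ → ℝ≥0∞) :
    transition S b q (fun _ _ => 1) j r + killed S b q j r = 1 := by
  have h := mul_discTime_add (c := totalRate S j + q) (by positivity) (serviceTime b j r)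
  rw [transition, jumpOp_one, killed]
  refine Eq.trans ?_ h
  push_cast
  ring

lemma measurable_discTime (c : ℝ≥0) : Measurable (discTime c) := by
  have h : MeasurableSet {p : ℝ≥0∞ × ℝ≥0 | (p.2 : ℝ≥0∞) < p.1} :=
    measurableSet_lt (measurable_coe_nnreal_ennreal.comp measurable_snd) measurable_fst
  have h2 : Measurable fun p : ℝ≥0∞ × ℝ≥0 => disc c p.2 :=
    (measurable_disc _).comp (measurable_coe_nnreal_ennreal.comp measurable_snd)
  exact (h2.indicator h).lintegral_prod_right'

lemma levelMeasurable_killed : LevelMeasurable (killed S b q) := fun j =>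
  ((measurable_discTime _).comp (measurable_serviceTime b j)).const_mul _

end Linear

section Resolvent

/-- The iterates of the transition operator restricted to the levels in `C`. -/
noncomputable def iter (S : Params) (b : Option ℤ) (q : ℝ≥0) (C : Set ℤ)
    (f : ℤ → (ℤ → ℝ≥0∞) → ℝ≥0∞) : ℕ → ℤ → (ℤ → ℝ≥0∞) → ℝ≥0∞
  | 0 => f
  | n + 1 => cut C (transition S b q (iter S b q C f n))

/-- The resolvent of the transition operator restricted to the levels in `C`. -/
noncomputable def resolvent (S : Params) (b : Option ℤ) (q : ℝ≥0) (C : Set ℤ)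
    (f : ℤ → (ℤ → ℝ≥0∞) → ℝ≥0∞) (j : ℤ) (r : ℤ → ℝ≥0∞) : ℝ≥0∞ := ∑' n, iter S b q C f n j r

lemma LevelMeasurable.iter (hf : LevelMeasurable f) (n : ℕ) :
    LevelMeasurable (iter S b q C f n) := by
  induction n with
  | zero => exact hf
  | succ n ih => exact ih.transition.cut

lemma LevelMeasurable.resolvent (hf : LevelMeasurable f) :
    LevelMeasurable (resolvent S b q C f) := fun j => Measurable.tsum fun n => hf.iter n j

/-- The resolvent collects `f` at every event up to and including the first one with level outside
`C`. On `C` the function `f` acts as a running reward, off `C` as an exit reward. -/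
lemma resolvent_eq (hf : LevelMeasurable f) (j : ℤ) (r : ℤ → ℝ≥0∞) :
    resolvent S b q C f j r = f j r + cut C (transition S b q (resolvent S b q C f)) j r := by
  conv_lhs => rw [resolvent, tsum_eq_zero_add' ENNReal.summable]
  congr 1
  have h : resolvent S b q C f = fun j r => ∑' n, iter S b q C f n j r := rfl
  simp only [iter, cut]
  rw [h, transition_tsum (fun n => hf.iter n), ENNReal.tsum_mul_left]

/-- The resolvent is the least supersolution of its equation, as each partial sum of the series
stays below any supersolution. This replaces all bounds on the number of events. -/
lemma resolvent_le {V : ℤ → (ℤ → ℝ≥0∞) → ℝ≥0∞} (hf : LevelMeasurable f)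
    (h : f + cut C (transition S b q V) ≤ V) : resolvent S b q C f ≤ V := by
  have key : ∀ N, (fun j r => ∑ n ∈ Finset.range N, iter S b q C f n j r) ≤ V := by
    intro N
    induction N with
    | zero => intro j r; simp
    | succ N ih =>
      intro j r
      refine le_trans ?_ (h j r)
      simp only [Finset.sum_range_succ']
      rw [add_comm]
      refine add_le_add le_rfl ?_
      refine le_trans ?_ (cut_mono (transition_mono ih) j r)
      simp only [cut, transition_sum_range (fun n => hf.iter n), iter, Finset.mul_sum]
      exact le_rfl
  intro j r
  exact ENNReal.tsum_le_of_sum_range_le fun N => key N j r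

lemma iter_add (hf : LevelMeasurable f) (hf' : LevelMeasurable f') (n : ℕ) :
    iter S b q C (f + f') n = iter S b q C f n + iter S b q C f' n := by
  induction n with
  | zero => rfl
  | succ n ih =>
    rw [iter, ih, transition_add (hf.iter n) (hf'.iter n)]
    funext j r
    simp only [cut, iter, Pi.add_apply, mul_add]

lemma resolvent_add (hf : LevelMeasurable f) (hf' : LevelMeasurable f') :
    resolvent S b q C (f + f') = resolvent S b q C f + resolvent S b q C f' := by
  funext j r
  simp only [resolvent, iter_add hf hf', Pi.add_apply, ENNReal.tsum_add]

lemma iter_mono (h : f ≤ f') (n : ℕ) : iter S b q C f n ≤ iter S b q C f' n := by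
  induction n with
  | zero => exact h
  | succ n ih => exact cut_mono (transition_mono ih)

lemma resolvent_mono (h : f ≤ f') : resolvent S b q C f ≤ resolvent S b q C f' :=
  fun j r => ENNReal.tsum_le_tsum fun n => iter_mono h n j r

lemma iter_smul {c : ℝ≥0∞} (hc : c ≠ ⊤) (n : ℕ) :
    iter S b q C (fun j r => c * f j r) n = fun j r => c * iter S b q C f n j r := by
  induction n with
  | zero => rfl
  | succ n ih =>
    funext j r
    simp only [iter, ih, cut, transition_smul hc]
    ring

lemma resolvent_smul {c : ℝ≥0∞} (hc : c ≠ ⊤) (j : ℤ) (r : ℤ → ℝ≥0∞) :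
    resolvent S b q C (fun j r => c * f j r) j r = c * resolvent S b q C f j r := by
  simp only [resolvent, iter_smul hc, ENNReal.tsum_mul_left]

/-- Decomposition at the first visit to the levels outside `D ⊆ C`. -/
lemma resolvent_eq_resolvent (hDC : D ⊆ C) (hf : LevelMeasurable f) :
    resolvent S b q C f
      = resolvent S b q D (f + cut (C \ D) (transition S b q (resolvent S b q C f))) := by
  set V := resolvent S b q C f with hV
  have hsplit : ∀ u : ℤ → (ℤ → ℝ≥0∞) → ℝ≥0∞, cut C u = cut (C \ D) u + cut D u := by
    intro u
    funext j r
    simp only [Pi.add_apply]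
    by_cases hD : j ∈ D
    · rw [cut_of_mem (hDC hD), cut_of_mem hD, cut_of_notMem fun h => h.2 hD, zero_add]
    · by_cases hC : j ∈ C
      · rw [cut_of_mem hC, cut_of_notMem hD, cut_of_mem (C := C \ D) ⟨hC, hD⟩, add_zero]
      · rw [cut_of_notMem hC, cut_of_notMem hD, cut_of_notMem fun h => hC h.1, add_zero]
  have hg : LevelMeasurable (f + cut (C \ D) (transition S b q V)) :=
    hf.add hf.resolvent.transition.cut
  -- Both inequalities come from minimality. First `V` is a supersolution of the equation on `D`;
  -- then, by this bound, the right side is a supersolution of the equation on `C`.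
  have hle : resolvent S b q D (f + cut (C \ D) (transition S b q V)) ≤ V := by
    refine resolvent_le hg ?_
    rw [add_assoc, ← hsplit]
    intro j r
    exact (resolvent_eq hf j r).ge
  refine le_antisymm (resolvent_le hf ?_) hle
  set V' := resolvent S b q D (f + cut (C \ D) (transition S b q V)) with hV'
  intro j r
  have h1 := resolvent_eq (S := S) (b := b) (q := q) (C := D) hg j r
  rw [← hV'] at h1
  rw [h1, hsplit, ← add_assoc]
  exact add_le_add (add_le_add le_rfl (cut_mono (transition_mono hle) j r)) le_rfl

/-- The constant one is a supersolution, since a further event and killing before it have total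
probability one. -/
lemma resolvent_le_one (hq : q ≠ 0) (hf : LevelMeasurable f)
    (h : ∀ j r, f j r ≤ 1) (hC : ∀ j ∈ C, ∀ r, f j r ≤ killed S b q j r) (j : ℤ) (r : ℤ → ℝ≥0∞) :
    resolvent S b q C f j r ≤ 1 := by
  refine resolvent_le (V := fun _ _ => 1) hf (fun j r => ?_) j r
  simp only [Pi.add_apply]
  by_cases hj : j ∈ C
  · rw [cut_of_mem hj, add_comm]
    exact (add_le_add le_rfl (hC j hj r)).trans (transition_one_add_killed hq j r).le
  · rw [cut_of_notMem hj, add_zero]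
    exact h j r

end Resolvent

end PRP

/-! ### Excursions above a level -/

namespace PRP

variable {S : Params} {b : Option ℤ} {q : ℝ≥0} {l v : ℤ}
  {f f' g : ℤ → (ℤ → ℝ≥0∞) → ℝ≥0∞} {j : ℤ} {r : ℤ → ℝ≥0∞}

section Local

/-- The function depends on the residual works only through those of the customers with labels
above `l` that are present. -/
def LocalAbove (l : ℤ) (f : ℤ → (ℤ → ℝ≥0∞) → ℝ≥0∞) : Prop :=
  ∀ j r r', (∀ n, l < n → n ≤ j → r n = r' n) → f j r = f j r'

/-- The rate of the jumps from level `l`, weighted with the expectation of `f` after the jump. -/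
noncomputable def jumpRate (S : Params) (l : ℤ) (f : ℤ → (ℤ → ℝ≥0∞) → ℝ≥0∞) : ℝ≥0∞ :=
  ∑' a : Clock, if a.source = l then
    a.rate S * ∫⁻ z, f a.target (newResid l a.target 0 0 z) ∂workRow S else 0

lemma newResid_of_lt {m n : ℤ} (h1 : l < n) (h2 : n ≤ m) (r : ℤ → ℝ≥0∞) (t : ℝ≥0∞)
    (z : ℤ → ℝ≥0) : newResid l m r t z n = z n := by
  simp [newResid, h1, h2]

/-- A jump from at or above the barrier that the barrier cuts short brings no new customers, so
reflection does not alter the residual works. -/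
lemma newResid_max (hj : l ≤ j) (m : ℤ) (r : ℤ → ℝ≥0∞) (t : ℝ≥0∞) (z : ℤ → ℝ≥0) :
    newResid j (max l m) r t z = newResid j m r t z := by
  funext n
  have : (j < n ∧ n ≤ max l m) ↔ (j < n ∧ n ≤ m) := by
    constructor <;> rintro ⟨h1, h2⟩ <;> refine ⟨h1, ?_⟩ <;> omega
  simp only [newResid, this]

/-- When the reward after the jump depends on the fresh works only, neither the time of the jump nor
the old residual works matter. The integral over the jump time then separates as a factor. -/
lemma jumpOp_eq_jumpRate_mul (h : ∀ (a : Clock) (s : ℝ≥0) z, a.source = l →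
      g (reflectAt b a.target) (newResid l (reflectAt b a.target) r s z)
        = f a.target (newResid l a.target 0 0 z)) :
    jumpOp S b q g l r = jumpRate S l f * discTime (totalRate S l + q) (serviceTime b l r) := by
  unfold jumpOp jumpRate
  rw [← ENNReal.tsum_mul_right]
  refine tsum_congr fun a => ?_
  split_ifs with ha
  swap
  · simp
  rw [mul_assoc]
  congr 1
  rw [discTime, ← lintegral_const_mul _ (Measurable.indicator (by fun_prop)
    (measurableSet_coe_lt _))]
  refine lintegral_congr fun s => ?_
  by_cases hs : s ∈ {s : ℝ≥0 | (s : ℝ≥0∞) < serviceTime b l r}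
  · simp only [Set.indicator_of_mem hs, h a s _ ha]
    rw [mul_comm]
  · simp only [Set.indicator_of_notMem hs, mul_zero]

lemma jumpOp_none_of_localAbove (hf : LocalAbove l f) :
    jumpOp S none q f l r = jumpRate S l f * discTime (totalRate S l + q) (r l) := by
  have : serviceTime none l r = r l := by simp [serviceTime]
  rw [jumpOp_eq_jumpRate_mul (f := f), this]
  intro a s z _
  refine hf _ _ _ fun n h1 h2 => ?_
  simp only [reflectAt] at h2 ⊢
  rw [newResid_of_lt h1 h2, newResid_of_lt h1 h2]

lemma jumpOp_some_of_localAbove (hf : LocalAbove l f) (hg : ∀ m r, g (max l m) r = f m r) :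
    jumpOp S (some l) q g l r = jumpRate S l f * discTime (totalRate S l + q) ⊤ := by
  have : serviceTime (some l) l r = ⊤ := by simp [serviceTime]
  rw [jumpOp_eq_jumpRate_mul (f := f), this]
  intro a s z _
  simp only [reflectAt]
  rw [hg, newResid_max le_rfl]
  refine hf _ _ _ fun n h1 h2 => ?_
  rw [newResid_of_lt h1 h2, newResid_of_lt h1 h2]

/-- From a level above `l`, service uses the work of a customer above `l`, and an event alters no
residual works but that customer's and those of new arrivals. This is where the preemptive-resume
discipline enters. -/
lemma LocalAbove.cut_transition (hf : LocalAbove l f) :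
    LocalAbove l (cut (Set.Ioi l) (transition S none q f)) := by
  intro j r r' h
  by_cases hj : j ∈ Set.Ioi l
  · rw [cut_of_mem hj, cut_of_mem hj]
    have hj' : l < j := hj
    have h1 : serviceTime none j r = serviceTime none j r' := by
      simpa [serviceTime] using h j hj' le_rfl
    have h2 : f (j - 1) r = f (j - 1) r' := hf _ _ _ fun n h1 h2 => h n h1 (by omega)
    have h3 : ∀ (m : ℤ) (s : ℝ≥0) (z : ℤ → ℝ≥0),
        f m (newResid j m r s z) = f m (newResid j m r' s z) := by
      intro m s z
      refine hf _ _ _ fun n h1 h2 => ?_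
      unfold newResid
      split_ifs with h3 h4
      · rfl
      · subst h4; rw [h n hj' le_rfl]
      · exact h n h1 (by omega)
    simp only [transition, jumpOp, h1, h2, h3]
  · rw [cut_of_notMem hj, cut_of_notMem hj]

lemma LocalAbove.resolvent (hf : LocalAbove l f) :
    LocalAbove l (resolvent S none q (Set.Ioi l) f) := by
  have h : ∀ n, LocalAbove l (iter S none q (Set.Ioi l) f n) := by
    intro n
    induction n with
    | zero => exact hf
    | succ n ih => exact ih.cut_transition
  exact fun j r r' hr => tsum_congr fun n => h n j r r' hr

lemma localAbove_const (C : Set ℤ) (c : ℝ≥0∞) : LocalAbove l (cut C fun _ _ => c) :=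
  fun _ _ _ _ => rfl

lemma localAbove_killed (D : Set ℤ) :
    LocalAbove l (cut (Set.Ioi l) (cut D (killed S none q))) := by
  intro j r r' h
  by_cases hj : j ∈ Set.Ioi l
  · simp only [cut, killed, serviceTime]
    rw [h j hj le_rfl]
  · rw [cut_of_notMem hj, cut_of_notMem hj]

/-- Above the barrier the two systems differ only in the target of a catastrophe that reaches or
crosses `l`, and this can be absorbed in the reward. -/
lemma transition_some_eq (hj : l < j) (f : ℤ → (ℤ → ℝ≥0∞) → ℝ≥0∞) (r : ℤ → ℝ≥0∞) :
    transition S (some l) q f j r = transition S none q (fun m r => f (max l m) r) j r := by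
  have h1 : serviceTime (some l) j r = serviceTime none j r := by
    simp [serviceTime, hj.ne]
  have h2 : max l (j - 1) = j - 1 := by omega
  simp only [transition, jumpOp, h1, h2, reflectAt, newResid_max hj.le]

lemma resolvent_some_eq (f : ℤ → (ℤ → ℝ≥0∞) → ℝ≥0∞) (m : ℤ) (r : ℤ → ℝ≥0∞) :
    resolvent S (some l) q (Set.Ioi l) f (max l m) r
      = resolvent S none q (Set.Ioi l) (fun m r => f (max l m) r) m r := by
  have h : ∀ n m r, iter S (some l) q (Set.Ioi l) f n (max l m) r
      = iter S none q (Set.Ioi l) (fun m r => f (max l m) r) n m r := by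
    intro n
    induction n with
    | zero => intro m r; rfl
    | succ n ih =>
      intro m r
      by_cases hm : l < m
      · rw [max_eq_right hm.le, iter, iter, cut_of_mem (by exact hm), cut_of_mem (by exact hm),
          transition_some_eq hm]
        simp only [ih]
      · rw [iter, iter, cut_of_notMem (by simpa using hm), cut_of_notMem (by exact hm)]
  exact tsum_congr fun n => h n m r

end Local

/-! ### Contraction and uniqueness for the return equation -/

section Contraction

/-- The expectation of `φ` at the next visit to `l`, which follows on a jump. -/
noncomputable def returnOp (S : Params) (b : Option ℤ) (q : ℝ≥0) (l : ℤ)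
    (φ : (ℤ → ℝ≥0∞) → ℝ≥0∞) (r : ℤ → ℝ≥0∞) : ℝ≥0∞ :=
  jumpOp S b q (resolvent S b q (Set.Ioi l) (cut {l} fun _ => φ)) l r

lemma returnOp_mono {φ ψ : (ℤ → ℝ≥0∞) → ℝ≥0∞} (h : φ ≤ ψ) :
    returnOp S b q l φ ≤ returnOp S b q l ψ :=
  fun _ => jumpOp_mono (resolvent_mono (cut_mono fun _ => h)) _ _

lemma returnOp_smul {c : ℝ≥0∞} (hc : c ≠ ⊤) (φ : (ℤ → ℝ≥0∞) → ℝ≥0∞) (r : ℤ → ℝ≥0∞) :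
    returnOp S b q l (fun r => c * φ r) r = c * returnOp S b q l φ r := by
  unfold returnOp
  have h1 : (cut {l} fun _ r => c * φ r) = fun j r => c * cut {l} (fun _ => φ) j r := by
    funext j r; simp only [cut]; ring
  rw [h1, show resolvent S b q (Set.Ioi l) (fun j r => c * cut {l} (fun _ => φ) j r)
    = fun j r => c * resolvent S b q (Set.Ioi l) (cut {l} fun _ => φ) j r from
    funext fun j => funext fun r => resolvent_smul hc j r, jumpOp_smul hc]

lemma returnOp_add {φ ψ : (ℤ → ℝ≥0∞) → ℝ≥0∞} (hφ : Measurable φ) (hψ : Measurable ψ)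
    (r : ℤ → ℝ≥0∞) :
    returnOp S b q l (fun r => φ r + ψ r) r = returnOp S b q l φ r + returnOp S b q l ψ r := by
  have hφ' : LevelMeasurable (cut {l} fun _ => φ) := LevelMeasurable.cut fun _ => hφ
  have hψ' : LevelMeasurable (cut {l} fun _ => ψ) := LevelMeasurable.cut fun _ => hψ
  have h : (cut {l} fun _ r => φ r + ψ r) = (cut {l} fun _ => φ) + cut {l} fun _ => ψ := by
    funext j r; simp only [cut, Pi.add_apply, mul_add]
  simp only [returnOp]
  rw [h, resolvent_add hφ' hψ', jumpOp_add hφ'.resolvent hψ'.resolvent]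
  rfl

/-- A return requires that some clock ring before the exponential time. The bound is uniform in the
residual works. -/
lemma returnOp_one_le (hq : q ≠ 0) (r : ℤ → ℝ≥0∞) :
    returnOp S b q l (fun _ => 1) r ≤ totalRate S l * (totalRate S l + q : ℝ≥0∞)⁻¹ := by
  have h1 : resolvent S b q (Set.Ioi l) (cut {l} fun _ _ => 1) ≤ fun _ _ => 1 := by
    refine fun j r => resolvent_le_one hq (levelMeasurable_const 1).cut (fun j r => ?_)
      (fun j hj r => ?_) j r
    · by_cases h : j = l <;> simp [cut, h]
    · have : j ≠ l := (ne_of_gt hj)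
      simp [cut, this]
  refine (jumpOp_mono h1 l r).trans ?_
  rw [jumpOp_one]
  refine mul_le_mul_right ?_ _
  have h2 := mul_discTime_add (c := totalRate S l + q) (by positivity) (serviceTime b l r)
  push_cast at h2
  rw [ENNReal.le_inv_iff_mul_le, mul_comm]
  exact le_self_add.trans h2.le

/-- Each application of the equation multiplies the excess of `X` over `Y` by at most the
contraction factor. The excess is carried as an added bound, and `Y` need not be bounded. -/
lemma le_of_returnOp (hq : q ≠ 0) {X Y α : (ℤ → ℝ≥0∞) → ℝ≥0∞} (hY : Measurable Y)
    {B : ℝ≥0∞} (hB : B ≠ ⊤) (hXB : ∀ r, X r ≤ B)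
    (hX : ∀ r, X r = α r + returnOp S b q l X r) (hY' : ∀ r, Y r = α r + returnOp S b q l Y r) :
    X ≤ Y := by
  set ρ : ℝ≥0∞ := totalRate S l * (totalRate S l + q : ℝ≥0∞)⁻¹ with hρ
  have hρ1 : ρ < 1 := by
    rw [hρ, ← div_eq_mul_inv]
    refine ENNReal.div_lt_of_lt_mul ?_
    rw [one_mul]
    exact_mod_cast lt_add_of_pos_right _ (pos_iff_ne_zero.2 hq)
  have key : ∀ n : ℕ, ∀ r, X r ≤ Y r + B * ρ ^ n := by
    intro n
    induction n with
    | zero => intro r; simpa using (hXB r).trans le_add_self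
    | succ n ih =>
      intro r
      have hM : B * ρ ^ n ≠ ⊤ := ENNReal.mul_ne_top hB (ENNReal.pow_ne_top hρ1.ne_top)
      have h1 : returnOp S b q l X r
          ≤ returnOp S b q l Y r + B * ρ ^ n * returnOp S b q l (fun _ => 1) r := by
        rw [← returnOp_smul hM, ← returnOp_add hY measurable_const]
        refine returnOp_mono (fun r => ?_) r
        simpa using ih r
      rw [hX, hY', pow_succ, ← mul_assoc, add_assoc]
      refine add_le_add le_rfl (h1.trans (add_le_add le_rfl (mul_le_mul_right ?_ _)))
      exact returnOp_one_le hq r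
  intro r
  have hlim : Filter.Tendsto (fun n : ℕ => Y r + B * ρ ^ n) Filter.atTop (nhds (Y r + B * 0)) :=
    tendsto_const_nhds.add (ENNReal.Tendsto.const_mul
      (ENNReal.tendsto_pow_atTop_nhds_zero_of_lt_one hρ1) (Or.inr hB))
  rw [mul_zero, add_zero] at hlim
  exact ge_of_tendsto' hlim fun n => key n r

lemma eq_of_returnOp (hq : q ≠ 0) {X Y α : (ℤ → ℝ≥0∞) → ℝ≥0∞} (hXm : Measurable X)
    (hYm : Measurable Y) {B : ℝ≥0∞} (hB : B ≠ ⊤) (hXB : ∀ r, X r ≤ B) (hYB : ∀ r, Y r ≤ B)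
    (hX : ∀ r, X r = α r + returnOp S b q l X r) (hY : ∀ r, Y r = α r + returnOp S b q l Y r) :
    X = Y :=
  le_antisymm (le_of_returnOp hq hYm hB hXB hX hY) (le_of_returnOp hq hXm hB hYB hY hX)

end Contraction

/-! ### Outcome rates and the proportionality of the two probabilities -/

section Outcome

/-- The probability to be at level `v` at the exponential time, with all levels before at least
`l`. -/
noncomputable def stayAt (S : Params) (b : Option ℤ) (q : ℝ≥0) (l v : ℤ) :
    ℤ → (ℤ → ℝ≥0∞) → ℝ≥0∞ :=
  resolvent S b q (Set.Ici l) (cut (Set.Ici l) (cut {v} (killed S b q)))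

/-- The probability to pass below `l` before the exponential time. -/
noncomputable def passBelow (S : Params) (q : ℝ≥0) (l : ℤ) : ℤ → (ℤ → ℝ≥0∞) → ℝ≥0∞ :=
  resolvent S none q (Set.Ici l) (cut (Set.Iio l) fun _ _ => 1)

/-- The rate at which outcome `v` is attained in a cycle that starts at level `l`. -/
noncomputable def outcomeRate (S : Params) (q : ℝ≥0) (l v : ℤ) : ℝ≥0∞ :=
  q * ({v} : Set ℤ).indicator 1 l + jumpRate S l (stayAt S none q (l + 1) v)

/-- The rate at which any outcome is attained in a cycle that starts at level `l`. -/
noncomputable def outcomeRateTotal (S : Params) (q : ℝ≥0) (l : ℤ) : ℝ≥0∞ :=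
  q + jumpRate S l fun j r => 1 - passBelow S q (l + 1) j r

lemma Ici_add_one (l : ℤ) : Set.Ici (l + 1) = Set.Ioi l := by
  ext; simp

lemma Iio_add_one (l : ℤ) : Set.Iio (l + 1) = Set.Iic l := by
  ext; simp

lemma levelMeasurable_stayAt : LevelMeasurable (stayAt S b q l v) :=
  levelMeasurable_killed.cut.cut.resolvent

lemma levelMeasurable_passBelow : LevelMeasurable (passBelow S q l) :=
  (levelMeasurable_const 1).cut.resolvent

lemma levelMeasurable_one_sub_passBelow : LevelMeasurable fun j r => 1 - passBelow S q l j r :=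
  fun j => measurable_const.sub (levelMeasurable_passBelow j)

lemma cut_le_self (C : Set ℤ) (f : ℤ → (ℤ → ℝ≥0∞) → ℝ≥0∞) : cut C f ≤ f := by
  intro j r
  by_cases h : j ∈ C
  · rw [cut_of_mem h]
  · rw [cut_of_notMem h]; exact zero_le

lemma killed_le_one (hq : q ≠ 0) (j : ℤ) (r : ℤ → ℝ≥0∞) : killed S b q j r ≤ 1 := by
  rw [← transition_one_add_killed (S := S) (b := b) hq j r]
  exact le_add_self

lemma stayAt_le_one (hq : q ≠ 0) (j : ℤ) (r : ℤ → ℝ≥0∞) : stayAt S b q l v j r ≤ 1 := by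
  have h : cut (Set.Ici l) (cut {v} (killed S b q)) ≤ killed S b q :=
    (cut_le_self _ _).trans (cut_le_self _ _)
  exact resolvent_le_one hq levelMeasurable_killed.cut.cut
    (fun j r => (h j r).trans (killed_le_one hq j r)) (fun j _ r => h j r) j r

lemma passBelow_le_one (hq : q ≠ 0) (j : ℤ) (r : ℤ → ℝ≥0∞) : passBelow S q l j r ≤ 1 := by
  refine resolvent_le_one hq (levelMeasurable_const 1).cut (fun j r => cut_le_self _ _ j r)
    (fun j hj r => ?_) j r
  rw [cut_of_notMem (by simpa using hj)]
  exact zero_le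

lemma localAbove_stayAt : LocalAbove l (stayAt S none q (l + 1) v) := by
  unfold stayAt
  rw [Ici_add_one]
  exact (localAbove_killed _).resolvent

lemma localAbove_passBelow : LocalAbove l (passBelow S q (l + 1)) := by
  unfold passBelow
  rw [Ici_add_one]
  exact (localAbove_const _ _).resolvent

lemma Ici_diff_Ioi (l : ℤ) : Set.Ici l \ Set.Ioi l = {l} := by
  ext x; simp only [Set.mem_sdiff, Set.mem_Ici, Set.mem_Ioi, Set.mem_singleton_iff]; omega

/-- Decomposition of `stayAt` at the first visit to `l`. -/
lemma stayAt_eq_add (b : Option ℤ) (j : ℤ) (r : ℤ → ℝ≥0∞) :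
    stayAt S b q l v j r
      = resolvent S b q (Set.Ioi l) (cut (Set.Ioi l) (cut {v} (killed S b q))) j r
        + resolvent S b q (Set.Ioi l) (cut {l} fun _ => stayAt S b q l v l) j r := by
  have hm : LevelMeasurable (cut (Set.Ici l) (cut {v} (killed S b q))) :=
    levelMeasurable_killed.cut.cut
  have h := resolvent_eq_resolvent (S := S) (b := b) (q := q) (C := Set.Ici l) (D := Set.Ioi l)
    Set.Ioi_subset_Ici_self hm
  rw [Ici_diff_Ioi] at h
  change stayAt S b q l v = _ at h
  have hm2 : LevelMeasurable (cut {l} fun _ => stayAt S b q l v l) :=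
    LevelMeasurable.cut fun _ => levelMeasurable_stayAt l
  conv_lhs => rw [h]
  rw [← Pi.add_apply, ← Pi.add_apply, ← resolvent_add levelMeasurable_killed.cut.cut hm2]
  refine congrArg (fun f => resolvent S b q (Set.Ioi l) f j r) ?_
  funext j r
  simp only [Pi.add_apply]
  by_cases hj : j = l
  · subst hj
    rw [cut_of_mem (Set.mem_singleton j), cut_of_mem (Set.mem_singleton j),
      cut_of_notMem (C := Set.Ioi j) (by simp), zero_add]
    conv_rhs => rw [stayAt, resolvent_eq hm, cut_of_mem (C := Set.Ici j) (f := transition _ _ _ _)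
      Set.self_mem_Ici]
  · rw [cut_of_notMem (C := {l}) hj, cut_of_notMem (C := {l}) hj, add_zero, add_zero]
    by_cases h' : l < j
    · rw [cut_of_mem (C := Set.Ici l) h'.le, cut_of_mem (C := Set.Ioi l) h']
    · rw [cut_of_notMem (C := Set.Ici l) (by simp only [Set.mem_Ici]; omega),
        cut_of_notMem (C := Set.Ioi l) h']

/-- The first level at or below `l` is either below it, and then the passage is complete, or `l`
itself, from where the passage has yet to happen. -/
lemma passBelow_eq (j : ℤ) (r : ℤ → ℝ≥0∞) :
    passBelow S q l j r = resolvent S none q (Set.Ioi l)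
      ((cut (Set.Iio l) fun _ _ => 1) + cut {l} fun _ => passBelow S q l l) j r := by
  have hm : LevelMeasurable (cut (Set.Iio l) fun _ _ => 1) := (levelMeasurable_const 1).cut
  have h := resolvent_eq_resolvent (S := S) (b := none) (q := q) (C := Set.Ici l) (D := Set.Ioi l)
    Set.Ioi_subset_Ici_self hm
  rw [Ici_diff_Ioi] at h
  change passBelow S q l = _ at h
  conv_lhs => rw [h]
  congr 2
  funext j r
  by_cases hj : j = l
  · subst hj
    rw [cut_of_mem (Set.mem_singleton j), cut_of_mem (Set.mem_singleton j)]
    conv_rhs => rw [passBelow, resolvent_eq hm, cut_of_mem (C := Set.Ici j)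
      (f := transition _ _ _ _) Set.self_mem_Ici, cut_of_notMem (by simp), zero_add]
  · rw [cut_of_notMem (C := {l}) hj, cut_of_notMem (C := {l}) hj]

/-- Decomposition of `passBelow (l + 1)` at the first visit to `l`. -/
lemma passBelow_succ_eq_add (hq : q ≠ 0) (j : ℤ) (r : ℤ → ℝ≥0∞) :
    passBelow S q (l + 1) j r = passBelow S q l j r
      + resolvent S none q (Set.Ioi l) (cut {l} fun _ r => 1 - passBelow S q l l r) j r := by
  have hm : LevelMeasurable (cut (Set.Iio l) fun _ _ => 1) := (levelMeasurable_const 1).cut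
  have hm2 : LevelMeasurable (cut {l} fun _ => passBelow S q l l) :=
    LevelMeasurable.cut fun _ => levelMeasurable_passBelow l
  have hm3 : LevelMeasurable (cut {l} fun _ r => 1 - passBelow S q l l r) :=
    LevelMeasurable.cut fun _ => measurable_const.sub (levelMeasurable_passBelow l)
  rw [passBelow_eq (l := l), ← Pi.add_apply, ← Pi.add_apply, ← resolvent_add (hm.add hm2) hm3,
    passBelow, Ici_add_one, Iio_add_one]
  congr 2
  funext j r
  simp only [Pi.add_apply, cut]
  rcases lt_trichotomy j l with h | h | h
  · simp [h, h.le, h.ne]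
  · subst h; simp [add_tsub_cancel_of_le (passBelow_le_one hq j r)]
  · simp [h.not_ge, h.ne', h.le]

lemma stayAt_of_lt (hj : j < l) : stayAt S b q l v j r = 0 := by
  rw [stayAt, resolvent_eq levelMeasurable_killed.cut.cut,
    cut_of_notMem (C := Set.Ici l) (by simpa using hj),
    cut_of_notMem (C := Set.Ici l) (by simpa using hj), add_zero]

lemma passBelow_of_lt (hj : j < l) : passBelow S q l j r = 1 := by
  rw [passBelow, resolvent_eq (levelMeasurable_const 1).cut, cut_of_mem (by exact hj),
    cut_of_notMem (C := Set.Ici l) (by simpa using hj), add_zero]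

/-- From `l`, the exponential time may fall during the stay; a completion leads below `l` and
contributes nothing; a jump contributes according to whether the outcome is attained above `l` or
only after a return to `l`. -/
lemma stayAt_self_eq_jumpOp (r : ℤ → ℝ≥0∞) :
    stayAt S b q l v l r = ({v} : Set ℤ).indicator 1 l * killed S b q l r
      + jumpOp S b q
          (resolvent S b q (Set.Ioi l) (cut (Set.Ioi l) (cut {v} (killed S b q)))) l r
      + returnOp S b q l (stayAt S b q l v l) r := by
  have hm : LevelMeasurable (cut {l} fun _ => stayAt S b q l v l) :=
    LevelMeasurable.cut fun _ => levelMeasurable_stayAt l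
  have h1 : stayAt S b q l v
      = resolvent S b q (Set.Ioi l) (cut (Set.Ioi l) (cut {v} (killed S b q)))
        + resolvent S b q (Set.Ioi l) (cut {l} fun _ => stayAt S b q l v l) :=
    funext fun j => funext fun r => stayAt_eq_add b j r
  have h2 : stayAt S b q l v l r = ({v} : Set ℤ).indicator 1 l * killed S b q l r
      + (disc (totalRate S l + q) (serviceTime b l r) * stayAt S b q l v (l - 1) r
        + jumpOp S b q (stayAt S b q l v) l r) := by
    conv_lhs => rw [stayAt, resolvent_eq levelMeasurable_killed.cut.cut,
      cut_of_mem (C := Set.Ici l) Set.self_mem_Ici, cut_of_mem (C := Set.Ici l) Set.self_mem_Ici]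
    rfl
  rw [h2, stayAt_of_lt (by omega), mul_zero, zero_add, add_assoc]
  congr 1
  conv_lhs => rw [h1]
  rw [jumpOp_add levelMeasurable_killed.cut.cut.resolvent hm.resolvent]
  rfl

/-- The equation for `stayAt` at level `l`. -/
lemma stayAt_self (r : ℤ → ℝ≥0∞) :
    stayAt S none q l v l r = outcomeRate S q l v * discTime (totalRate S l + q) (r l)
      + returnOp S none q l (stayAt S none q l v l) r := by
  have h := jumpOp_none_of_localAbove (S := S) (q := q) (r := r)
    (localAbove_stayAt (S := S) (q := q) (l := l) (v := v))
  have h1 : stayAt S none q (l + 1) v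
      = resolvent S none q (Set.Ioi l) (cut (Set.Ioi l) (cut {v} (killed S none q))) := by
    rw [stayAt, Ici_add_one]
  have h2 : serviceTime none l r = r l := by simp [serviceTime]
  rw [stayAt_self_eq_jumpOp, ← h1, h, killed, outcomeRate, h2]
  ring

/-- The equation for `stayAt` of the reflected system at level `l`. -/
lemma stayAt_some_self (r : ℤ → ℝ≥0∞) :
    stayAt S (some l) q l v l r = outcomeRate S q l v * discTime (totalRate S l + q) ⊤
      + returnOp S (some l) q l (stayAt S (some l) q l v l) r := by
  have hg : ∀ m r, resolvent S (some l) q (Set.Ioi l)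
      (cut (Set.Ioi l) (cut {v} (killed S (some l) q))) (max l m) r
        = stayAt S none q (l + 1) v m r := by
    intro m r
    rw [resolvent_some_eq, stayAt, Ici_add_one]
    congr 1
    funext m r
    by_cases hm : l < m
    · have : serviceTime (some l) m r = serviceTime none m r := by simp [serviceTime, hm.ne]
      rw [max_eq_right hm.le]
      simp only [cut, killed, this]
    · rw [cut_of_notMem (by simpa using hm), cut_of_notMem (by simpa using hm)]
  have h2 : serviceTime (some l) l r = ⊤ := by simp [serviceTime]
  rw [stayAt_self_eq_jumpOp, jumpOp_some_of_localAbove localAbove_stayAt hg, killed, outcomeRate,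
    h2]
  ring

/-- The complement of a passage below `l` obeys the same return equation as `stayAt`, with total
rate in place of the rate for `v`. Taking the complement of `passBelow`, rather than summing over
`v`, also counts exponential times after an explosion to `+∞`. -/
lemma one_sub_passBelow_self (hq : q ≠ 0) (r : ℤ → ℝ≥0∞) :
    1 - passBelow S q l l r = outcomeRateTotal S q l * discTime (totalRate S l + q) (r l)
      + returnOp S none q l (fun r => 1 - passBelow S q l l r) r := by
  have hw : serviceTime none l r = r l := by simp [serviceTime]
  have hW : passBelow S q l l r = disc (totalRate S l + q) (r l)
      + jumpOp S none q (passBelow S q l) l r := by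
    conv_lhs => rw [passBelow, resolvent_eq (levelMeasurable_const 1).cut,
      cut_of_mem (C := Set.Ici l) Set.self_mem_Ici, cut_of_notMem (by simp), zero_add]
    change disc (totalRate S l + q) (serviceTime none l r) * passBelow S q l (l - 1) r
      + jumpOp S none q (passBelow S q l) l r = _
    rw [passBelow_of_lt (by omega), mul_one, hw]
  have hm3 : LevelMeasurable (cut {l} fun _ r => 1 - passBelow S q l l r) :=
    LevelMeasurable.cut fun _ => measurable_const.sub (levelMeasurable_passBelow l)
  have h1 : passBelow S q (l + 1) = passBelow S q l
      + resolvent S none q (Set.Ioi l) (cut {l} fun _ r => 1 - passBelow S q l l r) :=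
    funext fun j => funext fun r => passBelow_succ_eq_add hq j r
  have h2 : jumpOp S none q (passBelow S q (l + 1)) l r = jumpOp S none q (passBelow S q l) l r
      + returnOp S none q l (fun r => 1 - passBelow S q l l r) r := by
    rw [h1, jumpOp_add levelMeasurable_passBelow hm3.resolvent]
    rfl
  have h3 : (fun _ _ => 1 : ℤ → (ℤ → ℝ≥0∞) → ℝ≥0∞)
      = passBelow S q (l + 1) + fun j r => 1 - passBelow S q (l + 1) j r := by
    funext j r
    simp [add_tsub_cancel_of_le (passBelow_le_one hq j r)]
  have h4 : jumpOp S none q (fun _ _ => 1) l r = jumpOp S none q (passBelow S q (l + 1)) l r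
      + jumpOp S none q (fun j r => 1 - passBelow S q (l + 1) j r) l r := by
    conv_lhs => rw [h3]
    rw [jumpOp_add levelMeasurable_passBelow levelMeasurable_one_sub_passBelow]
    rfl
  have h5 : jumpOp S none q (fun j r => 1 - passBelow S q (l + 1) j r) l r
      = jumpRate S l (fun j r => 1 - passBelow S q (l + 1) j r)
        * discTime (totalRate S l + q) (r l) :=
    jumpOp_none_of_localAbove fun j r r' h => by rw [localAbove_passBelow j r r' h]
  -- The balance of mass at `l`, in which the jump part is split into passage below `l`, return to
  -- `l` without later passage, and excursions that last until the exponential time.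
  have h6 := transition_one_add_killed (S := S) (b := none) hq l r
  rw [transition, killed, mul_one, hw, h4, h2, h5] at h6
  refine (ENNReal.eq_sub_of_add_eq
    (ne_top_of_le_ne_top ENNReal.one_ne_top (passBelow_le_one hq l r)) ?_).symm
  conv_rhs => rw [← h6]
  rw [hW, outcomeRateTotal]
  ring

lemma jumpRate_add (hf : LevelMeasurable f) (f' : ℤ → (ℤ → ℝ≥0∞) → ℝ≥0∞) :
    jumpRate S l (f + f') = jumpRate S l f + jumpRate S l f' := by
  unfold jumpRate
  rw [← ENNReal.tsum_add]
  refine tsum_congr fun a => ?_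
  split_ifs
  swap
  · simp
  simp only [Pi.add_apply]
  rw [lintegral_add_left, mul_add]
  exact (measurable_jump hf l a.target 0).comp (measurable_prodMk_left (x := (0 : ℝ≥0)))

lemma jumpRate_one : jumpRate S l (fun _ _ => 1) = totalRate S l := by
  unfold jumpRate
  simp only [lintegral_const, measure_univ, mul_one]
  rw [coe_totalRate]
  refine tsum_congr fun a => ?_
  unfold activeRate
  split_ifs <;> simp

lemma jumpRate_mono (h : f ≤ f') : jumpRate S l f ≤ jumpRate S l f' := by
  refine ENNReal.tsum_le_tsum fun a => ?_
  split_ifs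
  · exact mul_le_mul_right (lintegral_mono fun z => h _ _) _
  · exact le_rfl

/-- After a jump from `l`, the system either enters a level at or below `l` before the exponential
time or does not. -/
lemma outcomeRateTotal_add (hq : q ≠ 0) :
    outcomeRateTotal S q l + jumpRate S l (passBelow S q (l + 1)) = totalRate S l + q := by
  have h3 : (fun _ _ => 1 : ℤ → (ℤ → ℝ≥0∞) → ℝ≥0∞)
      = passBelow S q (l + 1) + fun j r => 1 - passBelow S q (l + 1) j r := by
    funext j r
    simp [add_tsub_cancel_of_le (passBelow_le_one hq j r)]
  rw [← jumpRate_one (S := S), h3, jumpRate_add levelMeasurable_passBelow, outcomeRateTotal]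
  ring

lemma outcomeRateTotal_ne_top (hq : q ≠ 0) : outcomeRateTotal S q l ≠ ⊤ := by
  refine ne_top_of_le_ne_top (b := (totalRate S l + q : ℝ≥0∞)) (by simp) ?_
  rw [← outcomeRateTotal_add hq]
  exact le_self_add

lemma outcomeRateTotal_ne_zero (hq : q ≠ 0) : outcomeRateTotal S q l ≠ 0 := by
  simp [outcomeRateTotal, hq]

lemma outcomeRate_ne_top (hq : q ≠ 0) : outcomeRate S q l v ≠ ⊤ := by
  refine ENNReal.add_ne_top.2 ⟨ENNReal.mul_ne_top ENNReal.coe_ne_top ?_, ?_⟩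
  · by_cases h : l = v <;> simp [h]
  · refine ne_top_of_le_ne_top (b := (totalRate S l : ℝ≥0∞)) (by simp) ?_
    rw [← jumpRate_one]
    exact jumpRate_mono fun j r => stayAt_le_one hq j r

/-- After cross-multiplication by the two rates, both sides are bounded solutions of one return
equation, whose inhomogeneous term is the product of the rates and the discounted length of the
stay. The quotient of the two probabilities is therefore free of the residual works. -/
theorem stayAt_mul_outcomeRateTotal (hq : q ≠ 0) (r : ℤ → ℝ≥0∞) :
    outcomeRateTotal S q l * stayAt S none q l v l r
      = outcomeRate S q l v * (1 - passBelow S q l l r) := by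
  have hA := outcomeRate_ne_top (S := S) (l := l) (v := v) hq
  have hT := outcomeRateTotal_ne_top (S := S) (l := l) hq
  refine congrFun (eq_of_returnOp (S := S) (b := none) (l := l) hq
    (X := fun r => outcomeRateTotal S q l * stayAt S none q l v l r)
    (Y := fun r => outcomeRate S q l v * (1 - passBelow S q l l r))
    (α := fun r => outcomeRateTotal S q l * outcomeRate S q l v
      * discTime (totalRate S l + q) (r l))
    -- A common finite bound, since the probabilities are at most one.
    (B := outcomeRateTotal S q l + outcomeRate S q l v)
    ((levelMeasurable_stayAt l).const_mul _)
    ((measurable_const.sub (levelMeasurable_passBelow l)).const_mul _)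
    (ENNReal.add_ne_top.2 ⟨hT, hA⟩) (fun r => ?_) (fun r => ?_) (fun r => ?_) fun r => ?_) r
  · exact (mul_le_of_le_one_right' (stayAt_le_one hq l r)).trans le_self_add
  · exact (mul_le_of_le_one_right' tsub_le_self).trans le_add_self
  · rw [returnOp_smul hT]
    conv_lhs => rw [stayAt_self]
    ring
  · rw [returnOp_smul hA (fun r => 1 - passBelow S q l l r)]
    conv_lhs => rw [one_sub_passBelow_self hq]
    ring

/-- The reflected system returns to `l` after a jump exactly when the unreflected one would enter a
level at or below `l`. -/
lemma returnOp_some_const (r : ℤ → ℝ≥0∞) :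
    returnOp S (some l) q l (fun _ => 1) r
      = jumpRate S l (passBelow S q (l + 1)) * discTime (totalRate S l + q) ⊤ := by
  refine jumpOp_some_of_localAbove localAbove_passBelow fun m r => ?_
  rw [resolvent_some_eq, passBelow, Ici_add_one, Iio_add_one]
  congr 1
  funext m r
  simp [cut, Set.indicator]

/-- With the server idle at `l`, all cycles at `l` are alike, and the return equation has a constant
solution. By uniqueness this solution is the probability for the reflected system, multiplied by the
total rate. -/
theorem stayAt_some_mul_outcomeRateTotal (hq : q ≠ 0) (r : ℤ → ℝ≥0∞) :
    outcomeRateTotal S q l * stayAt S (some l) q l v l r = outcomeRate S q l v := by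
  have hA := outcomeRate_ne_top (S := S) (l := l) (v := v) hq
  have hT := outcomeRateTotal_ne_top (S := S) (l := l) hq
  have h1 : (totalRate S l + q : ℝ≥0∞) * discTime (totalRate S l + q) ⊤ = 1 := by
    have := mul_discTime_add (c := totalRate S l + q) (by positivity) ⊤
    simpa [disc_top] using this
  refine congrFun (eq_of_returnOp (S := S) (b := some l) (l := l) hq
    (X := fun r => outcomeRateTotal S q l * stayAt S (some l) q l v l r)
    (Y := fun _ => outcomeRate S q l v)
    (α := fun r => outcomeRateTotal S q l * outcomeRate S q l v
      * discTime (totalRate S l + q) ⊤)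
    (B := outcomeRateTotal S q l + outcomeRate S q l v)
    ((levelMeasurable_stayAt l).const_mul _) measurable_const
    (ENNReal.add_ne_top.2 ⟨hT, hA⟩) (fun r => ?_) (fun r => ?_) (fun r => ?_) fun r => ?_) r
  · exact (mul_le_of_le_one_right' (stayAt_le_one hq l r)).trans le_self_add
  · exact le_add_self
  · rw [returnOp_smul hT]
    conv_lhs => rw [stayAt_some_self]
    ring
  · have h2 := returnOp_smul (S := S) (b := some l) (q := q) (l := l) hA (fun _ => 1) r
    simp only [mul_one] at h2
    rw [h2, returnOp_some_const]
    -- The outcome rates and the return rate sum to `totalRate S l + q`, whose reciprocal is the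
    -- discounted length of an unlimited stay.
    calc outcomeRate S q l v
        = outcomeRate S q l v * ((totalRate S l + q) * discTime (totalRate S l + q) ⊤) := by
          rw [h1, mul_one]
      _ = _ := by rw [← outcomeRateTotal_add hq]; ring

end Outcome

end PRP

/-! ### From iterates to the law of the system -/

namespace PRP

section Mean

variable {S : Params} {b : Option ℤ} {q : ℝ≥0} {l v : ℤ}

lemma meanWeight_eq_iter (C D : Set ℤ) (n : ℕ) :
    meanWeight S b q n (fun i => if i < n then C else D) = iter S b q C (cut D fun _ _ => 1) n := by
  induction n with
  | zero => funext j r; simp [meanWeight_zero, iter, cut]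
  | succ n ih =>
    funext j r
    rw [meanWeight_succ]
    simp only [Nat.add_lt_add_iff_right, ih, Nat.zero_lt_succ, if_true]
    rfl

/-- One more event than conditions on levels: the last, unconditioned set only records that the `(n
+ 1)`-st event occurs before the exponential time. -/
lemma meanWeight_succ_eq_iter (C D : Set ℤ) (n : ℕ) :
    meanWeight S b q (n + 1) (fun i => if i < n then C else if i = n then D else Set.univ)
      = iter S b q C (cut D (transition S b q fun _ _ => 1)) n := by
  induction n with
  | zero =>
    have h : meanWeight S b q 0 (fun _ => Set.univ) = fun _ _ => 1 := by
      funext j r; simp [meanWeight_zero]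
    funext j r
    rw [meanWeight_succ]
    simp [h, iter, cut]
  | succ n ih =>
    funext j r
    rw [meanWeight_succ]
    simp only [Nat.add_lt_add_iff_right, Nat.add_right_cancel_iff, ih, Nat.zero_lt_succ, if_true]
    rfl

/-- The exponential time, if it is not before the `n`-th event, falls either between this event and
the next one or after the latter. The first case is the `n`-th term of the resolvent of `killed`. -/
lemma iter_killed (hq : q ≠ 0) (C D : Set ℤ) (n : ℕ) (j : ℤ) (r : ℤ → ℝ≥0∞) :
    iter S b q C (cut D (killed S b q)) n j r
      + meanWeight S b q (n + 1) (fun i => if i < n then C else if i = n then D else Set.univ) j r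
      = meanWeight S b q n (fun i => if i < n then C else D) j r := by
  have h : (cut D fun _ _ => 1)
      = cut D (killed S b q) + cut D (transition S b q fun _ _ => 1) := by
    funext j r
    simp only [cut, Pi.add_apply]
    rw [← mul_add, add_comm, transition_one_add_killed hq]
  rw [meanWeight_eq_iter, meanWeight_succ_eq_iter, h,
    iter_add levelMeasurable_killed.cut (levelMeasurable_const 1).transition.cut]
  rfl

end Mean

section Law

lemma map_sumElim {ι κ α : Type*} [MeasurableSpace α] (μ : ι → Measure α) (ν : κ → Measure α)
    [∀ i, IsProbabilityMeasure (μ i)] [∀ i, IsProbabilityMeasure (ν i)]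
    [∀ i, IsProbabilityMeasure (Sum.elim μ ν i)] :
    ((Measure.infinitePi μ).prod (Measure.infinitePi ν)).map (fun p => Sum.elim p.1 p.2)
      = Measure.infinitePi (Sum.elim μ ν) := by
  classical
  have hm : Measurable fun p : (ι → α) × (κ → α) => (Sum.elim p.1 p.2 : ι ⊕ κ → α) := by
    refine measurable_pi_iff.2 fun i => ?_
    cases i with
    | inl i => exact (measurable_pi_apply i).comp measurable_fst
    | inr i => exact (measurable_pi_apply i).comp measurable_snd
  refine Measure.eq_infinitePi _ fun s t ht => ?_
  rw [Measure.map_apply hm (.pi s.countable_toSet fun _ _ => ht _)]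
  have h : (fun p : (ι → α) × (κ → α) => (Sum.elim p.1 p.2 : ι ⊕ κ → α)) ⁻¹' (Set.pi s t)
      = (Set.pi s.toLeft fun i => t (.inl i)) ×ˢ (Set.pi s.toRight fun i => t (.inr i)) := by
    ext ⟨x, y⟩
    simp [Set.mem_pi]
  rw [h, Measure.prod_prod, Measure.infinitePi_pi _ fun _ _ => ht _,
    Measure.infinitePi_pi _ fun _ _ => ht _]
  conv_rhs => rw [← Finset.toLeft_disjSum_toRight (u := s), Finset.prod_disjSum]
  rfl

lemma map_comp_inl_inr {ι κ α : Type*} [MeasurableSpace α] (μ : ι → Measure α)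
    (ν : κ → Measure α) [∀ i, IsProbabilityMeasure (μ i)] [∀ i, IsProbabilityMeasure (ν i)]
    [∀ i, IsProbabilityMeasure (Sum.elim μ ν i)] :
    (Measure.infinitePi (Sum.elim μ ν)).map
        (fun x => ((fun i => x (.inl i)), fun i => x (.inr i)))
      = (Measure.infinitePi μ).prod (Measure.infinitePi ν) := by
  have hm : Measurable fun p : (ι → α) × (κ → α) => (Sum.elim p.1 p.2 : ι ⊕ κ → α) := by
    refine measurable_pi_iff.2 fun i => ?_
    cases i with
    | inl i => exact (measurable_pi_apply i).comp measurable_fst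
    | inr i => exact (measurable_pi_apply i).comp measurable_snd
  rw [← map_sumElim, Measure.map_map (by fun_prop) hm]
  exact Measure.map_id

variable {Ω : Type*} [MeasurableSpace Ω] {S : Params} {P : Measure Ω} {X : Ω → Input}

lemma IsInput.hasLaw_gap (hX : IsInput S P X) (a : Clock) (i : ℕ) :
    HasLaw (fun ω => (X ω).gap a i) stdExp P where
  aemeasurable := by
    have h := (hX.gap_law a i).aemeasurable.real_toNNReal
    simpa using h
  map_eq := by
    have h := (hX.gap_law a i).map_eq
    have h2 : (fun ω => (X ω).gap a i) = Real.toNNReal ∘ fun ω => ((X ω).gap a i : ℝ) := by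
      funext ω; simp
    rw [h2, ← AEMeasurable.map_map_of_aemeasurable (by fun_prop) (hX.gap_law a i).aemeasurable, h]
    rfl

/-- The single independent family indexed by gaps and works is regrouped by clock and by row of
works. -/
lemma IsInput.hasLaw (hX : IsInput S P X) :
    HasLaw (fun ω => ((X ω).gap, (X ω).work)) (clockLaw.prod (worksLaw S)) P := by
  let μ : Clock × ℕ → Measure ℝ≥0 := fun _ => stdExp
  let ν : ℕ × ℤ → Measure ℝ≥0 := fun p => S.work p.2
  have hlaw : ∀ c, HasLaw (fun ω => Sum.elim (fun p => (X ω).gap p.1 p.2)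
      (fun p => (X ω).work p.1 p.2) c) (Sum.elim μ ν c) P := by
    rintro (p | p)
    · exact hX.hasLaw_gap p.1 p.2
    · exact hX.work_law p.1 p.2
  have inst : ∀ c, IsProbabilityMeasure (Sum.elim μ ν c) := by
    rintro (p | p)
    · exact inferInstanceAs (IsProbabilityMeasure stdExp)
    · exact inferInstanceAs (IsProbabilityMeasure (S.work p.2 : Measure ℝ≥0))
  have h1 := hX.indep.hasLaw_infinitePi hlaw (aemeasurable_pi_iff.2 fun c => (hlaw c).aemeasurable)
  have hm1 : Measurable fun x : (Clock × ℕ) ⊕ (ℕ × ℤ) → ℝ≥0 =>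
      ((fun i => x (.inl i)), fun i => x (.inr i)) := by fun_prop
  have h2 : (Measure.infinitePi (Sum.elim μ ν)).map (fun x => (MeasurableEquiv.curry Clock ℕ ℝ≥0
      (fun i => x (.inl i)), MeasurableEquiv.curry ℕ ℤ ℝ≥0 fun i => x (.inr i)))
      = clockLaw.prod (worksLaw S) := by
    have h3 := map_comp_inl_inr μ ν
    have h4 := congrArg (Measure.map (Prod.map (MeasurableEquiv.curry Clock ℕ ℝ≥0)
      (MeasurableEquiv.curry ℕ ℤ ℝ≥0))) h3
    rw [Measure.map_map (by fun_prop) hm1, ← Measure.map_prod_map _ _ (by fun_prop) (by fun_prop),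
      Measure.infinitePi_map_curry (fun (_ : Clock) (_ : ℕ) => stdExp),
      Measure.infinitePi_map_curry (fun (_ : ℕ) (n : ℤ) => (S.work n : Measure ℝ≥0))] at h4
    exact h4
  have h5 : Measurable fun x : (Clock × ℕ) ⊕ (ℕ × ℤ) → ℝ≥0 => (MeasurableEquiv.curry Clock ℕ ℝ≥0
      (fun i => x (.inl i)), MeasurableEquiv.curry ℕ ℤ ℝ≥0 fun i => x (.inr i)) := by fun_prop
  exact (HasLaw.mk h5.aemeasurable h2).comp h1

lemma IsInput.ae_good (hX : IsInput S P X) : ∀ᵐ ω ∂P, Good S (X ω).gap := by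
  have h1 : ∀ᵐ p ∂clockLaw.prod (worksLaw S), Good S p.1 :=
    Measure.quasiMeasurePreserving_fst.ae (PRP.ae_good S)
  rw [← hX.hasLaw.map_eq] at h1
  exact ae_of_ae_map hX.hasLaw.aemeasurable h1

variable {b : Option ℤ} {n₀ : ℤ} {q : ℝ≥0}

lemma measurable_firstStep_input (S : Params) (b : Option ℤ) (q : ℝ≥0) (n : ℕ) (C : ℕ → Set ℤ)
    (n₀ : ℤ) : Measurable fun p : (Clock → ℕ → ℝ≥0) × (ℤ → ℝ≥0) × (ℕ → ℤ → ℝ≥0) =>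
      firstStep S b q n C n₀ (fun n => (p.2.1 n : ℝ≥0∞)) p.1 p.2.2 :=
  (measurable_firstStep S b q n C n₀).comp (Measurable.prodMk
    (measurable_pi_iff.2 fun n => Measurable.coe_nnreal_ennreal (by fun_prop))
    (Measurable.prodMk (by fun_prop) (by fun_prop)))

lemma IsInput.weight_ae_eq (hX : IsInput S P X) (b : Option ℤ) (n₀ : ℤ) (q : ℝ≥0) (n : ℕ)
    (C : ℕ → Set ℤ) : (fun ω => weight q C (state S b n₀ (X ω)) n)
      =ᵐ[P] fun ω => firstStep S b q n C n₀ (fun n => ((X ω).work 0 n : ℝ≥0∞)) (X ω).gap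
        fun i => (X ω).work (i + 1) := by
  filter_upwards [hX.ae_good] with ω hω
  rw [firstStep_eq_weight hω]
  congr 1
  funext m
  exact state_eq_chain S b n₀ (X ω) m

lemma measurable_split_works :
    Measurable fun p : (Clock → ℕ → ℝ≥0) × (ℕ → ℤ → ℝ≥0) =>
      (p.1, p.2 0, fun i => p.2 (i + 1)) := by fun_prop

lemma IsInput.aemeasurable_weight (hX : IsInput S P X) (b : Option ℤ) (n₀ : ℤ) (q : ℝ≥0) (n : ℕ)
    (C : ℕ → Set ℤ) : AEMeasurable (fun ω => weight q C (state S b n₀ (X ω)) n) P :=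
  (((measurable_firstStep_input S b q n C n₀).comp measurable_split_works).comp_aemeasurable
    hX.hasLaw.aemeasurable).congr (hX.weight_ae_eq b n₀ q n C).symm

/-- Row zero of the works supplies the initial residual works and is independent of the later rows,
which supply the arrivals. It is therefore integrated out last. -/
lemma IsInput.lintegral_weight (hX : IsInput S P X) (b : Option ℤ) (n₀ : ℤ) (q : ℝ≥0) (n : ℕ)
    (C : ℕ → Set ℤ) : ∫⁻ ω, weight q C (state S b n₀ (X ω)) n ∂P
      = ∫⁻ z, meanWeight S b q n C n₀ (fun n => (z n : ℝ≥0∞)) ∂workRow S := by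
  have hm := measurable_firstStep_input S b q n C n₀
  have hm2 : Measurable fun p : (Clock → ℕ → ℝ≥0) × (ℕ → ℤ → ℝ≥0) =>
      firstStep S b q n C n₀ (fun n => (p.2 0 n : ℝ≥0∞)) p.1 fun i => p.2 (i + 1) :=
    hm.comp measurable_split_works
  rw [lintegral_congr_ae (hX.weight_ae_eq b n₀ q n C)]
  rw [← lintegral_map' (f := fun p : (Clock → ℕ → ℝ≥0) × (ℕ → ℤ → ℝ≥0) =>
      firstStep S b q n C n₀ (fun n => (p.2 0 n : ℝ≥0∞)) p.1 fun i => p.2 (i + 1))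
    hm2.aemeasurable hX.hasLaw.aemeasurable, hX.hasLaw.map_eq,
    lintegral_prod _ hm2.aemeasurable]
  have h1 : ∀ g, ∫⁻ w, firstStep S b q n C n₀ (fun n => (w 0 n : ℝ≥0∞)) g (fun i => w (i + 1))
        ∂worksLaw S = ∫⁻ z, ∫⁻ y, firstStep S b q n C n₀ (fun n => (z n : ℝ≥0∞)) g y
          ∂worksLaw S ∂workRow S := fun g =>
    lintegral_worksLaw S (F := fun z y => firstStep S b q n C n₀ (fun n => (z n : ℝ≥0∞)) g y)
      (hm.comp measurable_prodMk_left)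
  simp only [h1]
  have hm3 : Measurable fun p : (Clock → ℕ → ℝ≥0) × (ℤ → ℝ≥0) =>
      ∫⁻ y, firstStep S b q n C n₀ (fun n => (p.2 n : ℝ≥0∞)) p.1 y ∂worksLaw S := by
    refine Measurable.lintegral_prod_right' (f := fun p : ((Clock → ℕ → ℝ≥0) × (ℤ → ℝ≥0)) ×
      (ℕ → ℤ → ℝ≥0) => firstStep S b q n C n₀ (fun n => (p.1.2 n : ℝ≥0∞)) p.1.1 p.2) ?_
    exact hm.comp (by fun_prop : Measurable fun p : ((Clock → ℕ → ℝ≥0) × (ℤ → ℝ≥0)) ×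
      (ℕ → ℤ → ℝ≥0) => (p.1.1, p.1.2, p.2))
  rw [lintegral_lintegral_swap hm3.aemeasurable]
  refine lintegral_congr fun z => ?_
  rw [meanWeight, lintegral_prod]
  exact (hm.comp (by fun_prop : Measurable fun p : (Clock → ℕ → ℝ≥0) × (ℕ → ℤ → ℝ≥0) =>
      (p.1, z, p.2))).aemeasurable

end Law

end PRP

/-! ### Integrating out the exponential time -/

namespace PRP

section ExpLaw

/-- The exponential law with rate `q` on the nonnegative reals. -/
noncomputable def expLaw (q : ℝ≥0) : Measure ℝ≥0 := (expMeasure q).map Real.toNNReal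

lemma isProbabilityMeasure_expLaw {q : ℝ≥0} (hq : q ≠ 0) : IsProbabilityMeasure (expLaw q) := by
  have := isProbabilityMeasure_expMeasure (r := (q : ℝ)) (by positivity)
  exact Measure.isProbabilityMeasure_map (by fun_prop)

lemma expLaw_lt {q : ℝ≥0} (hq : q ≠ 0) (T : ℝ≥0∞) :
    expLaw q {t | (t : ℝ≥0∞) < T} = q * discTime q T := by
  have hm := measurableSet_coe_lt T
  rw [← lintegral_indicator_one hm, expLaw, lintegral_map (measurable_one.indicator hm)
    (by fun_prop), lintegral_exp_law (f := {t : ℝ≥0 | (t : ℝ≥0∞) < T}.indicator 1)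
    (measurable_one.indicator hm) (by positivity), discTime]
  congr 1
  refine lintegral_congr fun s => ?_
  by_cases hs : s ∈ {s : ℝ≥0 | (s : ℝ≥0∞) < T}
  · simp only [Set.indicator_of_mem hs, Pi.one_apply, mul_one]
  · simp only [Set.indicator_of_notMem hs, mul_zero]

lemma expLaw_le {q : ℝ≥0} (hq : q ≠ 0) (T : ℝ≥0∞) :
    expLaw q {t | T ≤ (t : ℝ≥0∞)} = disc q T := by
  have := isProbabilityMeasure_expLaw hq
  have h1 := prob_add_prob_compl (μ := expLaw q) (measurableSet_coe_lt T)
  rw [expLaw_lt hq, show {t : ℝ≥0 | (t : ℝ≥0∞) < T}ᶜ = {t : ℝ≥0 | T ≤ (t : ℝ≥0∞)} by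
    ext; simp, ← mul_discTime_add hq T] at h1
  refine (ENNReal.add_right_inj ?_).1 h1
  refine ne_top_of_le_ne_top ENNReal.one_ne_top ?_
  rw [← mul_discTime_add hq T]
  exact le_self_add

lemma measurableSet_le_coe (T : ℝ≥0∞) : MeasurableSet {t : ℝ≥0 | T ≤ (t : ℝ≥0∞)} :=
  measurableSet_le measurable_const measurable_coe_nnreal_ennreal

/-- The times after the `n`-th event, if the level after the `i`-th event is in `C i` for
`i ≤ n`. -/
def eventTimes (C : ℕ → Set ℤ) (f : ℕ → State) (n : ℕ) : Set ℝ≥0 :=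
  {t | (f n).time ≤ t ∧ ∀ i ≤ n, (f i).level ∈ C i}

lemma measurableSet_eventTimes (C : ℕ → Set ℤ) (f : ℕ → State) (n : ℕ) :
    MeasurableSet (eventTimes C f n) :=
  (measurableSet_le_coe _).inter (MeasurableSet.const _)

lemma prod_indicator_eq (C : ℕ → Set ℤ) (f : ℕ → State) (n : ℕ)
    [Decidable (∀ i ≤ n, (f i).level ∈ C i)] :
    ∏ i ∈ Finset.range (n + 1), (C i).indicator (1 : ℤ → ℝ≥0∞) (f i).level
      = if ∀ i ≤ n, (f i).level ∈ C i then 1 else 0 := by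
  split_ifs with h
  · refine Finset.prod_eq_one fun i hi => ?_
    simp [h i (by simpa [Nat.lt_succ_iff] using hi)]
  · push Not at h
    obtain ⟨i, hi, h⟩ := h
    exact Finset.prod_eq_zero (i := i) (by simpa [Nat.lt_succ_iff] using hi) (by simp [h])

/-- For a fixed trajectory the discount factor at an event is the probability that the exponential
time is not earlier. This links the operators to an independent exponential time. -/
lemma expLaw_eventTimes {q : ℝ≥0} (hq : q ≠ 0) (C : ℕ → Set ℤ) (f : ℕ → State) (n : ℕ) :
    expLaw q (eventTimes C f n) = weight q C f n := by
  classical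
  rw [weight, prod_indicator_eq, eventTimes]
  by_cases h : ∀ i ≤ n, (f i).level ∈ C i
  · simp only [eq_true h, and_true, if_true, mul_one]
    exact expLaw_le hq _
  · simp [h]

lemma weight_le_one (q : ℝ≥0) (C : ℕ → Set ℤ) (f : ℕ → State) (n : ℕ) : weight q C f n ≤ 1 := by
  classical
  rw [weight, prod_indicator_eq]
  refine mul_le_one' (disc_le_one _ _) ?_
  split_ifs <;> simp

end ExpLaw

section Times

variable {q : ℝ≥0} {f : ℕ → State} {l v : ℤ}

/-- The times up to which a level below `l` has been entered. -/
def passTimes (f : ℕ → State) (l : ℤ) : Set ℝ≥0 :=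
  {t | ∃ m, (f m).time ≤ t ∧ (f m).level < l}

/-- The times between the `m`-th and the next event, if the level is `v`, and all levels before
are at least `l`. -/
def stayCell (f : ℕ → State) (l v : ℤ) (m : ℕ) : Set ℝ≥0 :=
  {t | (f m).time ≤ t ∧ t < (f (m + 1)).time ∧ (f m).level = v ∧ ∀ i ≤ m, l ≤ (f i).level}

/-- The times at which the level is `v`, and all levels before are at least `l`. -/
def stayTimes (f : ℕ → State) (l v : ℤ) : Set ℝ≥0 := ⋃ m, stayCell f l v m

lemma measurableSet_passTimes (f : ℕ → State) (l : ℤ) : MeasurableSet (passTimes f l) := by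
  have : passTimes f l = ⋃ m, {t : ℝ≥0 | (f m).time ≤ t ∧ (f m).level < l} := by
    ext; simp [passTimes]
  rw [this]
  exact MeasurableSet.iUnion fun m => (measurableSet_le_coe _).inter (MeasurableSet.const _)

lemma measurableSet_stayCell (f : ℕ → State) (l v : ℤ) (m : ℕ) :
    MeasurableSet (stayCell f l v m) :=
  (measurableSet_le_coe _).inter ((measurableSet_coe_lt _).inter (MeasurableSet.const _))

lemma measurableSet_stayTimes (f : ℕ → State) (l v : ℤ) : MeasurableSet (stayTimes f l v) :=
  MeasurableSet.iUnion fun m => measurableSet_stayCell f l v m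

/-- Sort by the first event after which the level is below `l`; these cases are disjoint. -/
lemma expLaw_passTimes (hq : q ≠ 0) (hf : Monotone fun m => (f m).time) (l : ℤ) :
    expLaw q (passTimes f l)
      = ∑' n, weight q (fun i => if i < n then Set.Ici l else Set.Iio l) f n := by
  have h1 : passTimes f l
      = ⋃ n, eventTimes (fun i => if i < n then Set.Ici l else Set.Iio l) f n := by
    ext t
    simp only [passTimes, eventTimes, Set.mem_ofPred_eq, Set.mem_iUnion]
    constructor
    · rintro ⟨m, h1, h2⟩
      classical
      have hex : ∃ m, (f m).level < l := ⟨m, h2⟩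
      refine ⟨Nat.find hex, (hf (Nat.find_min' hex h2)).trans h1, fun i hi => ?_⟩
      split_ifs with h
      · simpa using Nat.find_min hex h
      · rw [le_antisymm hi (not_lt.1 h)]
        exact Nat.find_spec hex
    · rintro ⟨n, h1, h2⟩
      exact ⟨n, h1, by simpa using h2 n le_rfl⟩
  rw [h1, measure_iUnion _ fun n => measurableSet_eventTimes _ _ _]
  · exact tsum_congr fun n => expLaw_eventTimes hq _ _ _
  · have h2 : ∀ m n, m < n → ∀ t ∈ eventTimes (fun i => if i < m then Set.Ici l else Set.Iio l) f m,
        t ∉ eventTimes (fun i => if i < n then Set.Ici l else Set.Iio l) f n := by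
      intro m n hmn t ht ht'
      have h3 := ht.2 m le_rfl
      have h4 := ht'.2 m hmn.le
      simp only [lt_self_iff_false, if_false, Set.mem_Iio] at h3
      simp only [hmn, if_true, Set.mem_Ici] at h4
      omega
    intro m n hmn
    refine Set.disjoint_left.2 fun t ht ht' => ?_
    rcases lt_or_gt_of_ne hmn with h | h
    · exact h2 m n h t ht ht'
    · exact h2 n m h t ht' ht

/-- The pathwise counterpart of `iter_killed`, again in additive form. -/
lemma expLaw_stayCell (hq : q ≠ 0) (hf : Monotone fun m => (f m).time) (l v : ℤ) (n : ℕ) :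
    expLaw q (stayCell f l v n) + weight q (fun i => if i < n then Set.Ici l else
        if i = n then Set.Ici l ∩ {v} else Set.univ) f (n + 1)
      = weight q (fun i => if i < n then Set.Ici l else Set.Ici l ∩ {v}) f n := by
  have := isProbabilityMeasure_expLaw hq
  rw [← expLaw_eventTimes hq, ← expLaw_eventTimes hq, ← measure_union _
    (measurableSet_eventTimes _ _ _)]
  · congr 1
    ext t
    simp only [stayCell, eventTimes, Set.mem_union, Set.mem_ofPred_eq]
    constructor
    · rintro (⟨h1, h2, h3, h4⟩ | ⟨h1, h2⟩)
      · refine ⟨h1, fun i hi => ?_⟩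
        split_ifs with h
        · exact h4 i hi
        · rw [le_antisymm hi (not_lt.1 h)]
          exact ⟨h4 n le_rfl, h3⟩
      · refine ⟨(hf n.le_succ).trans h1, fun i hi => ?_⟩
        have := h2 i (hi.trans n.le_succ)
        split_ifs with h
        · simpa [h] using this
        · simpa [le_antisymm hi (not_lt.1 h)] using this
    · rintro ⟨h1, h2⟩
      have hv : (f n).level ∈ Set.Ici l ∩ {v} := by simpa using h2 n le_rfl
      have hle : ∀ i ≤ n, l ≤ (f i).level := by
        intro i hi
        have := h2 i hi
        split_ifs at this with h
        · exact this
        · exact this.1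
      by_cases h3 : (t : ℝ≥0∞) < (f (n + 1)).time
      · exact Or.inl ⟨h1, h3, hv.2, hle⟩
      · refine Or.inr ⟨not_lt.1 h3, fun i hi => ?_⟩
        split_ifs with h h'
        · exact hle i h.le
        · rw [h']; exact hv
        · trivial
  · exact Set.disjoint_left.2 fun t ht ht' => ht.2.1.not_ge ht'.1

lemma expLaw_stayTimes (hf : Monotone fun m => (f m).time) (l v : ℤ) :
    expLaw q (stayTimes f l v) = ∑' n, expLaw q (stayCell f l v n) := by
  refine measure_iUnion (fun m n hmn => ?_) fun n => measurableSet_stayCell _ _ _ _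
  have h2 : ∀ m n, m < n → ∀ t ∈ stayCell f l v m, t ∉ stayCell f l v n := fun m n hmn t ht ht' =>
    (ht.2.1.trans_le (hf (Nat.succ_le_of_lt hmn))).not_ge ht'.1
  refine Set.disjoint_left.2 fun t ht ht' => ?_
  rcases lt_or_gt_of_ne hmn with h | h
  · exact h2 m n h t ht ht'
  · exact h2 n m h t ht' ht

end Times

section Expectation

variable {Ω : Type*} [MeasurableSpace Ω] {S : Params} {P : Measure Ω} {X : Ω → Input}
  {b : Option ℤ} {n₀ : ℤ} {q : ℝ≥0}

lemma state_time_mono (S : Params) (b : Option ℤ) (n₀ : ℤ) (x : Input) :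
    Monotone fun m => (state S b n₀ x m).time := by
  simp only [state_eq_chain]
  exact chain_time_mono _

lemma measurable_coe_resid : Measurable fun (z : ℤ → ℝ≥0) (n : ℤ) => (z n : ℝ≥0∞) :=
  measurable_pi_iff.2 fun n => Measurable.coe_nnreal_ennreal (by fun_prop)

lemma lintegral_tsum_iter {C : Set ℤ} {h : ℤ → (ℤ → ℝ≥0∞) → ℝ≥0∞} (hh : LevelMeasurable h)
    (n₀ : ℤ) : ∫⁻ z, ∑' n, iter S b q C h n n₀ (fun n => ((z n : ℝ≥0) : ℝ≥0∞)) ∂workRow S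
      = ∑' n, ∫⁻ z, iter S b q C h n n₀ (fun n => (z n : ℝ≥0∞)) ∂workRow S :=
  lintegral_tsum fun n => ((hh.iter n n₀).comp measurable_coe_resid).aemeasurable

lemma IsInput.lintegral_passTimes (hX : IsInput S P X) (hq : q ≠ 0) (n₀ l : ℤ) :
    ∫⁻ ω, expLaw q (passTimes (state S none n₀ (X ω)) l) ∂P
      = ∫⁻ z, passBelow S q l n₀ (fun n => (z n : ℝ≥0∞)) ∂workRow S := by
  simp only [expLaw_passTimes hq (state_time_mono _ _ _ _)]
  rw [lintegral_tsum fun n => hX.aemeasurable_weight _ _ _ _ _]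
  simp only [hX.lintegral_weight, meanWeight_eq_iter, passBelow, resolvent]
  exact (lintegral_tsum_iter (levelMeasurable_const 1).cut n₀).symm

lemma IsInput.aemeasurable_stayCell (hX : IsInput S P X) (hq : q ≠ 0) (b : Option ℤ)
    (n₀ l v : ℤ) (n : ℕ) :
    AEMeasurable (fun ω => expLaw q (stayCell (state S b n₀ (X ω)) l v n)) P := by
  have hcell : ∀ ω, expLaw q (stayCell (state S b n₀ (X ω)) l v n)
      = weight q (fun i => if i < n then Set.Ici l else Set.Ici l ∩ {v}) (state S b n₀ (X ω)) n
        - weight q (fun i => if i < n then Set.Ici l else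
        if i = n then Set.Ici l ∩ {v} else Set.univ) (state S b n₀ (X ω)) (n + 1) := fun ω =>
    ENNReal.eq_sub_of_add_eq (ne_top_of_le_ne_top ENNReal.one_ne_top (weight_le_one _ _ _ _))
      (expLaw_stayCell hq (state_time_mono _ _ _ _) l v n)
  simp only [hcell]
  exact (hX.aemeasurable_weight _ _ _ _ _).sub (hX.aemeasurable_weight _ _ _ _ _)

lemma IsInput.aemeasurable_stayTimes (hX : IsInput S P X) (hq : q ≠ 0) (b : Option ℤ)
    (n₀ l v : ℤ) : AEMeasurable (fun ω => expLaw q (stayTimes (state S b n₀ (X ω)) l v)) P := by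
  simp only [expLaw_stayTimes (state_time_mono _ _ _ _)]
  exact AEMeasurable.tsum fun n => hX.aemeasurable_stayCell hq b n₀ l v n

lemma IsInput.aemeasurable_passTimes (hX : IsInput S P X) (hq : q ≠ 0) (b : Option ℤ)
    (n₀ l : ℤ) : AEMeasurable (fun ω => expLaw q (passTimes (state S b n₀ (X ω)) l)) P := by
  simp only [expLaw_passTimes hq (state_time_mono _ _ _ _)]
  exact AEMeasurable.tsum fun n => hX.aemeasurable_weight _ _ _ _ _

/-- For each number of events, the identities `expLaw_stayCell` and `iter_killed` share two terms in
mean. Cancelling the finite one matches the cell with a term of the resolvent. -/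
lemma IsInput.lintegral_stayTimes [IsProbabilityMeasure P] (hX : IsInput S P X) (hq : q ≠ 0)
    (b : Option ℤ) (n₀ l v : ℤ) :
    ∫⁻ ω, expLaw q (stayTimes (state S b n₀ (X ω)) l v) ∂P
      = ∫⁻ z, stayAt S b q l v n₀ (fun n => (z n : ℝ≥0∞)) ∂workRow S := by
  have hm := hX.aemeasurable_stayCell hq b n₀ l v
  simp only [expLaw_stayTimes (state_time_mono _ _ _ _)]
  have hcut : cut (Set.Ici l) (cut {v} (killed S b q))
      = cut (Set.Ici l ∩ {v}) (killed S b q) := by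
    funext j r
    simp only [cut, ← mul_assoc, Set.inter_indicator_one, Pi.mul_apply]
  rw [lintegral_tsum hm, stayAt, hcut]
  simp only [resolvent]
  rw [lintegral_tsum_iter levelMeasurable_killed.cut]
  refine tsum_congr fun n => ?_
  have h1 : ∫⁻ ω, expLaw q (stayCell (state S b n₀ (X ω)) l v n) ∂P
      + ∫⁻ ω, weight q (fun i => if i < n then Set.Ici l else
        if i = n then Set.Ici l ∩ {v} else Set.univ) (state S b n₀ (X ω)) (n + 1) ∂P
      = ∫⁻ ω, weight q (fun i => if i < n then Set.Ici l else Set.Ici l ∩ {v})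
          (state S b n₀ (X ω)) n ∂P := by
    rw [← lintegral_add_left' (hm n)]
    exact lintegral_congr fun ω => expLaw_stayCell hq (state_time_mono _ _ _ _) l v n
  have hfin : ∫⁻ ω, weight q (fun i => if i < n then Set.Ici l else
        if i = n then Set.Ici l ∩ {v} else Set.univ) (state S b n₀ (X ω)) (n + 1) ∂P ≠ ⊤ := by
    refine ne_top_of_le_ne_top ENNReal.one_ne_top ?_
    calc _ ≤ ∫⁻ _, 1 ∂P := lintegral_mono fun ω => weight_le_one _ _ _ _
      _ = 1 := by simp
  rw [hX.lintegral_weight, hX.lintegral_weight] at h1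
  rw [hX.lintegral_weight] at hfin
  refine (ENNReal.add_left_inj hfin).1 (h1.trans ?_)
  have hm2 : Measurable fun z : ℤ → ℝ≥0 => iter S b q (Set.Ici l)
      (cut (Set.Ici l ∩ {v}) (killed S b q)) n n₀ fun n => (z n : ℝ≥0∞) :=
    (levelMeasurable_killed.cut.iter n n₀).comp measurable_coe_resid
  rw [← lintegral_add_left hm2]
  exact lintegral_congr fun z => (iter_killed hq _ _ n n₀ _).symm

end Expectation

end PRP

/-! ### Paths, running infima and the embedded chain -/

namespace PRP

variable {S : Params} {b : Option ℤ} {n₀ l v : ℤ} {x : Input} {t u : ℝ≥0}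

section Path

lemma state_time_zero : (state S b n₀ x 0).time = 0 := rfl

lemma time_index_unique {m m' : ℕ} (h1 : (state S b n₀ x m).time ≤ t)
    (h2 : (t : ℝ≥0∞) < (state S b n₀ x (m + 1)).time) (h1' : (state S b n₀ x m').time ≤ t)
    (h2' : (t : ℝ≥0∞) < (state S b n₀ x (m' + 1)).time) : m = m' := by
  have hf := state_time_mono S b n₀ x
  by_contra h
  rcases lt_or_gt_of_ne h with h | h
  · exact (h2.trans_le (hf (Nat.succ_le_of_lt h))).not_ge h1'
  · exact (h2'.trans_le (hf (Nat.succ_le_of_lt h))).not_ge h1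

lemma path_of_mem {m : ℕ} (h1 : (state S b n₀ x m).time ≤ t)
    (h2 : (t : ℝ≥0∞) < (state S b n₀ x (m + 1)).time) :
    path S b n₀ x t = (((state S b n₀ x m).level : ℝ) : EReal) := by
  have h : ∃ m, (state S b n₀ x m).time ≤ t ∧ (t : ℝ≥0∞) < (state S b n₀ x (m + 1)).time :=
    ⟨m, h1, h2⟩
  rw [path, dif_pos h, time_index_unique h.choose_spec.1 h.choose_spec.2 h1 h2]

lemma exploded_iff : (¬ ∃ m, (state S b n₀ x m).time ≤ t ∧
      (t : ℝ≥0∞) < (state S b n₀ x (m + 1)).time) ↔ ∀ m, (state S b n₀ x m).time ≤ t := by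
  constructor
  · intro h m
    induction m with
    | zero => simp [state_time_zero]
    | succ m ih => exact not_lt.1 fun h' => h ⟨m, ih, h'⟩
  · rintro h ⟨m, -, h2⟩
    exact h2.not_ge (h (m + 1))

open Classical in
lemma path_of_exploded (h : ∀ m, (state S b n₀ x m).time ≤ t) : path S b n₀ x t
    = if BddBelow (Set.range fun m => (state S b n₀ x m).level) then ⊤ else ⊥ := by
  rw [path, dif_neg (exploded_iff.2 h)]

lemma path_eq_coe_iff : path S b n₀ x t = ((v : ℝ) : EReal) ↔
    ∃ m, (state S b n₀ x m).time ≤ t ∧ (t : ℝ≥0∞) < (state S b n₀ x (m + 1)).time ∧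
      (state S b n₀ x m).level = v := by
  constructor
  · intro h
    by_cases h' : ∀ m, (state S b n₀ x m).time ≤ t
    · rw [path_of_exploded h'] at h
      split_ifs at h
      · exact absurd h.symm (EReal.coe_ne_top _)
      · exact absurd h.symm (EReal.coe_ne_bot _)
    · rw [← exploded_iff, not_not] at h'
      obtain ⟨m, h1, h2⟩ := h'
      rw [path_of_mem h1 h2] at h
      exact ⟨m, h1, h2, by exact_mod_cast h⟩
  · rintro ⟨m, h1, h2, rfl⟩
    exact path_of_mem h1 h2

lemma path_eq_bot_iff : path S b n₀ x t = ⊥ ↔ (∀ m, (state S b n₀ x m).time ≤ t) ∧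
    ∀ N : ℤ, ∃ m, (state S b n₀ x m).level < N := by
  have hbdd : (∀ N : ℤ, ∃ m, (state S b n₀ x m).level < N) ↔
      ¬ BddBelow (Set.range fun m => (state S b n₀ x m).level) := by
    rw [not_bddBelow_iff]
    simp
  rw [hbdd]
  by_cases h' : ∀ m, (state S b n₀ x m).time ≤ t
  · rw [path_of_exploded h']
    split_ifs with h <;> simp [h, h']
  · have h'' := h'
    rw [← exploded_iff, not_not] at h''
    obtain ⟨m, h1, h2⟩ := h''
    rw [path_of_mem h1 h2]
    simp only [EReal.coe_ne_bot, false_iff, not_and_or]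
    exact Or.inl h'

lemma path_cases (S : Params) (b : Option ℤ) (n₀ : ℤ) (x : Input) (t : ℝ≥0) :
    path S b n₀ x t = ⊤ ∨ path S b n₀ x t = ⊥ ∨ ∃ v : ℤ, path S b n₀ x t = ((v : ℝ) : EReal) := by
  by_cases h' : ∀ m, (state S b n₀ x m).time ≤ t
  · rw [path_of_exploded h']
    split_ifs <;> simp
  · rw [← exploded_iff, not_not] at h'
    obtain ⟨m, h1, h2⟩ := h'
    exact Or.inr (Or.inr ⟨_, path_of_mem h1 h2⟩)

/-- A path is constant immediately after each time. -/
def RightConstant (f : ℝ≥0 → EReal) : Prop := ∀ t, ∃ s, t < s ∧ ∀ u, t ≤ u → u < s → f u = f t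

lemma rightConstant_path (S : Params) (b : Option ℤ) (n₀ : ℤ) (x : Input) :
    RightConstant (path S b n₀ x) := by
  intro t
  by_cases h' : ∀ m, (state S b n₀ x m).time ≤ t
  · refine ⟨t + 1, by simp, fun u hu _ => ?_⟩
    rw [path_of_exploded h', path_of_exploded fun m => (h' m).trans (by exact_mod_cast hu)]
  · rw [← exploded_iff, not_not] at h'
    obtain ⟨m, h1, h2⟩ := h'
    obtain ⟨s, hs1, hs2⟩ := ENNReal.lt_iff_exists_nnreal_btwn.1 h2
    refine ⟨s, by exact_mod_cast hs1, fun u hu hus => ?_⟩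
    rw [path_of_mem h1 h2, path_of_mem (h1.trans (by exact_mod_cast hu))
      (lt_trans (by exact_mod_cast hus) hs2)]

/-- Finite values of the path are integers, so an infimum of `l` means that a value below `l + 1`
occurs and none below `l`. -/
lemma runningInf_path_eq_iff : runningInf (path S b n₀ x) t = ((l : ℝ) : EReal) ↔
    (∃ u ≤ t, path S b n₀ x u < (((l + 1 : ℤ) : ℝ) : EReal)) ∧
      ¬ ∃ u ≤ t, path S b n₀ x u < ((l : ℝ) : EReal) := by
  have hlt : ((l : ℝ) : EReal) < (((l + 1 : ℤ) : ℝ) : EReal) := by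
    exact_mod_cast lt_add_one l
  constructor
  · intro h
    constructor
    · rw [← h, runningInf] at hlt
      simp only [iInf_lt_iff] at hlt
      obtain ⟨u, hu, h2⟩ := hlt
      exact ⟨u, hu.2, h2⟩
    · rintro ⟨u, hu, h2⟩
      refine h2.not_ge ?_
      rw [← h]
      exact iInf₂_le u ⟨zero_le, hu⟩
  · rintro ⟨⟨u, hu, h1⟩, h2⟩
    push Not at h2
    refine le_antisymm ?_ (le_iInf₂ fun w hw => h2 w hw.2)
    refine (iInf₂_le u ⟨zero_le, hu⟩).trans ?_
    have h3 := h2 u hu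
    rcases path_cases S b n₀ x u with h | h | ⟨v, h⟩
    · rw [h] at h1; exact absurd h1 (by simp)
    · rw [h]; exact bot_le
    · rw [h] at h1 h3 ⊢
      have h4 : v < l + 1 := by exact_mod_cast h1
      exact_mod_cast Int.lt_add_one_iff.1 h4

end Path

section Unreflected

/-- The next ring is strictly later than the last event, so the only events that take no time are
completions of zero residual work. -/
lemma step_none_cases {g : Clock → ℕ → ℝ≥0} (hg : Good S g) (y : ℕ → ℤ → ℝ≥0) (fresh : ℤ → ℝ≥0)
    (s : State) (hs : s.time ≠ ⊤) (h : (step S none ⟨g, y⟩ fresh s).time = s.time) :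
    (step S none ⟨g, y⟩ fresh s).level = s.level - 1 := by
  rw [step_eq] at h ⊢
  split_ifs at h ⊢ with h1 h2
  · exact absurd h.symm hs
  · rfl
  · exact absurd h (lt_nextPt hg hs).ne'

lemma state_level_of_time_eq (hg : Good S x.gap) {m : ℕ} (hm : (state S none n₀ x m).time ≠ ⊤)
    {k : ℕ} (h : ∀ i ≤ k, (state S none n₀ x (m + i)).time = (state S none n₀ x m).time) :
    (state S none n₀ x (m + k)).level = (state S none n₀ x m).level - k := by
  induction k with
  | zero => simp
  | succ k ih =>
    have h1 := ih fun i hi => h i (hi.trans k.le_succ)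
    have h2 := h k k.le_succ
    have h3 := h (k + 1) le_rfl
    have h4 := step_none_cases hg x.work (x.work (m + k + 1)) (state S none n₀ x (m + k))
      (h2 ▸ hm) (h3.trans h2.symm)
    change (state S none n₀ x (m + k + 1)).level = _
    refine h4.trans ?_
    rw [h1]
    push_cast
    ring

/-- A level of the chain that is left at the instant it is entered is not a value of the path. But
instantaneous events only lower the level, so the path is below `l` at that instant all the same,
with value `⊥` if infinitely many completions coincide. -/
lemma exists_path_lt_iff (hg : Good S x.gap) :
    (∃ u ≤ t, path S none n₀ x u < ((l : ℝ) : EReal)) ↔ t ∈ passTimes (state S none n₀ x) l := by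
  have hf := state_time_mono S none n₀ x
  constructor
  · rintro ⟨u, hu, h⟩
    have hu' : (u : ℝ≥0∞) ≤ t := by exact_mod_cast hu
    rcases path_cases S none n₀ x u with h' | h' | ⟨v, h'⟩
    · rw [h'] at h; exact absurd h (by simp)
    · obtain ⟨h1, h2⟩ := path_eq_bot_iff.1 h'
      obtain ⟨m, hm⟩ := h2 l
      exact ⟨m, (h1 m).trans hu', hm⟩
    · obtain ⟨m, h1, -, h3⟩ := path_eq_coe_iff.1 h'
      rw [h'] at h
      exact ⟨m, h1.trans hu', by rw [h3]; exact_mod_cast h⟩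
  · rintro ⟨m, h1, h2⟩
    have hm : (state S none n₀ x m).time ≠ ⊤ := ne_top_of_le_ne_top ENNReal.coe_ne_top h1
    set s := (state S none n₀ x m).time.toNNReal with hs
    have hs' : (s : ℝ≥0∞) = (state S none n₀ x m).time := ENNReal.coe_toNNReal hm
    refine ⟨s, by rw [← ENNReal.coe_le_coe, hs']; exact h1, ?_⟩
    by_cases h : ∀ k, (state S none n₀ x (m + k)).time = (state S none n₀ x m).time
    · have hbot : path S none n₀ x s = ⊥ := by
        refine path_eq_bot_iff.2 ⟨fun i => ?_, fun N => ?_⟩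
        · rw [hs', ← h i]
          exact hf (by omega)
        · refine ⟨m + ((state S none n₀ x m).level - N + 1).toNat, ?_⟩
          rw [state_level_of_time_eq hg hm fun i _ => h i]
          omega
      rw [hbot]
      exact EReal.bot_lt_coe _
    · push Not at h
      classical
      -- The index `m + k` belongs to the last event at this instant; zero is impossible because the
      -- two times then coincide trivially.
      obtain ⟨k, hk⟩ : ∃ k, Nat.find h = k + 1 := by
        refine Nat.exists_eq_succ_of_ne_zero fun h0 => ?_
        have := Nat.find_spec h
        rw [h0] at this
        exact this rfl
      have hlt : ∀ i ≤ k, (state S none n₀ x (m + i)).time = (state S none n₀ x m).time :=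
        fun i hi => not_not.1 (Nat.find_min h (by omega))
      have hne := Nat.find_spec h
      rw [hk] at hne
      have h3 : (s : ℝ≥0∞) < (state S none n₀ x (m + k + 1)).time := by
        rw [hs']
        exact lt_of_le_of_ne (hf (by omega)) (Ne.symm hne)
      rw [path_of_mem (m := m + k) (by rw [hs', hlt k le_rfl]) h3,
        state_level_of_time_eq hg hm hlt]
      have : (state S none n₀ x m).level - (k : ℤ) < l := by omega
      exact_mod_cast this

lemma runningInf_eq_iff_passTimes (hg : Good S x.gap) :
    runningInf (path S none n₀ x) t = ((l : ℝ) : EReal) ↔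
      t ∈ passTimes (state S none n₀ x) (l + 1) \ passTimes (state S none n₀ x) l := by
  rw [runningInf_path_eq_iff, exists_path_lt_iff hg, exists_path_lt_iff hg]
  rfl

lemma mem_stayTimes_iff : t ∈ stayTimes (state S b n₀ x) l v ↔
    path S b n₀ x t = ((v : ℝ) : EReal) ∧ t ∉ passTimes (state S b n₀ x) l := by
  have hf := state_time_mono S b n₀ x
  simp only [stayTimes, stayCell, Set.mem_iUnion, Set.mem_ofPred_eq, path_eq_coe_iff, passTimes]
  constructor
  · rintro ⟨m, h1, h2, h3, h4⟩
    refine ⟨⟨m, h1, h2, h3⟩, ?_⟩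
    rintro ⟨i, hi, hi'⟩
    have : i ≤ m := by
      by_contra h
      exact (h2.trans_le (hf (not_le.1 h))).not_ge hi
    exact hi'.not_ge (h4 i this)
  · rintro ⟨⟨m, h1, h2, h3⟩, h4⟩
    exact ⟨m, h1, h2, h3, fun i hi => not_lt.1 fun h => h4 ⟨i, (hf hi).trans h1, h⟩⟩

lemma passTimes_mono {f : ℕ → State} {l l' : ℤ} (h : l ≤ l') : passTimes f l ⊆ passTimes f l' :=
  fun _ ⟨m, h1, h2⟩ => ⟨m, h1, h2.trans_le h⟩

end Unreflected

section Reflected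

/-- At the barrier the completion time is infinite, so the level cannot drop by service, and jumps
are reflected. -/
lemma level_le_state_some (x : Input) (m : ℕ) : l ≤ (state S (some l) l x m).level := by
  induction m with
  | zero => exact le_rfl
  | succ m ih =>
    have hs : ∀ (s : State), l ≤ s.level → l ≤ (step S (some l) x (x.work (m + 1)) s).level := by
      intro s hs
      rw [step_eq]
      split_ifs with h1 h2
      · exact hs
      · have : completion (some l) s ≠ ⊤ := by
          intro h
          refine h1 ⟨h, ?_⟩
          rwa [h, top_le_iff] at h2
        have h3 : l ≠ s.level := by
          intro h
          exact this (by simp [completion, h])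
        change l ≤ s.level - 1
        omega
      · change l ≤ jumpLevel _ _ _
        unfold jumpLevel
        split_ifs
        · exact le_max_left _ _
        · exact hs
    exact hs _ ih

lemma mem_stayTimes_some_iff :
    t ∈ stayTimes (state S (some l) l x) l v ↔ path S (some l) l x t = ((v : ℝ) : EReal) := by
  rw [mem_stayTimes_iff, and_iff_left]
  rintro ⟨m, -, h⟩
  exact h.not_ge (level_le_state_some x m)

end Reflected

end PRP

/-! ### Measurability of paths and independence of the exponential time -/

namespace PRP

section DenseTimes

/-- A countable dense set of times. -/
noncomputable def denseTime : ℕ → ℝ≥0 := TopologicalSpace.denseSeq ℝ≥0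

lemma exists_denseTime_btwn {s t : ℝ≥0} (h : s < t) : ∃ n, s < denseTime n ∧ denseTime n < t := by
  obtain ⟨u, hu⟩ := exists_between h
  obtain ⟨n, hn⟩ := (TopologicalSpace.denseRange_denseSeq ℝ≥0).exists_mem_open
    (isOpen_Ioo (a := s) (b := t)) ⟨u, hu⟩
  exact ⟨n, hn⟩

/-- The event that a right-constant path has a value in `A` at time `t`, in terms of its values at
the times `denseTime n`. -/
def nowIn (A : Set EReal) : Set (ℝ≥0 × (ℕ → EReal)) :=
  {p | ∃ n, p.1 < denseTime n ∧ ∀ m, p.1 < denseTime m → denseTime m < denseTime n → p.2 m ∈ A}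

/-- The event that a right-constant path has a value in `A` up to time `t`, in terms of its values
at the times `denseTime n`. -/
def onceIn (A : Set EReal) : Set (ℝ≥0 × (ℕ → EReal)) :=
  nowIn A ∪ {p | ∃ n, denseTime n < p.1 ∧ p.2 n ∈ A}

variable {A : Set EReal} {f : ℝ≥0 → EReal} {t : ℝ≥0}

lemma measurableSet_nowIn (hA : MeasurableSet A) : MeasurableSet (nowIn A) := by
  have h : nowIn A = ⋃ n, ({p | p.1 < denseTime n} ∩ ⋂ m, ({p | p.1 < denseTime m}ᶜ ∪
      ({_p | denseTime m < denseTime n}ᶜ ∪ {p | p.2 m ∈ A}))) := by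
    ext p
    simp only [nowIn, Set.mem_ofPred_eq, Set.mem_iUnion, Set.mem_inter_iff, Set.mem_iInter,
      Set.mem_union, Set.mem_compl_iff, imp_iff_not_or]
  rw [h]
  refine MeasurableSet.iUnion fun n => (measurableSet_lt measurable_fst measurable_const).inter
    (MeasurableSet.iInter fun m =>
      (measurableSet_lt measurable_fst measurable_const).compl.union
        ((MeasurableSet.const _).compl.union ?_))
  exact ((measurable_pi_apply m).comp measurable_snd) hA

lemma measurableSet_onceIn (hA : MeasurableSet A) : MeasurableSet (onceIn A) := by
  refine (measurableSet_nowIn hA).union ?_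
  have h : {p : ℝ≥0 × (ℕ → EReal) | ∃ n, denseTime n < p.1 ∧ p.2 n ∈ A}
      = ⋃ n, ({p | denseTime n < p.1} ∩ {p | p.2 n ∈ A}) := by
    ext p; simp
  rw [h]
  exact MeasurableSet.iUnion fun n => (measurableSet_lt measurable_const measurable_fst).inter
    (((measurable_pi_apply n).comp measurable_snd) hA)

/-- The value at `t` persists for a while, so it is seen at all dense times shortly after `t`.
Events at a random time are thereby expressed through countably many coordinates of the path. -/
lemma mem_nowIn_iff (hf : RightConstant f) :
    (t, fun n => f (denseTime n)) ∈ nowIn A ↔ f t ∈ A := by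
  obtain ⟨s, hs, hc⟩ := hf t
  constructor
  · rintro ⟨n, h1, h2⟩
    obtain ⟨m, h3, h4⟩ := exists_denseTime_btwn (lt_min hs h1)
    rw [← hc (denseTime m) h3.le (h4.trans_le (min_le_left _ _))]
    exact h2 m h3 (h4.trans_le (min_le_right _ _))
  · intro h
    obtain ⟨n, h1, h2⟩ := exists_denseTime_btwn hs
    refine ⟨n, h1, fun m h3 h4 => ?_⟩
    simp only at h3 ⊢
    rwa [hc _ h3.le (h4.trans h2)]

lemma mem_onceIn_iff (hf : RightConstant f) :
    (t, fun n => f (denseTime n)) ∈ onceIn A ↔ ∃ u ≤ t, f u ∈ A := by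
  rw [onceIn, Set.mem_union, mem_nowIn_iff hf]
  constructor
  · rintro (h | ⟨n, h1, h2⟩)
    · exact ⟨t, le_rfl, h⟩
    · exact ⟨_, h1.le, h2⟩
  · rintro ⟨u, hu, h⟩
    rcases hu.eq_or_lt with rfl | hu
    · exact Or.inl h
    · obtain ⟨s, hs, hc⟩ := hf u
      obtain ⟨m, h3, h4⟩ := exists_denseTime_btwn (lt_min hs hu)
      refine Or.inr ⟨m, h4.trans_le (min_le_right _ _), ?_⟩
      simp only
      rwa [hc _ h3.le (h4.trans_le (min_le_left _ _))]

end DenseTimes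

section Measurability

variable {Ω : Type*} [MeasurableSpace Ω] {S : Params} {P : Measure Ω} {X : Ω → Input}
  {b : Option ℤ} {n₀ : ℤ}

/-- The discount of rate one is strictly decreasing, so the event is a superlevel set of a `weight`,
whose measurability up to null sets is known. The time and the level need no separate treatment. -/
lemma IsInput.nullMeasurableSet_time_level (hX : IsInput S P X) (b : Option ℤ) (n₀ : ℤ) (m : ℕ)
    (v : ℤ) (t : ℝ≥0) : NullMeasurableSet
      {ω | (state S b n₀ (X ω) m).time ≤ t ∧ (state S b n₀ (X ω) m).level = v} P := by
  classical
  have h : {ω | (state S b n₀ (X ω) m).time ≤ t ∧ (state S b n₀ (X ω) m).level = v}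
      = (fun ω => weight 1 (fun i => if i < m then Set.univ else {v}) (state S b n₀ (X ω)) m) ⁻¹'
        Set.Ici (disc 1 t) := by
    ext ω
    have h1 : (∀ i ≤ m, (state S b n₀ (X ω) i).level ∈ if i < m then Set.univ else {v})
        ↔ (state S b n₀ (X ω) m).level = v := by
      constructor
      · intro h
        simpa using h m le_rfl
      · intro h i hi
        split_ifs with h'
        · trivial
        · rw [le_antisymm hi (not_lt.1 h')]
          exact h
    simp only [Set.mem_preimage, Set.mem_Ici, weight, prod_indicator_eq, h1, Set.mem_ofPred_eq]
    split_ifs with h2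
    · simp [h2, disc_le_disc_iff one_pos]
    · simp only [h2, and_false, mul_zero, false_iff, not_le]
      exact disc_pos _ ENNReal.coe_ne_top
  rw [h]
  exact (hX.aemeasurable_weight b n₀ 1 m _).nullMeasurable measurableSet_Ici

lemma IsInput.nullMeasurableSet_time (hX : IsInput S P X) (b : Option ℤ) (n₀ : ℤ) (m : ℕ)
    (t : ℝ≥0) : NullMeasurableSet {ω | (state S b n₀ (X ω) m).time ≤ t} P := by
  have h : {ω | (state S b n₀ (X ω) m).time ≤ t}
      = ⋃ v, {ω | (state S b n₀ (X ω) m).time ≤ t ∧ (state S b n₀ (X ω) m).level = v} := by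
    ext ω; simp
  rw [h]
  exact .iUnion fun v => hX.nullMeasurableSet_time_level b n₀ m v t

lemma IsInput.nullMeasurableSet_path_eq_coe (hX : IsInput S P X) (b : Option ℤ) (n₀ : ℤ)
    (t : ℝ≥0) (v : ℤ) : NullMeasurableSet {ω | path S b n₀ (X ω) t = ((v : ℝ) : EReal)} P := by
  have h : {ω | path S b n₀ (X ω) t = ((v : ℝ) : EReal)}
      = ⋃ m, ({ω | (state S b n₀ (X ω) m).time ≤ t ∧ (state S b n₀ (X ω) m).level = v}
        \ {ω | (state S b n₀ (X ω) (m + 1)).time ≤ t}) := by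
    ext ω
    simp only [Set.mem_ofPred_eq, path_eq_coe_iff, Set.mem_iUnion, Set.mem_sdiff, not_le]
    exact exists_congr fun m => by tauto
  rw [h]
  exact .iUnion fun m => (hX.nullMeasurableSet_time_level b n₀ m v t).diff
    (hX.nullMeasurableSet_time b n₀ (m + 1) t)

lemma IsInput.nullMeasurableSet_path_eq_bot (hX : IsInput S P X) (b : Option ℤ) (n₀ : ℤ)
    (t : ℝ≥0) : NullMeasurableSet {ω | path S b n₀ (X ω) t = ⊥} P := by
  have h : {ω | path S b n₀ (X ω) t = ⊥}
      = (⋂ m, {ω | (state S b n₀ (X ω) m).time ≤ t}) ∩ ⋂ N : ℤ, ⋃ m, ⋃ v : ℤ, ⋃ _ : v < N,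
        {ω | (state S b n₀ (X ω) m).time ≤ t ∧ (state S b n₀ (X ω) m).level = v} := by
    ext ω
    simp only [Set.mem_ofPred_eq, path_eq_bot_iff, Set.mem_iUnion, Set.mem_inter_iff,
      Set.mem_iInter, exists_prop]
    refine and_congr_right fun h => forall_congr' fun N => exists_congr fun m => ?_
    exact ⟨fun h' => ⟨_, h', h m, rfl⟩, fun ⟨v, h1, _, h2⟩ => h2 ▸ h1⟩
  rw [h]
  exact (NullMeasurableSet.iInter fun m => hX.nullMeasurableSet_time b n₀ m t).inter
    (.iInter fun N => .iUnion fun m => .iUnion fun v => .iUnion fun _ =>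
      hX.nullMeasurableSet_time_level b n₀ m v t)

/-- The path takes countably many values, so it suffices to treat the event of each value. -/
lemma IsInput.aemeasurable_path (hX : IsInput S P X) (b : Option ℤ) (n₀ : ℤ) (t : ℝ≥0) :
    AEMeasurable (fun ω => path S b n₀ (X ω) t) P := by
  have hint := hX.nullMeasurableSet_path_eq_coe b n₀ t
  have hbot := hX.nullMeasurableSet_path_eq_bot b n₀ t
  have htop : NullMeasurableSet {ω | path S b n₀ (X ω) t = ⊤} P := by
    have h : {ω | path S b n₀ (X ω) t = ⊤} = ({ω | path S b n₀ (X ω) t = ⊥}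
        ∪ ⋃ v : ℤ, {ω | path S b n₀ (X ω) t = ((v : ℝ) : EReal)})ᶜ := by
      ext ω
      simp only [Set.mem_ofPred_eq, Set.mem_compl_iff, Set.mem_union, Set.mem_iUnion]
      rcases path_cases S b n₀ (X ω) t with h | h | ⟨v, h⟩ <;> simp [h]
    rw [h]
    exact (hbot.union (.iUnion hint)).compl
  refine NullMeasurable.aemeasurable fun s _ => ?_
  have h : (fun ω => path S b n₀ (X ω) t) ⁻¹' s
      = (⋃ _ : (⊤ : EReal) ∈ s, {ω | path S b n₀ (X ω) t = ⊤})
        ∪ ((⋃ _ : (⊥ : EReal) ∈ s, {ω | path S b n₀ (X ω) t = ⊥})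
        ∪ ⋃ v : ℤ, ⋃ _ : ((v : ℝ) : EReal) ∈ s,
          {ω | path S b n₀ (X ω) t = ((v : ℝ) : EReal)}) := by
    ext ω
    simp only [Set.mem_preimage, Set.mem_union, Set.mem_iUnion, exists_prop, Set.mem_ofPred_eq]
    constructor
    · intro hs
      rcases path_cases S b n₀ (X ω) t with h | h | ⟨v, h⟩
      · exact Or.inl ⟨h ▸ hs, h⟩
      · exact Or.inr (Or.inl ⟨h ▸ hs, h⟩)
      · exact Or.inr (Or.inr ⟨v, h ▸ hs, h⟩)
    · rintro (⟨hs, h⟩ | ⟨hs, h⟩ | ⟨v, hs, h⟩) <;> rwa [h]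
  rw [h]
  exact (NullMeasurableSet.iUnion fun _ => htop).union ((NullMeasurableSet.iUnion fun _ =>
    hbot).union (.iUnion fun v => .iUnion fun _ => hint v))

end Measurability

section Independence

variable {Ω : Type*} [MeasurableSpace Ω] {S : Params} {P : Measure Ω} {X : Ω → Input}
  {b : Option ℤ} {n₀ : ℤ} {q : ℝ} {e : Ω → ℝ≥0} {Y : Ω → ℝ≥0 → EReal}

lemma IsExpTime.hasLaw (he : IsExpTime P q e Y) (hq : 0 < q) :
    HasLaw e (expLaw q.toNNReal) P := by
  have h2 : e = Real.toNNReal ∘ fun ω => (e ω : ℝ) := by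
    funext ω; simp
  refine ⟨?_, ?_⟩
  · have h := he.law.aemeasurable.real_toNNReal
    simpa using h
  · rw [h2, ← AEMeasurable.map_map_of_aemeasurable (by fun_prop) he.law.aemeasurable,
      he.law.map_eq, expLaw, Real.coe_toNNReal q hq.le]

lemma IsExpTime.aemeasurable_pair (he : IsExpTime P q e Y) (hq : 0 < q)
    (hY : ∀ t, AEMeasurable (fun ω => Y ω t) P) :
    AEMeasurable (fun ω => (e ω, fun n => Y ω (denseTime n))) P :=
  (he.hasLaw hq).aemeasurable.prodMk (aemeasurable_pi_iff.2 fun _ => hY _)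

/-- The exponential time can be integrated out first. -/
lemma IsExpTime.prob_eq_lintegral [IsProbabilityMeasure P] (he : IsExpTime P q e Y) (hq : 0 < q)
    (hY : ∀ t, AEMeasurable (fun ω => Y ω t) P) {D : Set (ℝ≥0 × (ℕ → EReal))}
    (hD : MeasurableSet D) : P {ω | (e ω, fun n => Y ω (denseTime n)) ∈ D}
      = ∫⁻ ω, expLaw q.toNNReal {t | (t, fun n => Y ω (denseTime n)) ∈ D} ∂P := by
  have hYd : AEMeasurable (fun ω n => Y ω (denseTime n)) P := aemeasurable_pi_iff.2 fun _ => hY _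
  -- Independence of the whole path passes to its values at the dense times. Measurability is known
  -- for each time separately and extends to countably many coordinates only.
  have hind : IndepFun e (fun ω n => Y ω (denseTime n)) P :=
    he.indep.comp (φ := id) (ψ := fun (f : ℝ≥0 → EReal) n => f (denseTime n)) measurable_id
      (measurable_pi_iff.2 fun n => measurable_pi_apply _)
  have := isProbabilityMeasure_expLaw (q := q.toNNReal) (by simpa using hq)
  have h1 := (indepFun_iff_map_prod_eq_prod_map_map (he.hasLaw hq).aemeasurable hYd).1 hind
  have h2 := Measure.map_apply_of_aemeasurable (he.aemeasurable_pair hq hY) hD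
  have := Measure.isProbabilityMeasure_map hYd
  rw [h1, (he.hasLaw hq).map_eq, Measure.prod_apply_symm hD,
    lintegral_map' (measurable_measure_prodMk_right hD).aemeasurable hYd] at h2
  exact h2.symm

end Independence

end PRP

/-! ### The two probabilities and the conclusion -/

namespace PRP

variable {Ω : Type*} [MeasurableSpace Ω] {S : Params} {P : Measure Ω} {X : Ω → Input}
  {n₀ l v : ℤ} {q : ℝ} {e : Ω → ℝ≥0}

/-- Both stopped quantities are proportional at the first visit to `l`. -/
lemma resolvent_stayAt_mul {q : ℝ≥0} (hq : q ≠ 0) (j : ℤ) (r : ℤ → ℝ≥0∞) :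
    outcomeRateTotal S q l
        * resolvent S none q (Set.Ioi l) (cut {l} fun _ => stayAt S none q l v l) j r
      = outcomeRate S q l v
        * resolvent S none q (Set.Ioi l) (cut {l} fun _ r => 1 - passBelow S q l l r) j r := by
  rw [← resolvent_smul (outcomeRateTotal_ne_top hq), ← resolvent_smul (outcomeRate_ne_top hq)]
  congr 1
  funext j r
  simp only [cut]
  rw [mul_left_comm, stayAt_mul_outcomeRateTotal hq, mul_left_comm]

/-- The event that the infimum up to the exponential time is `l`, in terms of the values at the
times `denseTime n`. -/
def infEvent (l : ℤ) : Set (ℝ≥0 × (ℕ → EReal)) :=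
  onceIn (Set.Iio (((l + 1 : ℤ) : ℝ) : EReal)) \ onceIn (Set.Iio ((l : ℝ) : EReal))

lemma measurableSet_infEvent (l : ℤ) : MeasurableSet (infEvent l) :=
  (measurableSet_onceIn measurableSet_Iio).diff (measurableSet_onceIn measurableSet_Iio)

lemma mem_infEvent_iff {b : Option ℤ} {x : Input} {t : ℝ≥0} :
    (t, fun n => path S b n₀ x (denseTime n)) ∈ infEvent l
      ↔ runningInf (path S b n₀ x) t = ((l : ℝ) : EReal) := by
  rw [infEvent, Set.mem_sdiff, mem_onceIn_iff (rightConstant_path S b n₀ x),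
    mem_onceIn_iff (rightConstant_path S b n₀ x), runningInf_path_eq_iff]
  rfl

/-- The infimum is `l` when levels below `l + 1`, but none below `l`, have been entered. The
difference of the two passage probabilities is the term for the first visit to `l` in
`passBelow_succ_eq_add`. -/
lemma prob_runningInf_eq [IsProbabilityMeasure P] (hX : IsInput S P X) (hq : 0 < q)
    (he : IsExpTime P q e fun ω => path S none n₀ (X ω)) :
    P {ω | runningInf (path S none n₀ (X ω)) (e ω) = ((l : ℝ) : EReal)}
      = ∫⁻ z, resolvent S none q.toNNReal (Set.Ioi l)
          (cut {l} fun _ r => 1 - passBelow S q.toNNReal l l r) n₀ (fun n => (z n : ℝ≥0∞))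
          ∂workRow S := by
  have hq' : q.toNNReal ≠ 0 := by simpa using hq
  have := isProbabilityMeasure_expLaw hq'
  have h1 := he.prob_eq_lintegral hq (hX.aemeasurable_path none n₀) (measurableSet_infEvent l)
  simp only [mem_infEvent_iff] at h1
  rw [h1]
  have h2 : ∫⁻ ω, expLaw q.toNNReal {t | runningInf (path S none n₀ (X ω)) t = ((l : ℝ) : EReal)} ∂P
      + ∫⁻ ω, expLaw q.toNNReal (passTimes (state S none n₀ (X ω)) l) ∂P
      = ∫⁻ ω, expLaw q.toNNReal (passTimes (state S none n₀ (X ω)) (l + 1)) ∂P := by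
    rw [← lintegral_add_right' _ (hX.aemeasurable_passTimes hq' none n₀ l)]
    refine lintegral_congr_ae ?_
    filter_upwards [hX.ae_good] with ω hω
    rw [show {t | runningInf (path S none n₀ (X ω)) t = ((l : ℝ) : EReal)}
      = passTimes (state S none n₀ (X ω)) (l + 1) \ passTimes (state S none n₀ (X ω)) l from
      Set.ext fun t => runningInf_eq_iff_passTimes hω]
    rw [← measure_sdiff_add_inter (μ := expLaw q.toNNReal)
      (passTimes (state S none n₀ (X ω)) (l + 1)) (measurableSet_passTimes _ l),
      Set.inter_eq_right.2 (passTimes_mono (by omega))]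
  rw [hX.lintegral_passTimes hq', hX.lintegral_passTimes hq'] at h2
  have hfin : ∫⁻ z, passBelow S q.toNNReal l n₀ (fun n => ((z n : ℝ≥0) : ℝ≥0∞)) ∂workRow S ≠ ⊤ := by
    refine ne_top_of_le_ne_top ENNReal.one_ne_top ?_
    calc _ ≤ ∫⁻ _, 1 ∂workRow S := lintegral_mono fun z => passBelow_le_one hq' _ _
      _ = 1 := by simp
  refine (ENNReal.add_left_inj hfin).1 (h2.trans ?_)
  have hm : Measurable fun z : ℤ → ℝ≥0 =>
      passBelow S q.toNNReal l n₀ (fun n => ((z n : ℝ≥0) : ℝ≥0∞)) :=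
    (levelMeasurable_passBelow n₀).comp measurable_coe_resid
  rw [← lintegral_add_right _ hm]
  refine lintegral_congr fun z => ?_
  rw [passBelow_succ_eq_add hq', add_comm]

/-- Being at `v` with infimum `l` means being there without a visit below `l`, but not without a
visit below `l + 1`. The difference of the two `stayAt` is the term for the first visit to `l` in
`stayAt_eq_add`. -/
lemma prob_runningInf_path_eq [IsProbabilityMeasure P] (hX : IsInput S P X) (hq : 0 < q)
    (he : IsExpTime P q e fun ω => path S none n₀ (X ω)) :
    P ({ω | path S none n₀ (X ω) (e ω) = ((v : ℝ) : EReal)}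
        ∩ {ω | runningInf (path S none n₀ (X ω)) (e ω) = ((l : ℝ) : EReal)})
      = ∫⁻ z, resolvent S none q.toNNReal (Set.Ioi l)
          (cut {l} fun _ => stayAt S none q.toNNReal l v l) n₀ (fun n => (z n : ℝ≥0∞))
          ∂workRow S := by
  have hq' : q.toNNReal ≠ 0 := by simpa using hq
  have := isProbabilityMeasure_expLaw hq'
  have h1 := he.prob_eq_lintegral hq (hX.aemeasurable_path none n₀)
    ((measurableSet_nowIn (measurableSet_singleton ((v : ℝ) : EReal))).inter
      (measurableSet_infEvent l))
  simp only [Set.mem_inter_iff, mem_infEvent_iff, mem_nowIn_iff (rightConstant_path S none n₀ _),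
    Set.mem_singleton_iff] at h1
  rw [← Set.ofPred_and, h1]
  have hst : ∀ l, ∫⁻ ω, expLaw q.toNNReal (stayTimes (state S none n₀ (X ω)) l v) ∂P
      = ∫⁻ z, stayAt S none q.toNNReal l v n₀ (fun n => (z n : ℝ≥0∞)) ∂workRow S := fun l =>
    hX.lintegral_stayTimes hq' none n₀ l v
  have h2 : ∫⁻ ω, expLaw q.toNNReal {t | path S none n₀ (X ω) t = ((v : ℝ) : EReal)
        ∧ runningInf (path S none n₀ (X ω)) t = ((l : ℝ) : EReal)} ∂P
      + ∫⁻ ω, expLaw q.toNNReal (stayTimes (state S none n₀ (X ω)) (l + 1) v) ∂P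
      = ∫⁻ ω, expLaw q.toNNReal (stayTimes (state S none n₀ (X ω)) l v) ∂P := by
    rw [← lintegral_add_right' _ (hX.aemeasurable_stayTimes hq' none n₀ (l + 1) v)]
    refine lintegral_congr_ae ?_
    filter_upwards [hX.ae_good] with ω hω
    have h3 : {t | path S none n₀ (X ω) t = ((v : ℝ) : EReal)
          ∧ runningInf (path S none n₀ (X ω)) t = ((l : ℝ) : EReal)}
        = stayTimes (state S none n₀ (X ω)) l v
          \ stayTimes (state S none n₀ (X ω)) (l + 1) v := by
      ext t
      simp only [Set.mem_ofPred_eq, runningInf_eq_iff_passTimes hω, Set.mem_sdiff,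
        mem_stayTimes_iff]
      tauto
    have h4 : stayTimes (state S none n₀ (X ω)) (l + 1) v
        ⊆ stayTimes (state S none n₀ (X ω)) l v := by
      intro t
      simp only [mem_stayTimes_iff]
      exact fun h => ⟨h.1, fun h' => h.2 (passTimes_mono (by omega) h')⟩
    rw [h3, ← measure_sdiff_add_inter (μ := expLaw q.toNNReal)
      (stayTimes (state S none n₀ (X ω)) l v) (measurableSet_stayTimes _ (l + 1) v),
      Set.inter_eq_right.2 h4]
  rw [hst, hst] at h2
  have hfin : ∫⁻ z, stayAt S none q.toNNReal (l + 1) v n₀ (fun n => ((z n : ℝ≥0) : ℝ≥0∞))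
      ∂workRow S ≠ ⊤ := by
    refine ne_top_of_le_ne_top ENNReal.one_ne_top ?_
    calc _ ≤ ∫⁻ _, 1 ∂workRow S := lintegral_mono fun z => stayAt_le_one hq' _ _
      _ = 1 := by simp
  refine (ENNReal.add_left_inj hfin).1 (h2.trans ?_)
  have hm : Measurable fun z : ℤ → ℝ≥0 =>
      stayAt S none q.toNNReal (l + 1) v n₀ (fun n => ((z n : ℝ≥0) : ℝ≥0∞)) :=
    (levelMeasurable_stayAt n₀).comp measurable_coe_resid
  rw [← lintegral_add_right _ hm]
  refine lintegral_congr fun z => ?_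
  have h3 : stayAt S none q.toNNReal (l + 1) v = resolvent S none q.toNNReal (Set.Ioi l)
      (cut (Set.Ioi l) (cut {v} (killed S none q.toNNReal))) := by rw [stayAt, Ici_add_one]
  rw [stayAt_eq_add, add_comm, h3]

/-- The reflected system is never below `l`, so the restriction built into `stayAt` is void. -/
lemma prob_path_some_eq [IsProbabilityMeasure P] (hX : IsInput S P X) (hq : 0 < q)
    (he : IsExpTime P q e fun ω => path S (some l) l (X ω)) :
    P {ω | path S (some l) l (X ω) (e ω) = ((v : ℝ) : EReal)}
      = ∫⁻ z, stayAt S (some l) q.toNNReal l v l (fun n => (z n : ℝ≥0∞)) ∂workRow S := by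
  have hq' : q.toNNReal ≠ 0 := by simpa using hq
  have h1 := he.prob_eq_lintegral hq (hX.aemeasurable_path (some l) l)
    (measurableSet_nowIn (measurableSet_singleton ((v : ℝ) : EReal)))
  simp only [mem_nowIn_iff (rightConstant_path S (some l) l _), Set.mem_singleton_iff,
    ← mem_stayTimes_some_iff] at h1
  simp only [← mem_stayTimes_some_iff]
  rw [h1, ← hX.lintegral_stayTimes hq' (some l) l l v]
  rfl

lemma outcomeRateTotal_mul_prob [IsProbabilityMeasure P] (hX : IsInput S P X) (hq : 0 < q)
    (he : IsExpTime P q e fun ω => path S none n₀ (X ω)) :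
    outcomeRateTotal S q.toNNReal l * P ({ω | path S none n₀ (X ω) (e ω) = ((v : ℝ) : EReal)}
        ∩ {ω | runningInf (path S none n₀ (X ω)) (e ω) = ((l : ℝ) : EReal)})
      = outcomeRate S q.toNNReal l v
        * P {ω | runningInf (path S none n₀ (X ω)) (e ω) = ((l : ℝ) : EReal)} := by
  have hq' : q.toNNReal ≠ 0 := by simpa using hq
  rw [prob_runningInf_path_eq hX hq he, prob_runningInf_eq hX hq he,
    ← lintegral_const_mul' _ _ (outcomeRateTotal_ne_top hq'),
    ← lintegral_const_mul' _ _ (outcomeRate_ne_top hq')]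
  exact lintegral_congr fun z => resolvent_stayAt_mul hq' _ _

lemma outcomeRateTotal_mul_prob_some [IsProbabilityMeasure P] (hX : IsInput S P X) (hq : 0 < q)
    (he : IsExpTime P q e fun ω => path S (some l) l (X ω)) :
    outcomeRateTotal S q.toNNReal l * P {ω | path S (some l) l (X ω) (e ω) = ((v : ℝ) : EReal)}
      = outcomeRate S q.toNNReal l v := by
  have hq' : q.toNNReal ≠ 0 := by simpa using hq
  rw [prob_path_some_eq hX hq he, ← lintegral_const_mul' _ _ (outcomeRateTotal_ne_top hq')]
  simp only [stayAt_some_mul_outcomeRateTotal hq', lintegral_const, measure_univ, mul_one]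

/-- The conditioning event is shown to be measurable only up to null sets, as the input is known
through laws of almost everywhere measurable functions. -/
lemma cond_apply_of_nullMeasurableSet {s : Set Ω} (hs : NullMeasurableSet s P) (t : Set Ω) :
    ProbabilityTheory.cond P s t = (P s)⁻¹ * P (t ∩ s) := by
  rw [ProbabilityTheory.cond, Measure.smul_apply, Measure.restrict_apply₀' hs, smul_eq_mul]

lemma IsExpTime.nullMeasurableSet_runningInf (hX : IsInput S P X) (hq : 0 < q)
    (he : IsExpTime P q e fun ω => path S none n₀ (X ω)) (l : ℤ) : NullMeasurableSet
      {ω | runningInf (path S none n₀ (X ω)) (e ω) = ((l : ℝ) : EReal)} P := by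
  have h := (he.aemeasurable_pair hq (hX.aemeasurable_path none n₀)).nullMeasurable
    (measurableSet_infEvent l)
  simpa only [Set.preimage, mem_infEvent_iff] using h

lemma sub_coe_eq_coe_iff {x : EReal} {k l : ℤ} :
    x - ((l : ℝ) : EReal) = ((k : ℝ) : EReal) ↔ x = (((k + l : ℤ) : ℝ) : EReal) := by
  induction x with
  | bot => exact iff_of_false (EReal.bot_ne_coe _) (EReal.bot_ne_coe _)
  | top => rw [EReal.top_sub_coe]; exact iff_of_false (EReal.top_ne_coe _) (EReal.top_ne_coe _)
  | coe x =>
    rw [← EReal.coe_sub, EReal.coe_eq_coe_iff, EReal.coe_eq_coe_iff, sub_eq_iff_eq_add]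
    push_cast
    rfl

end PRP

theorem theorem3p1 (S : PRP.Params) (n₀ k l : ℤ) (hk : 0 ≤ k) (hl : l ≤ n₀) (q : ℝ) (hq : 0 < q)
    -- the system `Q`, started at `n₀`
    {Ω : Type*} [MeasurableSpace Ω] (P : Measure Ω) [IsProbabilityMeasure P]
    (X : Ω → PRP.Input) (hX : PRP.IsInput S P X)
    (e : Ω → ℝ≥0) (he : PRP.IsExpTime P q e (fun ω => PRP.Q S n₀ (X ω)))
    -- the system `Q_l`, reflected at `l` and started at `l`
    {Ω' : Type*} [MeasurableSpace Ω'] (P' : Measure Ω') [IsProbabilityMeasure P']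
    (X' : Ω' → PRP.Input) (hX' : PRP.IsInput S P' X')
    (e' : Ω' → ℝ≥0) (he' : PRP.IsExpTime P' q e' (fun ω => PRP.Qrefl S l (X' ω)))
    -- the conditional probabilities make sense
    (hpos : P {ω | PRP.runningInf (PRP.Q S n₀ (X ω)) (e ω) = ((l : ℝ) : EReal)} ≠ 0) :
    P' {ω | PRP.Qrefl S l (X' ω) (e' ω) = (((k + l : ℤ) : ℝ) : EReal)}
      = ProbabilityTheory.cond P
          {ω | PRP.runningInf (PRP.Q S n₀ (X ω)) (e ω) = ((l : ℝ) : EReal)}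
          {ω | PRP.Q S n₀ (X ω) (e ω) = (((k + l : ℤ) : ℝ) : EReal)} ∧
    ProbabilityTheory.cond P
        {ω | PRP.runningInf (PRP.Q S n₀ (X ω)) (e ω) = ((l : ℝ) : EReal)}
        {ω | PRP.Q S n₀ (X ω) (e ω) = (((k + l : ℤ) : ℝ) : EReal)}
      = ProbabilityTheory.cond P
          {ω | PRP.runningInf (PRP.Q S n₀ (X ω)) (e ω) = ((l : ℝ) : EReal)}
          {ω | PRP.Q S n₀ (X ω) (e ω) - PRP.runningInf (PRP.Q S n₀ (X ω)) (e ω)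
            = ((k : ℝ) : EReal)} := by
  have hq' : q.toNNReal ≠ 0 := by simpa using hq
  have hnull := he.nullMeasurableSet_runningInf hX hq l
  have hU := PRP.outcomeRateTotal_mul_prob_some (v := k + l) hX' hq he'
  have hV := PRP.outcomeRateTotal_mul_prob (l := l) (v := k + l) hX hq he
  have h0 := PRP.outcomeRateTotal_ne_zero (S := S) (l := l) hq'
  have htop := PRP.outcomeRateTotal_ne_top (S := S) (l := l) hq'
  unfold PRP.Q PRP.Qrefl at *
  rw [PRP.cond_apply_of_nullMeasurableSet hnull, PRP.cond_apply_of_nullMeasurableSet hnull]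
  constructor
  -- After multiplication by the total outcome rate, both sides equal the outcome rate of `k + l`.
  · refine (ENNReal.mul_right_inj h0 htop).1 ?_
    rw [hU, mul_left_comm, hV, mul_left_comm, ENNReal.inv_mul_cancel hpos (measure_ne_top _ _),
      mul_one]
  -- On the conditioning event the infimum is `l`, so the two events have the same intersection with
  -- it.
  · congr 2
    ext ω
    simp only [Set.mem_inter_iff, Set.mem_ofPred_eq]
    refine and_congr_left fun h => ?_
    rw [h, PRP.sub_coe_eq_coe_iff]
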